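/- **Setting.** Let $n\ge 2$, $N\ge 2$, $b\ge 1$, $\varkappa_1,\dots,\varkappa_N\ge 1$ be integers, $m:=b(\varkappa_1+\dots+\varkappa_N)$, $l_1,\dots,l_m\in\mathbb Z$, $\tau>0$. Let $G\subset\mathbb R^n$ be a bounded domain with $C^\infty$ boundary $\Gamma$, $\Omega:=G\times(0,\tau)$, $S:=\Gamma\times(0,\tau)$; $G$ and $\Gamma$ are also identified with $G\times\{0\}$ and $\Gamma\times\{0\}$. With $D_x^\alpha=\prod_k(i\,\partial/\partial x_k)^{\alpha_k}$ put $$A_{j,k}=\sum_{|\alpha|+2b\beta\le 2b\varkappa_k}a_{j,k}^{\alpha,\beta}(x,t)D_x^\alpha\partial_t^\beta,\qquad B_{j,k}=\sum_{|\alpha|+2b\beta\le l_j+2b\varkappa_k}b_{j,k}^{\alpha,\beta}(x,t)D_x^\alpha\partial_t^\beta,$$ with $a_{j,k}^{\alpha,\beta}\in C^\infty(\overline\Omega)$, $b_{j,k}^{\alpha,\beta}\in C^\infty(\overline S)$ ($B_{j,k}=0$ if $l_j+2b\varkappa_k<0$), and consider the problem $$\sum_kA_{j,k}u_k=f_j\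 \text{in }\Omega\ (1\le j\le N),\quad \sum_kB_{j,k}u_k=g_j\ \text{on }S\ (1\le j\le m),\quad \partial_t^ru_k|_{t=0}=h_{k,r}\ \text{on }G\ (1\le k\le N,\ 0\le r<\varkappa_k).$$ Write $\Lambda u=(f,g,h)$ for the left-hand sides. The problem is assumed to be Petrovskii parabolic. Let $A^\circ,B^\circ$ be the matrices of principal symbols (the terms with $|\alpha|+2b\beta=2b\varkappa_k$, resp. $=l_j+2b\varkappa_k$, with $D_x,\partial_t$ replaced by $\xi,p$). Then: (1) for some $\delta>0$ and all $(x,t)\in\overline\Omega$, $\xi\in\mathbb R^n$, every root $p$ of $\det A^\circ(x,t,\xi,p)$ satisfies $\mathrm{Re}\,p\le-\delta|\xi|^{2b}$; (2) $a_{j,k}^{0,\varkappa_k}\equiv\delta_{j,k}$; (3) for some $\delta_1\in(0,\delta)$ and all $x\in\Gamma$ with unit inward normal $\nu$, $t\in[0,\tau]$, $\xi\in\mathbb R^n$ with $\xi\perp\nu$, $p\in\mathbb C$ with $\mathrm{Re}\,p\ge-\delta_1|\xi|^{2b}$ and $|\xi|+|p|>0$, the rows of $B^\circ\cdot\mathrm{adj}A^\circ$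 at $(x,t,\xi+\zeta\nu,p)$ are linearly independent modulo $\prod(\zeta-\zeta^+)$, the product over the roots $\zeta^+$ of $\det A^\circ(x,t,\xi+\zeta\nu,p)$ with positive imaginary part. **Spaces.** $\mathcal M$ is the class of Borel functions $\varphi:[1,\infty)\to(0,\infty)$ such that $\varphi,1/\varphi$ are bounded on every $[1,c]$ and $\varphi(\lambda y)/\varphi(y)\to1$ as $y\to\infty$ for every $\lambda>0$. $H^{s,s/(2b);\varphi}(\mathbb R^{k})$ consists of the tempered distributions $w$ whose Fourier transform is locally integrable with $\int(1+|\xi|^2+|\eta|^{1/b})^s\varphi^2((1+|\xi|^2+|\eta|^{1/b})^{1/2})|\widetilde w(\xi,\eta)|^2\,d\xi\,d\eta<\infty$ ($\xi\in\mathbb R^{k-1}$, $\eta\in\mathbb R$); $H^{s;\varphi}(\mathbb R^k)$ is its isotropic analogue with the weight built on $1+|\xi|^2$. On an open set one takes restrictions with the quotient norm, and $H^{s,s/(2b);\varphi}(S)$ is defined through a finite atlas $\theta_j:\mathbb R^{n-1}\leftrightarrow\Gamma_j$ of $\Gamma$ and a subordinate partition of unity, from the spaces on $\mathbb R^{n-1}\times(0,\tau)$.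 The index $\varphi$ is omitted if $\varphi\equiv1$. Put $$\mathcal H^{s,s/(2b);\varphi}:=(H^{s,s/(2b);\varphi}(\Omega))^N\oplus\bigoplus_{j}H^{s-l_j-1/2,(s-l_j-1/2)/(2b);\varphi}(S)\oplus\bigoplus_{k,r}H^{s+2b\varkappa_k-2br-b;\varphi}(G),$$ $\sigma_0:=\max\{0,l_1+1,\dots,l_m+1\}$ and $E:=\{(2l+1)b+l_j+1/2:\ l\ge0,\ 1\le j\le m\}\cap(\sigma_0,\infty)$. For $s>\sigma_0$, $s\notin E$, let $\mathcal Q^{s,s/(2b);\varphi}$ be the subspace of all $(f,g,h)\in\mathcal H^{s,s/(2b);\varphi}$ satisfying, for all $j$ and all integers $0\le r<(s-l_j-1/2-b)/(2b)$, the compatibility conditions $$\partial_t^rg_j|_{t=0}=\sum_{i}\sum_{|\alpha|+2b\beta\le l_j+2b\varkappa_i}\sum_{q=0}^r\binom rq(\partial_t^{r-q}b_{j,i}^{\alpha,\beta})|_{t=0}\,D_x^\alpha v_{i,\beta+q}\quad\text{on }\Gamma$$ in the sense of traces, where $v_{i,\mu}=h_{i,\mu}$ for $\mu<\varkappa_i$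 and, for $\mu\ge\varkappa_i$, $$v_{i,\mu}=-\sum_k\sum_{|\alpha|+2b\beta\le2b\varkappa_k,\ \beta<\varkappa_k}\ \sum_{q=0}^{\mu-\varkappa_i}\binom{\mu-\varkappa_i}q(\partial_t^{\mu-\varkappa_i-q}a_{i,k}^{\alpha,\beta})|_{t=0}\,D_x^\alpha v_{k,\beta+q}+(\partial_t^{\mu-\varkappa_i}f_i)|_{t=0}.$$ For $s\in E$ let $\mathcal Q^{s,s/(2b);\varphi}:=[\mathcal Q^{s-\varepsilon,(s-\varepsilon)/(2b);\varphi},\mathcal Q^{s+\varepsilon,(s+\varepsilon)/(2b);\varphi}]_{1/2}$ (quadratic interpolation with parameter $1/2$, i.e. the domain of $J^{1/2}$ where $J$ is the positive-definite self-adjoint operator in the first space whose domain is the second one and which satisfies $\|Jv\|_0=\|v\|_1$), with an arbitrary $\varepsilon\in(0,1/2)$. A vector function $u\in\bigoplus_kH^{\sigma_0+2b\varkappa_k,(\sigma_0+2b\varkappa_k)/(2b)}(\Omega)$ is a (generalized) solution with right-hand sides $(f,g,h)$ if $\Lambda u=(f,g,h)$, where $\Lambda$ is extended by continuity from $(C^\infty(\overline\Omega))^N$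 to a bounded operator from this space to $\mathcal H^{\sigma_0,\sigma_0/(2b)}$. Let $U\subset\mathbb R^{n+1}$ be open with $\Omega_0:=U\cap\Omega\ne\emptyset$ and $U\cap\Gamma=\emptyset$; put $\Omega':=U\cap\partial\overline\Omega$, $S_0:=U\cap S$, $S':=U\cap(\Gamma\times\{\tau\})$, $G_0:=U\cap G$. The right-hand sides satisfy the *local conditions* for $s,\varphi$ on $U$ if for all $j,k,r$: $\chi f_j\in H^{s,s/(2b);\varphi}(\Omega)$ whenever $\chi\in C^\infty(\overline\Omega)$, $\mathrm{supp}\,\chi\subset\Omega_0\cup\Omega'$; $\chi g_j\in H^{s-l_j-1/2,(s-l_j-1/2)/(2b);\varphi}(S)$ whenever $\chi\in C^\infty(\overline S)$, $\mathrm{supp}\,\chi\subset S_0\cup S'$; and $\chi h_{k,r}\in H^{s+2b\varkappa_k-2br-b;\varphi}(G)$ whenever $\chi\in C^\infty(\overline G)$, $\mathrm{supp}\,\chi\subset G_0$. **Statement.** Let $p\in\mathbb Z$ be such that $s:=p+b+n/2>\sigma_0$ and $p+2b\varkappa_k\ge0$ for some $k$. For $\varphi\in\mathcal M$ and $U$ as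 above consider the assertions (G) every solution $u$ with right-hand sides $(f,g,h)\in\mathcal Q^{s,s/(2b);\varphi}$ has the property that, for all $k,\alpha,\beta$ with $|\alpha|+2b\beta\le p+2b\varkappa_k$, the distribution $D_x^\alpha\partial_t^\beta u_k$ on $\Omega$ is given by a function continuous on $\overline\Omega$; (L) every solution $u$ whose right-hand sides satisfy the local conditions for $s,\varphi$ on $U$ has the property that, for all $k,\alpha,\beta$ with $|\alpha|+2b\beta\le p+2b\varkappa_k$, the distribution $D_x^\alpha\partial_t^\beta u_k$ is given on $\Omega_0$ by a function continuous on $\Omega_0\cup\Omega'$. If $\varphi\in\mathcal M$ and (G) holds, then $\int_1^\infty\frac{dy}{y\,\varphi^2(y)}<\infty$. If $\varphi\in\mathcal M$ and (L) holds for some $U$ as above, then likewise $\int_1^\infty\frac{dy}{y\,\varphi^2(y)}<\infty$. In particular, for $\varphi\equiv1$ (Sobolev spaces) assertion (G) is false, and (L) is false for every such $U$. -/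

import Mathlib

open MeasureTheory Filter Topology Set
open scoped ENNReal ContDiff SchwartzMap FourierTransform InnerProductSpace

noncomputable section

namespace Parabolic

/-! ### Function parameters -/

/-- The class `𝓜`: Borel functions `φ : [1, ∞) → (0, ∞)` such that `φ` and `1 / φ` are bounded on
every `[1, c]` and `φ` varies slowly at infinity. Only the values of `φ` on `[1, ∞)` matter. -/
structure ClassM (φ : ℝ → ℝ) : Prop where
  measurable : Measurable fun y : Ici (1 : ℝ) => φ y
  pos : ∀ y, 1 ≤ y → 0 < φ y
  bdd : ∀ c, 1 < c → BddAbove (φ '' Icc 1 c)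
  bdd_inv : ∀ c, 1 < c → BddAbove ((fun y => 1 / φ y) '' Icc 1 c)
  slow : ∀ r, 0 < r → Tendsto (fun y => φ (r * y) / φ y) atTop (𝓝 1)

/-- `∫₁^∞ dy / (y φ²(y)) < ∞`. -/
def IntegralCondition (φ : ℝ → ℝ) : Prop :=
  ∫⁻ y in Ioi (1 : ℝ), ENNReal.ofReal (1 / (y * φ y ^ 2)) < ⊤

/-! ### Space-time -/

/-- The Euclidean space `ℝ^d`. -/
abbrev Sp (d : ℕ) : Type := EuclideanSpace ℝ (Fin d)

/-- The Euclidean space `ℝ^(d+1)` of points `(x, t)` with `x ∈ ℝ^d` and `t ∈ ℝ`. -/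
abbrev SpT (d : ℕ) : Type := WithLp 2 (Sp d × ℝ)

/-- The point `(x, t)`. -/
def pt {d : ℕ} (x : Sp d) (t : ℝ) : SpT d := WithLp.toLp 2 (x, t)

/-- The spatial derivative of multi-order `α`, taken along the vectors `e i`. -/
def iterPartial {Y : Type*} [NormedAddCommGroup Y] [NormedSpace ℝ Y] {d : ℕ}
    (e : Fin d → Y) (α : Fin d → ℕ) (f : Y → ℂ) : Y → ℂ :=
  (List.finRange d).foldr (fun i g => (fun (k : Y → ℂ) y => fderiv ℝ k y (e i))^[α i] g) f

/-- `∂_t^β f` on space-time. -/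
def dt {d : ℕ} (β : ℕ) (f : SpT d → ℂ) : SpT d → ℂ :=
  (fun (k : SpT d → ℂ) z => fderiv ℝ k z (pt 0 1))^[β] f

/-- `∂_x^α ∂_t^β f` on space-time. -/
def dxt {d : ℕ} (α : Fin d → ℕ) (β : ℕ) (f : SpT d → ℂ) : SpT d → ℂ :=
  iterPartial (fun i => pt (EuclideanSpace.single i 1) 0) α (dt β f)

/-- `D_x^α ∂_t^β f` on space-time, where `D_k = i ∂/∂x_k`. -/
def Dxt {d : ℕ} (α : Fin d → ℕ) (β : ℕ) (f : SpT d → ℂ) : SpT d → ℂ :=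
  fun z => Complex.I ^ (∑ i, α i) * dxt α β f z

/-- `D_x^α v` on space. -/
def Dx {d : ℕ} (α : Fin d → ℕ) (v : Sp d → ℂ) : Sp d → ℂ :=
  fun x => Complex.I ^ (∑ i, α i) * iterPartial (fun i => EuclideanSpace.single i (1 : ℝ)) α v x

/-- All `(α, β)` with `|α| + 2bβ ≤ M` (none if `M < 0`). The filter below does not depend on the
finite box when `b ≥ 1`. -/
def idxLE (d b : ℕ) (M : ℤ) : Finset ((Fin d → ℕ) × ℕ) :=
  ((Fintype.piFinset fun _ => Finset.range (M.toNat + 1)) ×ˢ Finset.range (M.toNat + 1)).filter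
    fun q => ((∑ i, q.1 i : ℕ) : ℤ) + 2 * b * q.2 ≤ M

/-- All `(α, β)` with `|α| + 2bβ = M`. -/
def idxEQ (d b : ℕ) (M : ℤ) : Finset ((Fin d → ℕ) × ℕ) :=
  (idxLE d b M).filter fun q => ((∑ i, q.1 i : ℕ) : ℤ) + 2 * b * q.2 = M

/-! ### Sobolev spaces of generalized smoothness -/

section Spaces

variable {Z : Type*} [NormedAddCommGroup Z] [InnerProductSpace ℝ Z] [FiniteDimensional ℝ Z]
  [MeasurableSpace Z] [BorelSpace Z]

/-- The Fourier transform of the tempered distribution `w` is the locally integrable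
function `F`. -/
def IsFourierDensity (w : 𝓢'(Z, ℂ)) (F : Z → ℂ) : Prop :=
  LocallyIntegrable F ∧
    ∀ g : 𝓢(Z, ℂ), HasCompactSupport (g : Z → ℂ) → (𝓕 w) g = ∫ z, F z * g z

/-- The norm `(∫ r(ζ)^{2s} φ²(r(ζ)) |ŵ(ζ)|² dζ)^{1/2}` of a tempered distribution; it is `∞` if `ŵ`
is not a locally integrable function. The factor `2π` passes from the frequency used by
the Fourier transform `∫ w(z) e^{-2πi z·ζ} dz` of the library to the angular frequency of
`∫ w(z) e^{-i z·ζ} dz`. -/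
def hNorm (r : Z → ℝ) (s : ℝ) (φ : ℝ → ℝ) (w : 𝓢'(Z, ℂ)) : ℝ≥0∞ :=
  ⨅ (F : Z → ℂ) (_ : IsFourierDensity w F),
    (∫⁻ z, ENNReal.ofReal (r ((2 * Real.pi) • z) ^ s * φ (r ((2 * Real.pi) • z))) ^ 2
      * ‖F z‖ₑ ^ 2) ^ (1 / 2 : ℝ)

/-- The restriction of `w` to the open set `U` is the (locally integrable) function `v`. -/
def RestrictsTo (w : 𝓢'(Z, ℂ)) (U : Set Z) (v : Z → ℂ) : Prop :=
  LocallyIntegrableOn v U ∧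
    ∀ g : 𝓢(Z, ℂ), HasCompactSupport (g : Z → ℂ) → tsupport (g : Z → ℂ) ⊆ U →
      w g = ∫ z, v z * g z

/-- The norm of `v` in the space of restrictions to `U`: the infimum of the norms of all
extensions (`∞` if there are none). All spaces occurring below have order `s > 0`, or `s = 0` and
`φ = 1`; their elements are square-integrable functions, so that nothing is lost by
taking `v` to be a function (only its values on `U` matter). -/
def hNormOn (r : Z → ℝ) (s : ℝ) (φ : ℝ → ℝ) (U : Set Z) (v : Z → ℂ) : ℝ≥0∞ :=
  ⨅ (w : 𝓢'(Z, ℂ)) (_ : RestrictsTo w U v), hNorm r s φ w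

end Spaces

/-- `(1 + |ξ|²)^{1/2}`. -/
def isoBase {d : ℕ} (ξ : Sp d) : ℝ := Real.sqrt (1 + ‖ξ‖ ^ 2)

/-- `(1 + |ξ|² + |η|^{1/b})^{1/2}`. -/
def anisoBase {d : ℕ} (b : ℕ) (ζ : SpT d) : ℝ :=
  Real.sqrt (1 + ‖ζ.fst‖ ^ 2 + |ζ.snd| ^ (1 / (b : ℝ)))

/-! ### Quadratic interpolation with parameter `1/2` -/

section Interpolation

variable {V : Type} [AddCommGroup V] [Module ℂ V]
variable {H : Type} [NormedAddCommGroup H] [InnerProductSpace ℂ H] [CompleteSpace H]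

/-- `π` identifies the space `X` with norm `N` (modulo vectors of norm zero) with the Hilbert
space `H`. -/
def IsHilbertRealization (X : Set V) (N : V → ℝ≥0∞) (π : V →ₗ[ℂ] H) : Prop :=
  (∀ v ∈ X, ‖π v‖ₑ = N v) ∧ π '' X = univ

/-- `J` is the positive-definite self-adjoint operator in (the realization `H` of) `X₀` with domain
`X₁` such that `‖J v‖_{X₀} = ‖v‖_{X₁}`. -/
def IsGenerator (X₁ : Set V) (N₁ : V → ℝ≥0∞) (π : V →ₗ[ℂ] H) (J : H →ₗ.[ℂ] H) : Prop :=
  IsSelfAdjoint J ∧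
  (∃ c : ℝ, 0 < c ∧ ∀ x : J.domain, c * ‖(x : H)‖ ^ 2 ≤ (⟪J x, (x : H)⟫_ℂ).re) ∧
  (J.domain : Set H) = π '' X₁ ∧
  ∀ v ∈ X₁, ∀ h : π v ∈ J.domain, ‖J ⟨π v, h⟩‖ₑ = N₁ v

/-- `R = J^{1/2}`: the operator `R` is self-adjoint and nonnegative, and `R² = J`. -/
def IsSquareRoot (R J : H →ₗ.[ℂ] H) : Prop :=
  IsSelfAdjoint R ∧
  (∀ x : R.domain, 0 ≤ (⟪R x, (x : H)⟫_ℂ).re) ∧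
  (∀ x : H, x ∈ J.domain ↔ ∃ h : x ∈ R.domain, R ⟨x, h⟩ ∈ R.domain) ∧
  ∀ (x : H) (hJ : x ∈ J.domain) (hR : x ∈ R.domain) (hRR : R ⟨x, hR⟩ ∈ R.domain),
    J ⟨x, hJ⟩ = R ⟨R ⟨x, hR⟩, hRR⟩

/-- The interpolation space `[X₀, X₁]_{1/2}`, i.e. the domain of `J^{1/2}` in `X₀`. For a regular pair
of Hilbert spaces the realization `H` exists and is unique up to a unitary operator, and `J`
and its square root exist and are unique; so it does not matter which realization is used. -/
def interpHalf (X₀ X₁ : Set V) (N₀ N₁ : V → ℝ≥0∞) : Set V :=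
  {v | v ∈ X₀ ∧ ∀ (H : Type) [NormedAddCommGroup H] [InnerProductSpace ℂ H] [CompleteSpace H]
    (π : V →ₗ[ℂ] H) (J R : H →ₗ.[ℂ] H), IsHilbertRealization X₀ N₀ π → IsGenerator X₁ N₁ π J →
      IsSquareRoot R J → π v ∈ R.domain}

end Interpolation

/-! ### Domains with smooth boundary -/

/-- `ρ` is a smooth function with nonvanishing gradient on the neighbourhood `O` of `x` such that
`G` is given by `ρ > 0` in `O`. -/
def IsLocalDefining {d : ℕ} (G : Set (Sp d)) (x : Sp d) (O : Set (Sp d)) (ρ : Sp d → ℝ) : Prop :=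
  IsOpen O ∧ x ∈ O ∧ ContDiff ℝ ∞ ρ ∧ (∀ y ∈ O, fderiv ℝ ρ y ≠ 0) ∧ G ∩ O = {y ∈ O | 0 < ρ y}

/-- The boundary of `G` is infinitely smooth. -/
def HasSmoothBoundary {d : ℕ} (G : Set (Sp d)) : Prop :=
  ∀ x ∈ frontier G, ∃ O ρ, IsLocalDefining G x O ρ

/-- `ν` is the unit inward normal to `∂G` at `x`. -/
def IsInwardNormal {d : ℕ} (G : Set (Sp d)) (x ν : Sp d) : Prop :=
  ∃ O ρ, IsLocalDefining G x O ρ ∧ ν = ‖gradient ρ x‖⁻¹ • gradient ρ x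

/-- A finite atlas of `Γ = ∂G` formed by smooth charts `θ j : ℝ^{d-1} ↔ Γ_j`, with a
subordinate smooth partition of unity `χ j` on `Γ`. -/
structure BoundaryAtlas {d : ℕ} (G : Set (Sp d)) where
  card : ℕ
  θ : Fin card → Sp (d - 1) → Sp d
  χ : Fin card → Sp d → ℂ
  θ_smooth : ∀ j, ContDiff ℝ ∞ (θ j)
  θ_embedding : ∀ j, IsEmbedding (θ j)
  θ_immersion : ∀ j y, Function.Injective (fderiv ℝ (θ j) y)
  θ_open : ∀ j, ∃ O, IsOpen O ∧ range (θ j) = O ∩ frontier G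
  θ_cover : ⋃ j, range (θ j) = frontier G
  χ_smooth : ∀ j, ContDiff ℝ ∞ (χ j)
  χ_supp : ∀ j, closure (Function.support (χ j) ∩ frontier G) ⊆ range (θ j)
  χ_sum : ∀ x ∈ frontier G, ∑ j, χ j x = 1

/-- The surface measure on `∂G`. -/
def surfaceMeasure {d : ℕ} (G : Set (Sp d)) : Measure (Sp d) :=
  (Measure.hausdorffMeasure ((d : ℝ) - 1)).restrict (frontier G)

/-- The surface measure on the lateral surface `∂G × (0, τ)`. -/
def lateralMeasure {d : ℕ} (G : Set (Sp d)) (τ : ℝ) : Measure (SpT d) :=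
  Measure.map (WithLp.toLp 2) ((surfaceMeasure G).prod (volume.restrict (Ioo 0 τ)))

/-- The norm in `H^{s,s/(2b);φ}(S)`, `s > 0`, of the function `η` on the lateral surface (`∞` if `η`
does not belong to this space). -/
def hNormS {d : ℕ} {G : Set (Sp d)} (𝒜 : BoundaryAtlas G) (b : ℕ) (τ s : ℝ) (φ : ℝ → ℝ)
    (η : SpT d → ℂ) : ℝ≥0∞ :=
  ⨅ (_ : MemLp η 2 (lateralMeasure G τ)),
    (∑ j, hNormOn (anisoBase b) s φ {z : SpT (d - 1) | z.snd ∈ Ioo 0 τ}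
      (fun z => 𝒜.χ j (𝒜.θ j z.fst) * η (pt (𝒜.θ j z.fst) z.snd)) ^ 2) ^ (1 / 2 : ℝ)

/-! ### The parabolic problem -/

/-- The data of the initial-boundary-value problem. The coefficients, smooth on the
closed cylinder and on its closed lateral surface, are represented by smooth extensions to
`ℝ^{n+1}`. -/
structure Problem where
  n : ℕ
  N : ℕ
  b : ℕ
  ϰ : Fin N → ℕ
  l : Fin (b * ∑ k, ϰ k) → ℤ
  G : Set (Sp n)
  τ : ℝ
  /-- the coefficients `a_{j,k}^{α,β}` -/
  a : Fin N → Fin N → (Fin n → ℕ) → ℕ → SpT n → ℂ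
  /-- the coefficients `b_{j,k}^{α,β}` -/
  c : Fin (b * ∑ k, ϰ k) → Fin N → (Fin n → ℕ) → ℕ → SpT n → ℂ

namespace Problem

variable (P : Problem)

/-- The number `m = b (ϰ_1 + ⋯ + ϰ_N)` of boundary conditions. -/
abbrev m : ℕ := P.b * ∑ k, P.ϰ k

/-- The cylinder `Ω = G × (0, τ)`. -/
def Ω : Set (SpT P.n) := {z | z.fst ∈ P.G ∧ z.snd ∈ Ioo 0 P.τ}

/-- The principal symbol `A°_{j,k}(z, ξ, p)`, for `ξ` and `p` in a commutative `ℂ`-algebra. -/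
def symA {R : Type} [CommRing R] [Algebra ℂ R] (z : SpT P.n) (ξ : Fin P.n → R) (p : R) :
    Matrix (Fin P.N) (Fin P.N) R :=
  Matrix.of fun j k => ∑ q ∈ idxEQ P.n P.b (2 * P.b * P.ϰ k),
    algebraMap ℂ R (P.a j k q.1 q.2 z) * (∏ i, ξ i ^ q.1 i) * p ^ q.2

/-- The principal symbol `B°_{j,k}(z, ξ, p)`. -/
def symB {R : Type} [CommRing R] [Algebra ℂ R] (z : SpT P.n) (ξ : Fin P.n → R) (p : R) :
    Matrix (Fin P.m) (Fin P.N) R :=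
  Matrix.of fun j k => ∑ q ∈ idxEQ P.n P.b (P.l j + 2 * P.b * P.ϰ k),
    algebraMap ℂ R (P.c j k q.1 q.2 z) * (∏ i, ξ i ^ q.1 i) * p ^ q.2

/-- All roots `p` of `det A°(x, t, ξ, p)` satisfy `Re p ≤ -δ |ξ|^{2b}`. -/
def RootCondition (δ : ℝ) : Prop :=
  ∀ x ∈ closure P.G, ∀ t ∈ Icc 0 P.τ, ∀ (ξ : Sp P.n) (p : ℂ),
    (P.symA (pt x t) (fun i => (ξ i : ℂ)) p).det = 0 → p.re ≤ -δ * ‖ξ‖ ^ (2 * P.b)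

open Polynomial in
/-- The vector `ξ + ζ ν` of polynomials in `ζ`. -/
def lineVec {d : ℕ} (ξ ν : Sp d) (i : Fin d) : ℂ[X] := C (ξ i : ℂ) + X * C (ν i : ℂ)

open Polynomial in
/-- The product of `ζ - ζ⁺` over all roots `ζ⁺` of `q` with positive imaginary part, counted with
multiplicity. -/
def plusFactor (q : ℂ[X]) : ℂ[X] :=
  open Classical in ((q.roots.filter fun r => 0 < r.im).map fun r => X - C r).prod

open Polynomial in
/-- The boundary operators cover the system on the lateral surface: the rows of
`B°(x, t, ξ + ζ ν, p) · adj A°(x, t, ξ + ζ ν, p)` are linearly independent modulo `∏ (ζ - ζ_j⁺)`. -/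
def CoveringCondition (δ₁ : ℝ) : Prop :=
  ∀ x ∈ frontier P.G, ∀ t ∈ Icc 0 P.τ, ∀ ν, IsInwardNormal P.G x ν →
    ∀ (ξ : Sp P.n) (p : ℂ), ⟪ξ, ν⟫_ℝ = 0 → -δ₁ * ‖ξ‖ ^ (2 * P.b) ≤ p.re → 0 < ‖ξ‖ + ‖p‖ →
      ∀ w : Fin P.m → ℂ,
        (∀ k, plusFactor (P.symA (pt x t) (lineVec ξ ν) (C p)).det ∣
          ∑ j, C (w j) * (P.symB (pt x t) (lineVec ξ ν) (C p) *
            (P.symA (pt x t) (lineVec ξ ν) (C p)).adjugate) j k) →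
        w = 0

/-- The standing assumptions: a Petrovskii parabolic problem with smooth coefficients in a bounded
cylinder over a domain with smooth boundary. -/
structure IsParabolic : Prop where
  two_le_n : 2 ≤ P.n
  two_le_N : 2 ≤ P.N
  b_pos : 1 ≤ P.b
  ϰ_pos : ∀ k, 1 ≤ P.ϰ k
  τ_pos : 0 < P.τ
  G_open : IsOpen P.G
  G_connected : IsConnected P.G
  G_bounded : Bornology.IsBounded P.G
  G_smooth : HasSmoothBoundary P.G
  a_smooth : ∀ j k α β, ContDiff ℝ ∞ (P.a j k α β)
  c_smooth : ∀ j k α β, ContDiff ℝ ∞ (P.c j k α β)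
  leading : ∀ j k, ∀ z ∈ closure P.Ω, P.a j k 0 (P.ϰ k) z = if j = k then 1 else 0
  parabolic : ∃ δ, 0 < δ ∧ P.RootCondition δ ∧ ∃ δ₁, 0 < δ₁ ∧ δ₁ < δ ∧ P.CoveringCondition δ₁

/-- Right-hand sides `(f, g, h)`: `f` is considered on `Ω`, `g` on `S`, and `h` on `G`. -/
abbrev RHS : Type :=
  (Fin P.N → SpT P.n → ℂ) × (Fin P.m → SpT P.n → ℂ) × ((k : Fin P.N) → Fin (P.ϰ k) → Sp P.n → ℂ)

/-- The mapping `Λ u = (Au, Bu, Cu|_{t=0})` on smooth functions. -/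
def Λ (u : Fin P.N → SpT P.n → ℂ) : P.RHS :=
  (fun j z => ∑ k, ∑ q ∈ idxLE P.n P.b (2 * P.b * P.ϰ k),
      P.a j k q.1 q.2 z * Dxt q.1 q.2 (u k) z,
   fun j z => ∑ k, ∑ q ∈ idxLE P.n P.b (P.l j + 2 * P.b * P.ϰ k),
      P.c j k q.1 q.2 z * Dxt q.1 q.2 (u k) z,
   fun k r x => dt r (u k) (pt x 0))

/-- `σ₀ = max {0, l_1 + 1, …, l_m + 1}`. -/
def σ₀ : ℕ := Finset.univ.sup fun j => (P.l j + 1).toNat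

/-- The norm in `H^{s,s/(2b);φ}(Ω)`. -/
def normΩ (s : ℝ) (φ : ℝ → ℝ) (v : SpT P.n → ℂ) : ℝ≥0∞ := hNormOn (anisoBase P.b) s φ P.Ω v

/-- The norm in `H^{s;φ}(G)`. -/
def normG (s : ℝ) (φ : ℝ → ℝ) (v : Sp P.n → ℂ) : ℝ≥0∞ := hNormOn isoBase s φ P.G v

variable (𝒜 : BoundaryAtlas P.G)

/-- The norm in `H^{s,s/(2b);φ}(S)`. -/
def normS (s : ℝ) (φ : ℝ → ℝ) (η : SpT P.n → ℂ) : ℝ≥0∞ := hNormS 𝒜 P.b P.τ s φ η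

/-- The norm in the space `𝓗^{s,s/(2b);φ}` of right-hand sides. -/
def normH (s : ℝ) (φ : ℝ → ℝ) (y : P.RHS) : ℝ≥0∞ :=
  (∑ j, P.normΩ s φ (y.1 j) ^ 2 + ∑ j, P.normS 𝒜 (s - P.l j - 1 / 2) φ (y.2.1 j) ^ 2 +
    ∑ k, ∑ r : Fin (P.ϰ k),
      P.normG (s + 2 * P.b * P.ϰ k - 2 * P.b * r - P.b) φ (y.2.2 k r) ^ 2) ^ (1 / 2 : ℝ)

/-- The vector function `u` belongs to `⨁_k H^{s+2bϰ_k,(s+2bϰ_k)/(2b);φ}(Ω)`. -/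
def MemDomain (s : ℝ) (φ : ℝ → ℝ) (u : Fin P.N → SpT P.n → ℂ) : Prop :=
  ∀ k, P.normΩ (s + 2 * P.b * P.ϰ k) φ (u k) < ⊤

/-- `u` is a generalized solution with right-hand sides `y = (f, g, h)`: `u` belongs to
`⨁_k H^{σ₀+2bϰ_k,(σ₀+2bϰ_k)/(2b)}(Ω)` and `Λ u = y` for the extension by continuity of `Λ` from smooth
functions to a bounded operator from this space to `𝓗^{σ₀,σ₀/(2b)}`. -/
def IsSolution (u : Fin P.N → SpT P.n → ℂ) (y : P.RHS) : Prop :=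
  P.MemDomain P.σ₀ 1 u ∧
  ∃ U : ℕ → Fin P.N → SpT P.n → ℂ, (∀ i k, ContDiff ℝ ∞ (U i k)) ∧
    (∀ k, Tendsto (fun i => P.normΩ (P.σ₀ + 2 * P.b * P.ϰ k) 1 (u k - U i k)) atTop (𝓝 0)) ∧
    Tendsto (fun i => P.normH 𝒜 P.σ₀ 1 (y - P.Λ (U i))) atTop (𝓝 0)

/-! ### Compatibility conditions -/

/-- All components of the right-hand sides are (restrictions of) smooth functions. -/
def SmoothRHS (y : P.RHS) : Prop :=
  (∀ j, ContDiff ℝ ∞ (y.1 j)) ∧ (∀ j, ContDiff ℝ ∞ (y.2.1 j)) ∧ ∀ k r, ContDiff ℝ ∞ (y.2.2 k r)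

/-- The functions `v_{i,μ}`, which the recurrent formulas determine from smooth right-hand sides:
they express `∂_t^μ u_i(·, 0)` through `f` and `h`. -/
def IsInitialJet (y : P.RHS) (v : Fin P.N → ℕ → Sp P.n → ℂ) : Prop :=
  (∀ i (μ : Fin (P.ϰ i)), v i μ = y.2.2 i μ) ∧
  ∀ i (ρ : ℕ) (x : Sp P.n), v i (P.ϰ i + ρ) x =
    -(∑ k, ∑ q ∈ (idxLE P.n P.b (2 * P.b * P.ϰ k)).filter (fun q => q.2 ≤ P.ϰ k - 1),
        ∑ r ∈ Finset.range (ρ + 1), (ρ.choose r : ℂ) *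
          dt (ρ - r) (P.a i k q.1 q.2) (pt x 0) * Dx q.1 (v k (q.2 + r)) x)
      + dt ρ (y.1 i) (pt x 0)

/-- The difference of both sides of the compatibility condition with indices `j` and `r`. -/
def residual (y : P.RHS) (v : Fin P.N → ℕ → Sp P.n → ℂ) (j : Fin P.m) (r : ℕ) (x : Sp P.n) : ℂ :=
  dt r (y.2.1 j) (pt x 0) -
    ∑ i, ∑ q ∈ idxLE P.n P.b (P.l j + 2 * P.b * P.ϰ i), ∑ μ ∈ Finset.range (r + 1),
      (r.choose μ : ℂ) * dt (r - μ) (P.c j i q.1 q.2) (pt x 0) * Dx q.1 (v i (q.2 + μ)) x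

/-- `y` satisfies the compatibility conditions on `Γ` for all `j` and all
`0 ≤ r < (s - l_j - 1/2 - b) / (2b)`. The traces in these conditions are continuous operators
from `𝓗^{s,s/(2b);φ}` to `L₂(Γ)`, obtained by passing to the limit from smooth right-hand sides. -/
def Compatible (s : ℝ) (φ : ℝ → ℝ) (y : P.RHS) : Prop :=
  ∃ (Y : ℕ → P.RHS) (v : ℕ → Fin P.N → ℕ → Sp P.n → ℂ),
    (∀ i, P.SmoothRHS (Y i) ∧ P.IsInitialJet (Y i) (v i)) ∧
    Tendsto (fun i => P.normH 𝒜 s φ (y - Y i)) atTop (𝓝 0) ∧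
    ∀ (j : Fin P.m) (r : ℕ), (r : ℝ) < (s - P.l j - 1 / 2 - P.b) / (2 * P.b) →
      Tendsto (fun i => eLpNorm (P.residual (Y i) (v i) j r) 2 (surfaceMeasure P.G)) atTop (𝓝 0)

/-- The exceptional set `E`. -/
def exceptional : Set ℝ :=
  {s | (P.σ₀ : ℝ) < s ∧ ∃ (j : Fin P.m) (i : ℕ), s = (2 * i + 1) * P.b + P.l j + 1 / 2}

/-- The space `𝓠^{s,s/(2b);φ}` for `s ∉ E`. -/
def QReg (s : ℝ) (φ : ℝ → ℝ) : Set P.RHS :=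
  {y | P.normH 𝒜 s φ y < ⊤ ∧ P.Compatible 𝒜 s φ y}

open Classical in
/-- The space `𝓠^{s,s/(2b);φ}`; if `s ∈ E`, it is obtained by interpolation with the help of a number
`ε ∈ (0, 1/2)`. -/
def Q (ε s : ℝ) (φ : ℝ → ℝ) : Set P.RHS :=
  if s ∈ P.exceptional then
    interpHalf (P.QReg 𝒜 (s - ε) φ) (P.QReg 𝒜 (s + ε) φ)
      (P.normH 𝒜 (s - ε) φ) (P.normH 𝒜 (s + ε) φ)
  else P.QReg 𝒜 s φ

/-! ### Local right-hand sides -/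

/-- `U` is open, meets `Ω`, and does not meet `Γ` (regarded as `Γ × {0}`). -/
def IsAdmissible (U : Set (SpT P.n)) : Prop :=
  IsOpen U ∧ (U ∩ P.Ω).Nonempty ∧ ∀ x ∈ frontier P.G, pt x 0 ∉ U

/-- `Ω₀ ∪ Ω'`, where `Ω₀ = U ∩ Ω` and `Ω'` is the part of the boundary of the cylinder in `U`. -/
def Ωloc (U : Set (SpT P.n)) : Set (SpT P.n) := (U ∩ P.Ω) ∪ (U ∩ frontier (closure P.Ω))

/-- `v ∈ H^{s,s/(2b);φ}_loc(Ω₀, Ω')`. -/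
def MemLocΩ (U : Set (SpT P.n)) (s : ℝ) (φ : ℝ → ℝ) (v : SpT P.n → ℂ) : Prop :=
  ∀ χ : SpT P.n → ℂ, ContDiff ℝ ∞ χ →
    closure (Function.support χ ∩ closure P.Ω) ⊆ P.Ωloc U → P.normΩ s φ (χ * v) < ⊤

/-- `η ∈ H^{s,s/(2b);φ}_loc(S₀, S')`, where `S₀ = U ∩ S` and `S' = U ∩ (Γ × {τ})`. -/
def MemLocS (U : Set (SpT P.n)) (s : ℝ) (φ : ℝ → ℝ) (η : SpT P.n → ℂ) : Prop :=
  ∀ χ : SpT P.n → ℂ, ContDiff ℝ ∞ χ →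
    closure (Function.support χ ∩ {z | z.fst ∈ frontier P.G ∧ z.snd ∈ Icc 0 P.τ}) ⊆
      (U ∩ {z | z.fst ∈ frontier P.G ∧ z.snd ∈ Ioo 0 P.τ}) ∪
        (U ∩ {z | z.fst ∈ frontier P.G ∧ z.snd = P.τ}) →
    P.normS 𝒜 s φ (χ * η) < ⊤

/-- `w ∈ H^{s;φ}_loc(G₀)`, where `G₀ = U ∩ G` (with `G` regarded as `G × {0}`). -/
def MemLocG (U : Set (SpT P.n)) (s : ℝ) (φ : ℝ → ℝ) (w : Sp P.n → ℂ) : Prop :=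
  ∀ χ : Sp P.n → ℂ, ContDiff ℝ ∞ χ →
    closure (Function.support χ ∩ closure P.G) ⊆ {x | x ∈ P.G ∧ pt x 0 ∈ U} →
    P.normG s φ (χ * w) < ⊤

/-- The local conditions on the right-hand sides. -/
def LocalRHS (U : Set (SpT P.n)) (s : ℝ) (φ : ℝ → ℝ) (y : P.RHS) : Prop :=
  (∀ j, P.MemLocΩ U s φ (y.1 j)) ∧
  (∀ j, P.MemLocS 𝒜 U (s - P.l j - 1 / 2) φ (y.2.1 j)) ∧
  ∀ k (r : Fin (P.ϰ k)),
    P.MemLocG U (s + 2 * P.b * P.ϰ k - 2 * P.b * r - P.b) φ (y.2.2 k r)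

/-! ### Continuity of derivatives -/

/-- The generalized derivative `D_x^α ∂_t^β v` is continuous on `W ⊇ W₀`, where `W₀` is open: it equals
in `W₀` a function continuous on `W`. -/
def ContinuousDerivOn {d : ℕ} (v : SpT d → ℂ) (α : Fin d → ℕ) (β : ℕ) (W₀ W : Set (SpT d)) : Prop :=
  ∃ v₀ : SpT d → ℂ, ContinuousOn v₀ W ∧
    ∀ η : SpT d → ℂ, ContDiff ℝ ∞ η → HasCompactSupport η → tsupport η ⊆ W₀ →
      (-1) ^ ((∑ i, α i) + β) * ∫ z, v z * Dxt α β η z = ∫ z in W₀, v₀ z * η z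

/-- For every `k`, all derivatives `D_x^α ∂_t^β u_k` with `|α| + 2bβ ≤ p + 2bϰ_k` are continuous on
`W ⊇ W₀`. -/
def ContinuityConclusion (p : ℤ) (u : Fin P.N → SpT P.n → ℂ) (W₀ W : Set (SpT P.n)) : Prop :=
  ∀ (k : Fin P.N) (α : Fin P.n → ℕ) (β : ℕ),
    ((∑ i, α i : ℕ) : ℤ) + 2 * P.b * β ≤ p + 2 * P.b * P.ϰ k → ContinuousDerivOn (u k) α β W₀ W

/-- The limiting value `s = p + b + n/2`. -/
def limitOrder (p : ℤ) : ℝ := p + P.b + P.n / 2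

/-- Every generalized solution with right-hand sides in `𝓠^{s,s/(2b);φ}`, `s = p + b + n/2`, satisfies
the continuity conclusion on the closed cylinder. -/
def GlobalImplication (ε : ℝ) (p : ℤ) (φ : ℝ → ℝ) : Prop :=
  ∀ u : Fin P.N → SpT P.n → ℂ, P.MemDomain P.σ₀ 1 u →
    (∃ y ∈ P.Q 𝒜 ε (P.limitOrder p) φ, P.IsSolution 𝒜 u y) →
      P.ContinuityConclusion p u P.Ω (closure P.Ω)

/-- Every generalized solution with right-hand sides subject to the local conditions for
`s = p + b + n/2` satisfies the continuity conclusion on `Ω₀ ∪ Ω'`. -/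
def LocalImplication (U : Set (SpT P.n)) (p : ℤ) (φ : ℝ → ℝ) : Prop :=
  ∀ u : Fin P.N → SpT P.n → ℂ, P.MemDomain P.σ₀ 1 u →
    (∃ y : P.RHS, P.LocalRHS 𝒜 U (P.limitOrder p) φ y ∧ P.IsSolution 𝒜 u y) →
      P.ContinuityConclusion p u (U ∩ P.Ω) (P.Ωloc U)

end Problem

end Parabolic

end

open MeasureTheory Filter Topology Set
open scoped ENNReal ContDiff SchwartzMap FourierTransform InnerProductSpace

noncomputable section

namespace Parabolic

/-! The proof is by contraposition. Nothing is solved: a function `u` with a discontinuous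
derivative is written down, and `Λ u` is computed. Let S_r(x,t) = (r x, r^{2b} t).

Slow variation makes φ comparable to a constant on dyadic blocks, so divergence of the integral
forces Σ φ(2^j)^{-2} = ∞ (`ClassM.integralCondition_of_summable`). By an Abel–Dini argument some
nonnegative a in ℓ² has Σ a_j/φ(2^j) = ∞ (`exists_summable_sq_not_summable_mul`). Put M = p + 2bϰ_k
≥ 0, and let ψ be a cutoff of the monomial x_1^M/M!. The only nonzero component of `u` is the `wave`
Σ_j a_j φ(2^j)^{-1} 2^{-jM} ψ(S_{2^j}(z - z_0)), centred at an interior point z_0.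

Regularity: the terms sit at frequencies 2^j, are nearly orthogonal, and are normalized exactly for
the order σ = M + b + n/2 = s + 2bϰ_k. Hence the norm of order σ with parameter φ is bounded by the
ℓ² norm of a (`exists_hNormOn_wave_le`). A differential operator of weighted order at most 2bϰ_k
turns the series into one of order s whose profiles depend on j but stay bounded in the Schwartz
space (`exists_family_of_operator`). Thus f = Au has the required smoothness, and partial sums serve
as smooth approximations.

Singularity: in a region between the scales J and J+1 all terms with j ≤ J are monomials and all
later ones vanish. There u_k is C_J times the monomial, with C_J = Σ_{j≤J} a_j/φ(2^j), so its M-th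
derivative in x_1 has modulus C_J, which is unbounded near z_0 (`not_continuousDerivOn_wave`).

Side conditions: after low frequencies are dropped, `u` is supported in a small ball inside Ω. So g
and h vanish, the compatibility conditions are trivial, and one construction refutes both (G) and
(L). For s in E, membership in the interpolation space follows because the j-th term has norms of
size |a_j| 2^{-jε} and |a_j| 2^{jε} in the two endpoint spaces: this makes the series of images
under J^{1/2} quasi-orthogonal (`mem_domain_of_quasiOrthogonal`). -/

section

/-! ### Slowly varying functions -/

/-- The uniform convergence theorem for slowly varying functions, in additive form. -/
theorem exists_forall_abs_sub_le_of_tendsto {h : ℝ → ℝ} (hm : Measurable h)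
    (hh : ∀ u, Tendsto (fun x => h (x + u) - h x) atTop (𝓝 0)) {η : ℝ} (hη : 0 < η) :
    ∃ X, ∀ x, X ≤ x → ∀ u ∈ Icc (0 : ℝ) 1, |h (x + u) - h x| ≤ η := by
  by_contra! H
  choose x hx u hu hxu using fun k : ℕ => H k
  have hx' : Tendsto x atTop atTop := tendsto_atTop_mono hx tendsto_natCast_atTop_atTop
  have hxu' : Tendsto (fun k => x k + u k) atTop atTop :=
    tendsto_atTop_mono (fun k => le_add_of_nonneg_right (hu k).1) hx'
  let μ : Measure ℝ := volume.restrict (Icc 0 2)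
  -- On [0, 2], of finite measure, pointwise convergence gives convergence in measure. This is
  -- applied with base points x_k and x_k + u_k.
  have key : ∀ w : ℕ → ℝ, Tendsto w atTop atTop →
      ∀ᶠ k in atTop, μ {v | ENNReal.ofReal (η / 2) ≤ edist (h (w k + v) - h (w k)) 0}
        < ENNReal.ofReal (1 / 2) := by
    intro w hw
    have h1 : TendstoInMeasure μ (fun k v => h (w k + v) - h (w k)) atTop (fun _ => (0 : ℝ)) := by
      refine tendstoInMeasure_of_tendsto_ae (fun k => ?_) (ae_of_all _ fun v => (hh v).comp hw)
      exact ((hm.comp (measurable_const.add measurable_id)).sub_const _).aestronglyMeasurable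
    exact (h1 (ENNReal.ofReal (η / 2)) (by simpa using hη)).eventually_lt_const (by simp)
  obtain ⟨k, hk1, hk2⟩ := ((key x hx').and (key _ hxu')).exists
  set A := {v | ENNReal.ofReal (η / 2) ≤ edist (h (x k + v) - h (x k)) 0}
  set B := {v | ENNReal.ofReal (η / 2) ≤ edist (h (x k + u k + v) - h (x k + u k)) 0}
  -- The two exceptional sets, the second translated by u_k, have total measure below 1. So some v
  -- in [1, 2] avoids both, and h(x_k + v) is within η/2 of both h(x_k) and h(x_k + u_k).
  have hsub : ¬ Icc (1 : ℝ) 2 ⊆ (A ∩ Icc 0 2) ∪ (fun v => v + -u k) ⁻¹' (B ∩ Icc 0 2) := by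
    intro hs
    have hle := (measure_mono hs).trans (measure_union_le (μ := volume) _ _)
    rw [measure_preimage_add_right, Real.volume_Icc] at hle
    have hA : volume (A ∩ Icc 0 2) < ENNReal.ofReal (1 / 2) :=
      lt_of_le_of_lt (Measure.le_restrict_apply _ _) hk1
    have hB : volume (B ∩ Icc 0 2) < ENNReal.ofReal (1 / 2) :=
      lt_of_le_of_lt (Measure.le_restrict_apply _ _) hk2
    have := hle.trans_lt (ENNReal.add_lt_add hA hB)
    rw [← ENNReal.ofReal_add (by norm_num) (by norm_num)] at this
    norm_num at this
  obtain ⟨v, hv, hvn⟩ := not_subset.1 hsub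
  simp only [mem_union, mem_inter_iff, mem_preimage, not_or, not_and', mem_Icc] at hvn
  have hvA := hvn.1 ⟨by linarith [hv.1], hv.2⟩
  have hvB := hvn.2 ⟨by linarith [hv.1, (hu k).2], by linarith [hv.2, (hu k).1]⟩
  simp only [A, B, mem_ofPred_eq, not_le, edist_dist, Real.dist_eq, sub_zero] at hvA hvB
  rw [ENNReal.ofReal_lt_ofReal_iff (by positivity)] at hvA hvB
  have e : x k + u k + (v + -u k) = x k + v := by ring
  rw [e] at hvB
  have h1 := hxu k
  have h2 : |h (x k + u k) - h (x k)| ≤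
      |h (x k + v) - h (x k)| + |h (x k + v) - h (x k + u k)| := by
    have := abs_sub (h (x k + v) - h (x k)) (h (x k + v) - h (x k + u k))
    simpa using this
  linarith

/-- Chain m unit steps and one step of length at most 1: a uniform local bound becomes linear growth
with small slope. -/
theorem abs_sub_le_of_local {h : ℝ → ℝ} {X δ : ℝ}
    (hX : ∀ x, X ≤ x → ∀ u ∈ Icc (0 : ℝ) 1, |h (x + u) - h x| ≤ δ) (m : ℕ) :
    ∀ x, X ≤ x → ∀ u ∈ Icc (0 : ℝ) 1, |h (x + m + u) - h x| ≤ δ * (m + 1) := by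
  induction m with
  | zero => intro x hx u hu; simpa using hX x hx u hu
  | succ m ih =>
    intro x hx u hu
    have h1 := ih (x + 1) (by linarith) u hu
    have h2 := hX x hx 1 (by simp)
    have e : x + (m + 1 : ℕ) + u = x + 1 + m + u := by push_cast; ring
    rw [e]
    have := abs_add_le (h (x + 1 + m + u) - h (x + 1)) (h (x + 1) - h x)
    rw [sub_add_sub_cancel] at this
    push_cast
    linarith

/-- Potter's bounds for functions of the class `𝓜`. -/
theorem ClassM.potter {φ : ℝ → ℝ} (hφ : ClassM φ) {δ : ℝ} (hδ : 0 < δ) :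
    ∃ C, 0 < C ∧ ∀ x y, 1 ≤ x → 1 ≤ y →
      φ x ≤ C * φ y * Real.exp (δ * |Real.log x - Real.log y|) := by
  -- Logarithmic coordinates turn slow variation into its additive form; `max x 0` keeps the
  -- argument of φ in [1, ∞), where its values are meaningful.
  let h : ℝ → ℝ := fun x => Real.log (φ (Real.exp (max x 0)))
  have hm : Measurable h := by
    have h1 : Measurable fun x : ℝ => (⟨Real.exp (max x 0), by simp⟩ : Ici (1 : ℝ)) := by
      apply Measurable.subtype_mk; fun_prop
    exact Real.measurable_log.comp (hφ.measurable.comp h1)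
  have hlim : ∀ u, Tendsto (fun x => h (x + u) - h x) atTop (𝓝 0) := by
    intro u
    have h1 := (hφ.slow (Real.exp u) (Real.exp_pos u)).comp Real.tendsto_exp_atTop
    have h2 := ((Real.continuousAt_log one_ne_zero).tendsto.comp h1)
    rw [Real.log_one] at h2
    refine h2.congr' ?_
    filter_upwards [eventually_ge_atTop 0, eventually_ge_atTop (-u)] with x hx hx'
    have hxu : 0 ≤ x + u := by linarith
    have p1 : 0 < φ (Real.exp (x + u)) := hφ.pos _ (by simpa using hxu)
    have p2 : 0 < φ (Real.exp x) := hφ.pos _ (by simpa using hx)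
    simp only [Function.comp, h, max_eq_left hx, max_eq_left hxu]
    rw [← Real.exp_add, add_comm u x, Real.log_div p1.ne' p2.ne']
  obtain ⟨X₀, hX₀⟩ := exists_forall_abs_sub_le_of_tendsto hm hlim hδ
  obtain ⟨X, hX0, hX⟩ : ∃ X, 0 < X ∧
      ∀ x, X ≤ x → ∀ u ∈ Icc (0 : ℝ) 1, |h (x + u) - h x| ≤ δ :=
    ⟨max X₀ 1, by positivity, fun x hx => hX₀ x ((le_max_left _ _).trans hx)⟩
  have hfar : ∀ x y, X ≤ x → x ≤ y → |h y - h x| ≤ δ * (y - x + 1) := by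
    intro x y hx hxy
    have h1 := abs_sub_le_of_local hX ⌊y - x⌋₊ x hx (y - x - ⌊y - x⌋₊)
      ⟨by linarith [Nat.floor_le (sub_nonneg.2 hxy)], by linarith [Nat.lt_floor_add_one (y - x)]⟩
    have e : x + ⌊y - x⌋₊ + (y - x - ⌊y - x⌋₊) = y := by ring
    rw [e] at h1
    refine h1.trans (mul_le_mul_of_nonneg_left ?_ hδ.le)
    linarith [Nat.floor_le (sub_nonneg.2 hxy)]
  obtain ⟨B, hB0, hB⟩ : ∃ B, 0 ≤ B ∧ ∀ x, 0 ≤ x → x ≤ X → |h x| ≤ B := by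
    have hc : 1 < Real.exp X := by simpa using hX0
    obtain ⟨B₁, hB₁⟩ := hφ.bdd _ hc
    obtain ⟨B₂, hB₂⟩ := hφ.bdd_inv _ hc
    refine ⟨max (Real.log B₁) (Real.log B₂) ⊔ 0, le_max_right _ _, fun x hx hxX => ?_⟩
    have hmem : Real.exp x ∈ Icc 1 (Real.exp X) := ⟨by simpa using hx, by simpa using hxX⟩
    have hp := hφ.pos _ hmem.1
    have b1 : φ (Real.exp x) ≤ B₁ := hB₁ (mem_image_of_mem _ hmem)
    have b2 : 1 / φ (Real.exp x) ≤ B₂ := hB₂ (mem_image_of_mem (fun y => 1 / φ y) hmem)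
    have l1 := Real.log_le_log hp b1
    have l2 := Real.log_le_log (by positivity) b2
    rw [one_div, Real.log_inv] at l2
    simp only [h, max_eq_left hx]
    rw [abs_le]
    constructor
    · have := le_max_left (max (Real.log B₁) (Real.log B₂)) 0
      have := le_max_right (Real.log B₁) (Real.log B₂)
      linarith
    · exact l1.trans ((le_max_left _ _).trans (le_max_left _ _))
  -- Beyond X the oscillation grows with slope δ; on [0, X] the local bounds for φ and 1/φ give |h|
  -- ≤ B. Splitting at X costs the additive constant 2B + δ.
  have hall : ∀ x y, 0 ≤ x → x ≤ y → |h y - h x| ≤ 2 * B + δ + δ * (y - x) := by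
    intro x y hx hxy
    have hd : 0 ≤ δ * (y - x) := mul_nonneg hδ.le (sub_nonneg.2 hxy)
    rcases le_total X x with hxX | hxX
    · linarith [hfar x y hxX hxy]
    · have b1 := hB x hx hxX
      rcases le_total X y with hyX | hyX
      · have b2 := hfar X y le_rfl hyX
        have b3 := hB X hX0.le le_rfl
        have b4 := abs_add_three (h y - h X) (h X) (-h x)
        have e : h y - h X + h X + -h x = h y - h x := by ring
        rw [e, abs_neg] at b4
        have : δ * (X - x) ≥ 0 := mul_nonneg hδ.le (sub_nonneg.2 hxX)
        nlinarith
      · have b2 := hB y (hx.trans hxy) hyX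
        have := abs_sub (h y) (h x)
        linarith
  refine ⟨Real.exp (2 * B + δ), Real.exp_pos _, fun x y hx hy => ?_⟩
  have hx0 := Real.log_nonneg hx
  have hy0 := Real.log_nonneg hy
  have px := hφ.pos x hx
  have py := hφ.pos y hy
  have main : h (Real.log x) - h (Real.log y) ≤
      2 * B + δ + δ * |Real.log x - Real.log y| := by
    rcases le_total (Real.log x) (Real.log y) with hl | hl
    · rw [abs_sub_comm, abs_of_nonneg (sub_nonneg.2 hl)]
      exact (le_abs_self _).trans ((abs_sub_comm _ _).trans_le (hall _ _ hx0 hl))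
    · rw [abs_of_nonneg (sub_nonneg.2 hl)]
      exact (le_abs_self _).trans (hall _ _ hy0 hl)
  simp only [h, max_eq_left hx0, max_eq_left hy0, Real.exp_log (lt_of_lt_of_le one_pos hx),
    Real.exp_log (lt_of_lt_of_le one_pos hy)] at main
  calc φ x = Real.exp (Real.log (φ x)) := (Real.exp_log px).symm
    _ ≤ Real.exp ((2 * B + δ) + Real.log (φ y) + δ * |Real.log x - Real.log y|) :=
      Real.exp_le_exp.2 (by linarith)
    _ = _ := by rw [Real.exp_add, Real.exp_add, Real.exp_log py]

/-- If the sum of `φ(2^j)⁻²` converges, then so does the integral of `1 / (y φ²(y))`. -/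
theorem ClassM.integralCondition_of_summable {φ : ℝ → ℝ} (hφ : ClassM φ)
    (hs : Summable fun j : ℕ => ((φ (2 ^ j))⁻¹) ^ 2) : IntegralCondition φ := by
  obtain ⟨C, hC, hpot⟩ := hφ.potter one_pos
  have hcov : Ioi (1 : ℝ) ⊆ ⋃ j : ℕ, Ico ((2 : ℝ) ^ j) (2 ^ (j + 1)) := by
    intro y hy
    obtain ⟨m, hm1, hm2⟩ := exists_nat_pow_near (le_of_lt hy) (one_lt_two : (1 : ℝ) < 2)
    exact mem_iUnion.2 ⟨m, hm1, hm2⟩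
  -- Potter's bound with δ = 1 loses at most y/2^j ≤ 2 on a dyadic block, whence C * 2. The factor
  -- (2^j)⁻¹ will cancel the length of the block.
  have hb : ∀ j : ℕ, ∀ y ∈ Ico ((2 : ℝ) ^ j) (2 ^ (j + 1)), 1 / (y * φ y ^ 2) ≤
      (C * 2) ^ 2 * ((φ (2 ^ j))⁻¹) ^ 2 * ((2 : ℝ) ^ j)⁻¹ := by
    intro j y hy
    have h2 : (1 : ℝ) ≤ 2 ^ j := one_le_pow₀ one_le_two
    have hy1 : 1 ≤ y := h2.trans hy.1
    have p1 := hφ.pos _ h2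
    have p2 := hφ.pos _ hy1
    have hp := hpot (2 ^ j) y h2 hy1
    have hexp : Real.exp (1 * |Real.log (2 ^ j) - Real.log y|) ≤ 2 := by
      rw [one_mul, abs_sub_comm, abs_of_nonneg (sub_nonneg.2 (Real.log_le_log (by positivity) hy.1)),
        ← Real.log_div (by positivity) (by positivity), Real.exp_log (by positivity),
        div_le_iff₀ (by positivity)]
      have := hy.2.le
      rw [pow_succ] at this
      linarith
    have hp' : φ (2 ^ j) ≤ C * 2 * φ y := by
      refine hp.trans ?_
      have := mul_le_mul_of_nonneg_left hexp (mul_pos hC p2).le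
      linarith
    have hq : φ (2 ^ j) ^ 2 ≤ (C * 2) ^ 2 * φ y ^ 2 := by
      rw [← mul_pow]; exact pow_le_pow_left₀ p1.le hp' 2
    rw [inv_pow, div_le_iff₀ (by positivity)]
    have e : (C * 2) ^ 2 * (φ (2 ^ j) ^ 2)⁻¹ * ((2 : ℝ) ^ j)⁻¹ * (y * φ y ^ 2) =
        ((C * 2) ^ 2 * φ y ^ 2 / φ (2 ^ j) ^ 2) * (y / 2 ^ j) := by
      field_simp
    rw [e]
    refine one_le_mul_of_one_le_of_one_le ?_ ?_
    · rwa [one_le_div (by positivity)]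
    · rw [one_le_div (by positivity)]; exact hy.1
  unfold IntegralCondition
  calc ∫⁻ y in Ioi (1 : ℝ), ENNReal.ofReal (1 / (y * φ y ^ 2))
      ≤ ∫⁻ y in ⋃ j : ℕ, Ico ((2 : ℝ) ^ j) (2 ^ (j + 1)), ENNReal.ofReal (1 / (y * φ y ^ 2)) :=
        lintegral_mono_set hcov
    _ ≤ ∑' j : ℕ, ∫⁻ y in Ico ((2 : ℝ) ^ j) (2 ^ (j + 1)), ENNReal.ofReal (1 / (y * φ y ^ 2)) :=
        lintegral_iUnion_le _ _
    _ ≤ ∑' j : ℕ, ENNReal.ofReal ((C * 2) ^ 2 * ((φ (2 ^ j))⁻¹) ^ 2) := by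
        refine ENNReal.tsum_le_tsum fun j => ?_
        refine (setLIntegral_mono measurable_const fun y hy =>
          ENNReal.ofReal_le_ofReal (hb j y hy)).trans ?_
        rw [setLIntegral_const, Real.volume_Ico, ← ENNReal.ofReal_mul (by positivity)]
        refine ENNReal.ofReal_le_ofReal (le_of_eq ?_)
        have h2 : (2 : ℝ) ^ j ≠ 0 := by positivity
        field_simp
        ring
    _ < ⊤ := by
        rw [← ENNReal.ofReal_tsum_of_nonneg (fun j => by positivity) (hs.mul_left _)]
        exact ENNReal.ofReal_lt_top

theorem classM_one : ClassM 1 where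
  measurable := measurable_const
  pos := fun _ _ => one_pos
  bdd := fun c _ => ⟨1, by rintro _ ⟨y, -, rfl⟩; simp⟩
  bdd_inv := fun c _ => ⟨1, by rintro _ ⟨y, -, rfl⟩; simp⟩
  slow := fun r _ => by simp

theorem not_integralCondition_one : ¬ IntegralCondition 1 := by
  intro h
  have h1 : ∫⁻ y in Ioi (1 : ℝ), ENNReal.ofReal (y⁻¹) < ⊤ := by
    simpa [IntegralCondition] using h
  have hi : IntegrableOn (fun y : ℝ => y⁻¹) (Ioi 1) := by
    refine ⟨measurable_inv.aestronglyMeasurable, ?_⟩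
    rw [hasFiniteIntegral_iff_ofReal]
    · exact h1
    · exact (ae_restrict_iff' measurableSet_Ioi).2
        (ae_of_all _ fun y hy => inv_nonneg.2 (zero_le_one.trans (le_of_lt hy)))
  exact not_integrableOn_Ioi_inv hi

/-- A divergent series of squares `∑ d_j²` has an `ℓ²` multiplier `a` with `∑ a_j d_j = ∞`. -/
theorem exists_summable_sq_not_summable_mul {d : ℕ → ℝ} (hd : ∀ j, 0 < d j)
    (hs : ¬ Summable fun j => d j ^ 2) :
    ∃ a : ℕ → ℝ, (∀ j, 0 ≤ a j) ∧ (Summable fun j => a j ^ 2) ∧ ¬ Summable fun j => a j * d j := by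
  -- The sum includes the index N itself, so D is positive already at 0.
  let D : ℕ → ℝ := fun N => ∑ j ∈ Finset.range (N + 1), d j ^ 2
  have hDs : ∀ N, D (N + 1) = D N + d (N + 1) ^ 2 := fun N => Finset.sum_range_succ _ _
  have hDpos : ∀ N, 0 < D N := fun N =>
    Finset.sum_pos (fun j _ => pow_pos (hd j) 2) Finset.nonempty_range_add_one
  have hDmono : Monotone D := monotone_nat_of_le_succ fun N => by
    rw [hDs]; linarith [pow_pos (hd (N + 1)) 2]
  have hDtop : Tendsto D atTop atTop :=
    ((not_summable_iff_tendsto_nat_atTop_of_nonneg fun j => (sq_nonneg _)).1 hs).comp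
      (tendsto_add_atTop_nat 1)
  -- Abel–Dini: d_j²/D_j² is at most 1/D_{j-1} - 1/D_j, which telescopes, while Σ d_j²/D_j still
  -- diverges.
  refine ⟨fun j => d j / D j, fun j => (div_pos (hd j) (hDpos j)).le, ?_, ?_⟩
  · rw [← summable_nat_add_iff 1]
    refine summable_of_sum_range_le (c := 1 / D 0) (fun j => sq_nonneg _) fun N => ?_
    have : ∑ i ∈ Finset.range N, (d (i + 1) / D (i + 1)) ^ 2 ≤
        ∑ i ∈ Finset.range N, (1 / D i - 1 / D (i + 1)) := by
      refine Finset.sum_le_sum fun i _ => ?_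
      have h0 := hDpos i
      have h1 := hDpos (i + 1)
      have e : 1 / D i - 1 / D (i + 1) = d (i + 1) ^ 2 / (D i * D (i + 1)) := by
        rw [div_sub_div _ _ h0.ne' h1.ne', hDs]; ring
      rw [e, div_pow]
      gcongr
      rw [sq]
      gcongr
      exact hDmono (Nat.le_succ i)
    refine this.trans ?_
    rw [Finset.sum_range_sub']
    have := hDpos N
    have : 0 < 1 / D N := by positivity
    linarith
  · intro hsum
    -- If the series converged, a tail would be below 1/2. But the tail from m on is at least (D_N -
    -- D_m)/D_N, which reaches 1/2 once D_N ≥ 2 D_m.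
    obtain ⟨m, hm⟩ := (tendsto_sum_nat_add (fun j => d j / D j * d j)).eventually_lt_const
      (show (0 : ℝ) < 1 / 2 by norm_num) |>.exists
    have hpos : ∀ i, 0 ≤ d i / D i * d i := fun i => by
      have := hd i; have := hDpos i; positivity
    obtain ⟨N, hN⟩ := (hDtop.eventually_ge_atTop (2 * D m)).exists_forall_of_atTop
    have hsum' : Summable fun k => d (k + m) / D (k + m) * d (k + m) :=
      (summable_nat_add_iff m).2 hsum
    have hfin : ∀ K, ∑ k ∈ Finset.range (K + 1), d (k + m) / D (k + m) * d (k + m) < 1 / 2 :=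
      fun K => lt_of_le_of_lt (hsum'.sum_le_tsum _ fun i _ => hpos _) hm
    have hlow : ∀ K, (D (K + m) - D m) / D (K + m) ≤
        ∑ k ∈ Finset.range (K + 1), d (k + m) / D (k + m) * d (k + m) := by
      intro K
      have h1 : D (K + m) - D m = ∑ k ∈ Finset.range K, d (k + 1 + m) ^ 2 := by
        induction K with
        | zero => simp
        | succ K ih =>
          rw [Finset.sum_range_succ, ← ih, show K + 1 + m = (K + m) + 1 by ring, hDs]
          ring
      rw [Finset.sum_range_succ', h1, Finset.sum_div]
      refine le_add_of_le_of_nonneg (Finset.sum_le_sum fun k hk => ?_) (hpos _)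
      have hD := hDpos (k + 1 + m)
      rw [div_mul_eq_mul_div, ← sq]
      gcongr
      have := Finset.mem_range.1 hk
      exact hDmono (by omega)
    have h2 := (hlow N).trans_lt (hfin N)
    have h3 := hN (N + m) (Nat.le_add_right _ _)
    rw [div_lt_iff₀ (hDpos _)] at h2
    linarith

end

section

/-! ### Anisotropic dilations -/

@[simp] theorem pt_fst {d : ℕ} (x : Sp d) (t : ℝ) : (pt x t).fst = x := rfl
@[simp] theorem pt_snd {d : ℕ} (x : Sp d) (t : ℝ) : (pt x t).snd = t := rfl

theorem SpT.ext {d : ℕ} {z w : SpT d} (h₁ : z.fst = w.fst) (h₂ : z.snd = w.snd) : z = w :=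
  (WithLp.ofLp_injective 2) (Prod.ext h₁ h₂)

theorem SpT.norm_sq {d : ℕ} (z : SpT d) : ‖z‖ ^ 2 = ‖z.fst‖ ^ 2 + z.snd ^ 2 := by
  rw [WithLp.prod_norm_sq_eq_of_L2, Real.norm_eq_abs, sq_abs]

theorem SpT.norm_fst_le {d : ℕ} (z : SpT d) : ‖z.fst‖ ≤ ‖z‖ :=
  le_of_sq_le_sq (by rw [SpT.norm_sq]; nlinarith [sq_nonneg z.snd]) (norm_nonneg _)

theorem SpT.abs_snd_le {d : ℕ} (z : SpT d) : |z.snd| ≤ ‖z‖ :=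
  abs_le_of_sq_le_sq (by rw [SpT.norm_sq]; nlinarith [sq_nonneg ‖z.fst‖]) (norm_nonneg _)

/-- The anisotropic dilation `(x, t) ↦ (r x, r^{2b} t)`. -/
def dilation {d : ℕ} (b : ℕ) (r : ℝ) : SpT d →L[ℝ] SpT d :=
  { toFun := fun z => pt (r • z.fst) (r ^ (2 * b) * z.snd)
    map_add' := fun z w => SpT.ext
      (show r • (z.fst + w.fst) = r • z.fst + r • w.fst from smul_add _ _ _)
      (show r ^ (2 * b) * (z.snd + w.snd) = _ from mul_add _ _ _)
    map_smul' := fun c z => SpT.ext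
      (show r • (c • z.fst) = c • (r • z.fst) from smul_comm _ _ _)
      (show r ^ (2 * b) * (c * z.snd) = c * (r ^ (2 * b) * z.snd) from mul_left_comm _ _ _)
    cont := (WithLp.prod_continuous_toLp 2 (Sp d) ℝ).comp
      (((WithLp.continuous_fst 2 (Sp d) ℝ).const_smul r).prodMk
        (continuous_const.mul (WithLp.continuous_snd 2 (Sp d) ℝ))) }

variable {d b : ℕ}

@[simp] theorem dilation_fst (r : ℝ) (z : SpT d) : (dilation b r z).fst = r • z.fst := rfl
@[simp] theorem dilation_snd (r : ℝ) (z : SpT d) : (dilation b r z).snd = r ^ (2 * b) * z.snd := rfl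

theorem dilation_dilation (r q : ℝ) (z : SpT d) :
    dilation b r (dilation b q z) = dilation b (r * q) z :=
  SpT.ext (by simp [smul_smul]) (by simp [mul_pow, mul_assoc])

@[simp] theorem dilation_one (z : SpT d) : dilation b 1 z = z := SpT.ext (by simp) (by simp)

theorem dilation_inv_dilation {r : ℝ} (hr : r ≠ 0) (z : SpT d) :
    dilation b r⁻¹ (dilation b r z) = z := by
  rw [dilation_dilation, inv_mul_cancel₀ hr, dilation_one]

theorem dilation_dilation_inv {r : ℝ} (hr : r ≠ 0) (z : SpT d) :
    dilation b r (dilation b r⁻¹ z) = z := by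
  rw [dilation_dilation, mul_inv_cancel₀ hr, dilation_one]

theorem dilation_single (r : ℝ) (i : Fin d) :
    dilation b r (pt (EuclideanSpace.single i 1) 0) = r • pt (EuclideanSpace.single i 1) 0 :=
  SpT.ext (by simp) (by simp)

theorem dilation_time (r : ℝ) :
    dilation b r (pt (0 : Sp d) 1) = r ^ (2 * b) • pt (0 : Sp d) 1 :=
  SpT.ext (by simp) (by simp)

theorem norm_dilation_le {r : ℝ} (h0 : 0 ≤ r) (h1 : r ≤ 1) (z : SpT d) :
    ‖dilation b r z‖ ≤ ‖z‖ := by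
  refine le_of_sq_le_sq ?_ (norm_nonneg _)
  rw [SpT.norm_sq, SpT.norm_sq, dilation_fst, dilation_snd, norm_smul, mul_pow, mul_pow,
    Real.norm_of_nonneg h0]
  have a1 : r ^ 2 ≤ 1 := pow_le_one₀ h0 h1
  have a2 : (r ^ (2 * b)) ^ 2 ≤ 1 := pow_le_one₀ (by positivity) (pow_le_one₀ h0 h1)
  nlinarith [sq_nonneg ‖z.fst‖, sq_nonneg z.snd]

theorem opNorm_dilation_le {r : ℝ} (h0 : 0 ≤ r) (h1 : r ≤ 1) :
    ‖(dilation b r : SpT d →L[ℝ] SpT d)‖ ≤ 1 :=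
  ContinuousLinearMap.opNorm_le_bound _ zero_le_one fun z => by
    simpa using norm_dilation_le h0 h1 z

theorem le_norm_dilation (hb : 1 ≤ b) {r : ℝ} (h1 : 1 ≤ r) (z : SpT d) :
    r * ‖z‖ ≤ ‖dilation b r z‖ := by
  refine le_of_sq_le_sq ?_ (norm_nonneg _)
  have h0 : 0 ≤ r := zero_le_one.trans h1
  rw [mul_pow, SpT.norm_sq, SpT.norm_sq, dilation_fst, dilation_snd, norm_smul, mul_pow, mul_pow,
    Real.norm_of_nonneg h0]
  have a1 : r ≤ r ^ (2 * b) := le_self_pow₀ h1 (by omega)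
  have a2 : r ^ 2 ≤ (r ^ (2 * b)) ^ 2 := pow_le_pow_left₀ h0 a1 2
  nlinarith [sq_nonneg z.snd]

/-- Symmetry of the dilation is what turns dilation by r in space-time into dilation by r⁻¹ on the
Fourier side. -/
theorem inner_dilation (r : ℝ) (z w : SpT d) :
    ⟪dilation b r z, w⟫_ℝ = ⟪z, dilation b r w⟫_ℝ := by
  rw [WithLp.prod_inner_apply, WithLp.prod_inner_apply]
  have h1 : ⟪(dilation b r z).fst, w.fst⟫_ℝ = ⟪z.fst, (dilation b r w).fst⟫_ℝ := by
    rw [dilation_fst, dilation_fst, real_inner_smul_left, real_inner_smul_right]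
  have h2 : ⟪(dilation b r z).snd, w.snd⟫_ℝ = ⟪z.snd, (dilation b r w).snd⟫_ℝ := by
    simp only [dilation_snd, RCLike.inner_apply, conj_trivial]
    ring
  exact congrArg₂ (· + ·) h1 h2

/-- The exponent d + 2b is the homogeneous dimension; half of it is the critical shift d/2 + b in
the definition of `waveCoeff`. -/
theorem det_dilation (r : ℝ) :
    LinearMap.det ((dilation b r : SpT d →L[ℝ] SpT d) : SpT d →ₗ[ℝ] SpT d) = r ^ (d + 2 * b) := by
  rw [← LinearMap.det_conj _ (WithLp.linearEquiv 2 ℝ (Sp d × ℝ))]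
  have : ((WithLp.linearEquiv 2 ℝ (Sp d × ℝ) : SpT d →ₗ[ℝ] Sp d × ℝ) ∘ₗ
      ((dilation b r : SpT d →L[ℝ] SpT d) : SpT d →ₗ[ℝ] SpT d) ∘ₗ
      ((WithLp.linearEquiv 2 ℝ (Sp d × ℝ)).symm : Sp d × ℝ →ₗ[ℝ] SpT d)) =
      LinearMap.prodMap (r • LinearMap.id) (r ^ (2 * b) • LinearMap.id) := by
    apply LinearMap.ext
    rintro ⟨x, t⟩
    rfl
  rw [this, LinearMap.det_prodMap, LinearMap.det_smul, LinearMap.det_smul]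
  simp [pow_add]

theorem map_dilation_volume {r : ℝ} (hr : 0 < r) :
    Measure.map (dilation b r : SpT d → SpT d) volume =
      ENNReal.ofReal ((r ^ (d + 2 * b))⁻¹) • (volume : Measure (SpT d)) := by
  have hdet : LinearMap.det ((dilation b r : SpT d →L[ℝ] SpT d) : SpT d →ₗ[ℝ] SpT d) ≠ 0 := by
    rw [det_dilation]; positivity
  have := Measure.map_linearMap_addHaar_eq_smul_addHaar (volume : Measure (SpT d)) hdet
  rw [det_dilation, abs_of_pos (by positivity)] at this
  exact this

theorem measurableEmbedding_dilation {r : ℝ} (hr : 0 < r) :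
    MeasurableEmbedding (dilation b r : SpT d → SpT d) :=
  (Homeomorph.measurableEmbedding
    { toFun := dilation b r
      invFun := dilation b r⁻¹
      left_inv := dilation_inv_dilation hr.ne'
      right_inv := dilation_dilation_inv hr.ne'
      continuous_toFun := (dilation b r).continuous
      continuous_invFun := (dilation b r⁻¹).continuous } : _)

theorem integral_comp_dilation {r : ℝ} (hr : 0 < r) (f : SpT d → ℂ) :
    ∫ z, f (dilation b r z) = ((r ^ (d + 2 * b))⁻¹ : ℝ) * ∫ z, f z := by
  rw [← (measurableEmbedding_dilation hr).integral_map, map_dilation_volume hr,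
    integral_smul_measure, ENNReal.toReal_ofReal (by positivity), Complex.real_smul]

theorem lintegral_comp_dilation {r : ℝ} (hr : 0 < r) (f : SpT d → ℝ≥0∞) :
    ∫⁻ z, f (dilation b r z) = ENNReal.ofReal ((r ^ (d + 2 * b))⁻¹) * ∫⁻ z, f z := by
  rw [← (measurableEmbedding_dilation hr).lintegral_map, map_dilation_volume hr,
    lintegral_smul_measure, smul_eq_mul]

/-! ### The anisotropic weight -/

theorem one_le_anisoBase (ζ : SpT d) : 1 ≤ anisoBase b ζ := by
  unfold anisoBase
  rw [Real.one_le_sqrt, add_assoc]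
  exact le_add_of_nonneg_right (by positivity)

theorem anisoBase_sq (ζ : SpT d) :
    anisoBase b ζ ^ 2 = 1 + ‖ζ.fst‖ ^ 2 + |ζ.snd| ^ (1 / (b : ℝ)) :=
  Real.sq_sqrt (by positivity)

/-- The dilations are adapted to the weight: (r^{2b})^{1/b} = r², so |ξ|² + |η|^{1/b} is homogeneous
of degree 2. -/
theorem anisoBase_dilation_sq (hb : 1 ≤ b) {r : ℝ} (hr : 0 ≤ r) (ζ : SpT d) :
    anisoBase b (dilation b r ζ) ^ 2 =
      1 + r ^ 2 * (‖ζ.fst‖ ^ 2 + |ζ.snd| ^ (1 / (b : ℝ))) := by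
  have hb' : (b : ℝ) ≠ 0 := by positivity
  have e : (r ^ (2 * b)) ^ (1 / (b : ℝ)) = r ^ 2 := by
    rw [pow_mul, ← Real.rpow_natCast (r ^ 2) b, ← Real.rpow_mul (by positivity),
      mul_one_div_cancel hb', Real.rpow_one]
  rw [anisoBase_sq, dilation_fst, dilation_snd, norm_smul, abs_mul, abs_of_nonneg (by positivity),
    Real.mul_rpow (by positivity) (abs_nonneg _), e, Real.norm_of_nonneg hr]
  ring

/-- Decay of a Schwartz function in the rescaled frequency becomes decay in the ratio of the weight
to r. The factor 8 bounds 2π from the frequency normalization. -/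
theorem inv_mul_anisoBase_le (hb : 1 ≤ b) {r : ℝ} (hr : 1 ≤ r) (ζ : SpT d) :
    r⁻¹ * anisoBase b ((2 * Real.pi) • ζ) ≤ 8 * (1 + ‖dilation b r⁻¹ ζ‖) := by
  have hr0 : 0 < r := one_pos.trans_le hr
  set ζ' := dilation b r⁻¹ ζ
  have hζ : (2 * Real.pi) • ζ = dilation b r ((2 * Real.pi) • ζ') := by
    rw [map_smul, dilation_dilation_inv hr0.ne']
  set w := (2 * Real.pi) • ζ'
  have hw : ‖w‖ = 2 * Real.pi * ‖ζ'‖ := by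
    rw [norm_smul, Real.norm_of_nonneg (by positivity)]
  have hA : r⁻¹ * anisoBase b ((2 * Real.pi) • ζ) ≤ 2 + ‖w‖ := by
    refine le_of_sq_le_sq ?_ (by positivity)
    rw [mul_pow, hζ, anisoBase_dilation_sq hb hr0.le]
    have h1 : |w.snd| ^ (1 / (b : ℝ)) ≤ 1 + |w.snd| := by
      refine (Real.rpow_le_rpow (abs_nonneg _) (by linarith : |w.snd| ≤ 1 + |w.snd|)
        (by positivity)).trans ?_
      refine (Real.rpow_le_rpow_of_exponent_le (by linarith [abs_nonneg w.snd])
        (?_ : 1 / (b : ℝ) ≤ 1)).trans_eq (Real.rpow_one _)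
      rw [div_le_one (by positivity)]
      exact_mod_cast hb
    have h2 := SpT.abs_snd_le w
    have h3 := SpT.norm_fst_le w
    have h4 : (r⁻¹) ^ 2 ≤ 1 := pow_le_one₀ (by positivity) (inv_le_one_of_one_le₀ hr)
    have h5 : (r⁻¹) ^ 2 * (1 + r ^ 2 * (‖w.fst‖ ^ 2 + |w.snd| ^ (1 / (b : ℝ)))) =
        (r⁻¹) ^ 2 + (‖w.fst‖ ^ 2 + |w.snd| ^ (1 / (b : ℝ))) := by
      field_simp
    rw [h5]
    nlinarith [norm_nonneg w, norm_nonneg w.fst]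
  have hpi := Real.pi_lt_four
  rw [hw] at hA
  nlinarith [norm_nonneg ζ']

end

section

/-! ### Norms of integrable functions -/

section Integrable

variable {Z : Type*} [NormedAddCommGroup Z] [InnerProductSpace ℝ Z] [FiniteDimensional ℝ Z]
  [MeasurableSpace Z] [BorelSpace Z]

/-- Both infima are bounded by one choice: f itself as the extension, and its classical Fourier
transform as the density. -/
theorem hNormOn_le_of_integrable (r : Z → ℝ) (s : ℝ) (φ : ℝ → ℝ) (U : Set Z) {f v : Z → ℂ}
    (hf : Integrable f) (hv : v =ᵐ[volume] f) :
    hNormOn r s φ U v ≤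
      (∫⁻ z, ENNReal.ofReal (r ((2 * Real.pi) • z) ^ s * φ (r ((2 * Real.pi) • z))) ^ 2
        * ‖𝓕 f z‖ₑ ^ 2) ^ (1 / 2 : ℝ) := by
  have hf1 : MemLp f 1 := memLp_one_iff_integrable.2 hf
  let w : 𝓢'(Z, ℂ) := Lp.toTemperedDistribution hf1.toLp
  have hw : ∀ g : 𝓢(Z, ℂ), w g = ∫ z, f z * g z := by
    intro g
    simp only [w, Lp.toTemperedDistribution_apply]
    refine integral_congr_ae ?_
    filter_upwards [hf1.coeFn_toLp] with z hz
    rw [hz, smul_eq_mul, mul_comm]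
  have hcont : Continuous (𝓕 f) :=
    VectorFourier.fourierIntegral_continuous Real.continuous_fourierChar
      (by exact continuous_inner) hf
  have hd : IsFourierDensity w (𝓕 f) := by
    refine ⟨hcont.locallyIntegrable, fun g _ => ?_⟩
    rw [TemperedDistribution.fourier_apply, hw]
    have := VectorFourier.integral_fourierIntegral_smul_eq_flip (L := innerₗ Z)
      Real.continuous_fourierChar (by exact continuous_inner) hf (g.integrable (μ := volume))
    rw [flip_innerₗ] at this
    simp only [smul_eq_mul] at this
    exact this.symm
  have hr : RestrictsTo w U v := by
    refine ⟨((hf.congr hv.symm).locallyIntegrable).locallyIntegrableOn _, fun g _ _ => ?_⟩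
    rw [hw]
    exact integral_congr_ae (by filter_upwards [hv] with z hz; rw [hz])
  exact iInf₂_le_of_le w hr (iInf₂_le_of_le _ hd le_rfl)

theorem hNormOn_zero (r : Z → ℝ) (s : ℝ) (φ : ℝ → ℝ) (U : Set Z) : hNormOn r s φ U 0 = 0 := by
  have h := hNormOn_le_of_integrable r s φ U (f := 0) (integrable_zero Z ℂ volume)
    (EventuallyEq.refl _ 0)
  have h0 : 𝓕 (0 : Z → ℂ) = 0 := by ext; simp [Real.fourier_eq]
  rw [h0] at h
  simpa using h

theorem hNormOn_mono_weight {r : Z → ℝ} {s s' : ℝ} {φ φ' : ℝ → ℝ} {C : ℝ} (hC : 0 < C)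
    (h : ∀ z, r z ^ s' * φ' (r z) ≤ C * (r z ^ s * φ (r z))) (U : Set Z) (v : Z → ℂ) :
    hNormOn r s' φ' U v ≤ ENNReal.ofReal C * hNormOn r s φ U v := by
  have hC0 : ENNReal.ofReal C ≠ 0 := by simpa using hC
  unfold hNormOn hNorm
  simp only [ENNReal.mul_iInf_of_ne hC0 ENNReal.ofReal_ne_top]
  gcongr with w hw F hF
  have e : ENNReal.ofReal C = (ENNReal.ofReal C ^ 2) ^ (1 / 2 : ℝ) := by
    rw [← ENNReal.rpow_natCast, ← ENNReal.rpow_mul]; norm_num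
  rw [e, ← ENNReal.mul_rpow_of_nonneg _ _ (by norm_num),
    ← lintegral_const_mul' _ _ (ENNReal.pow_ne_top ENNReal.ofReal_ne_top)]
  refine ENNReal.rpow_le_rpow (lintegral_mono fun z => ?_) (by norm_num)
  rw [← mul_assoc, ← mul_pow (ENNReal.ofReal C), ← ENNReal.ofReal_mul hC.le]
  exact mul_le_mul_left (pow_le_pow_left' (ENNReal.ofReal_le_ofReal (h _)) 2) _

end Integrable

/-- The Cauchy-Schwarz inequality for series in `[0, ∞]`. -/
theorem ENNReal_tsum_mul_sq_le (f g : ℕ → ℝ≥0∞) :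
    (∑' j, f j * g j) ^ 2 ≤ (∑' j, f j ^ 2) * ∑' j, g j ^ 2 := by
  have h := ENNReal.lintegral_mul_le_Lp_mul_Lq (Measure.count : Measure ℕ)
    Real.HolderConjugate.two_two (f := f) (g := g) (by fun_prop) (by fun_prop)
  simp only [lintegral_count, Pi.mul_apply] at h
  have h2 := pow_le_pow_left' h 2
  refine h2.trans_eq ?_
  rw [mul_pow, ← ENNReal.rpow_natCast, ← ENNReal.rpow_natCast, ← ENNReal.rpow_mul,
    ← ENNReal.rpow_mul]
  norm_num

theorem integrable_tsum_of_summable {Z : Type*} [MeasurableSpace Z] {μ : Measure Z}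
    {F : ℕ → Z → ℂ} (hF : ∀ j, Integrable (F j) μ)
    (hs : Summable fun j => ∫ z, ‖F j z‖ ∂μ) : Integrable (fun z => ∑' j, F j z) μ := by
  have htop : ∑' j, ∫⁻ z, ‖F j z‖ₑ ∂μ ≠ ⊤ := by
    have : ∀ j, ∫⁻ z, ‖F j z‖ₑ ∂μ = ENNReal.ofReal (∫ z, ‖F j z‖ ∂μ) := fun j =>
      (ofReal_integral_norm_eq_lintegral_enorm (hF j)).symm
    simp only [this]
    exact hs.tsum_ofReal_ne_top
  have hae : ∀ᵐ z ∂μ, Summable fun j => F j z := by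
    have h1 : ∑' j, eLpNorm (F j) 1 μ ≠ ⊤ := by simpa only [eLpNorm_one_eq_lintegral_enorm] using htop
    filter_upwards [summable_norm_of_tsum_eLpNorm_ne_top le_rfl (fun j => (hF j).1) h1] with z hz
    exact hz.of_norm
  refine ⟨?_, ?_⟩
  · refine aestronglyMeasurable_of_tendsto_ae atTop
      (f := fun (N : ℕ) z => ∑ j ∈ Finset.range N, F j z) (fun N => ?_) ?_
    · exact Finset.aestronglyMeasurable_fun_sum _ fun j _ => (hF j).1
    · filter_upwards [hae] with z hz using hz.hasSum.tendsto_sum_nat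
  · refine lt_of_le_of_lt (lintegral_mono fun z => enorm_tsum_le_tsum_enorm) ?_
    rw [lintegral_tsum fun j => (hF j).1.enorm]
    exact htop.lt_top

/-! ### Families of Schwartz functions -/

variable {d b : ℕ}

/-- The sequence `Ψ` is bounded in the Schwartz space. -/
def IsBoundedFamily (Ψ : ℕ → 𝓢(SpT d, ℂ)) : Prop :=
  ∀ k l, ∃ C, ∀ j, SchwartzMap.seminorm ℝ k l (Ψ j) ≤ C

theorem IsBoundedFamily.sup_le {Ψ : ℕ → 𝓢(SpT d, ℂ)} (hΨ : IsBoundedFamily Ψ)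
    (s : Finset (ℕ × ℕ)) :
    ∃ C, 0 ≤ C ∧ ∀ j, s.sup (schwartzSeminormFamily ℝ (SpT d) ℂ) (Ψ j) ≤ C := by
  choose K hK using hΨ
  have h0 : 0 ≤ ∑ i ∈ s, |K i.1 i.2| := Finset.sum_nonneg fun _ _ => abs_nonneg _
  refine ⟨_, h0, fun j => Seminorm.finset_sup_apply_le h0 fun i hi => ?_⟩
  exact ((hK i.1 i.2 j).trans (le_abs_self _)).trans
    (Finset.single_le_sum (f := fun i : ℕ × ℕ => |K i.1 i.2|) (fun _ _ => abs_nonneg _) hi)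

/-- The Fourier transform is continuous on the Schwartz space, so each seminorm of the image is
controlled by finitely many seminorms of the source. -/
theorem IsBoundedFamily.fourier {Ψ : ℕ → 𝓢(SpT d, ℂ)} (hΨ : IsBoundedFamily Ψ) :
    IsBoundedFamily fun j => 𝓕 (Ψ j) := by
  intro k l
  let q : Seminorm ℝ 𝓢(SpT d, ℂ) := (schwartzSeminormFamily ℝ (SpT d) ℂ (k, l)).comp
    (FourierTransform.fourierCLM ℝ 𝓢(SpT d, ℂ)).toLinearMap
  have hq : Continuous q := ((schwartz_withSeminorms ℝ (SpT d) ℂ).continuous_seminorm (k, l)).comp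
    (FourierTransform.fourierCLM ℝ 𝓢(SpT d, ℂ)).continuous
  obtain ⟨s, C, -, hC⟩ := Seminorm.bound_of_continuous (schwartz_withSeminorms ℝ (SpT d) ℂ) q hq
  obtain ⟨K, -, hK⟩ := hΨ.sup_le s
  exact ⟨C * K, fun j => (hC (Ψ j)).trans (mul_le_mul_of_nonneg_left (hK j) C.2)⟩

theorem IsBoundedFamily.fourier_decay {Ψ : ℕ → 𝓢(SpT d, ℂ)} (hΨ : IsBoundedFamily Ψ) (L : ℕ) :
    ∃ C, 0 < C ∧ ∀ j ζ, (1 + ‖ζ‖) ^ L * ‖𝓕 (Ψ j : SpT d → ℂ) ζ‖ ≤ C := by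
  obtain ⟨K, hK0, hK⟩ := hΨ.fourier.sup_le (Finset.Iic (L, 0))
  refine ⟨2 ^ L * K + 1, by positivity, fun j ζ => ?_⟩
  have h := SchwartzMap.one_add_le_sup_seminorm_apply (𝕜 := ℝ) (m := (L, 0)) le_rfl le_rfl
    (𝓕 (Ψ j)) ζ
  rw [norm_iteratedFDeriv_zero] at h
  exact (h.trans (mul_le_mul_of_nonneg_left (hK j) (by positivity))).trans (by simp)

theorem IsBoundedFamily.integral_norm_le {Ψ : ℕ → 𝓢(SpT d, ℂ)} (hΨ : IsBoundedFamily Ψ) :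
    ∃ C, 0 < C ∧ ∀ j, ∫ z, ‖Ψ j z‖ ≤ C := by
  obtain ⟨K₁, h₁⟩ := hΨ 0 0
  obtain ⟨K₂, h₂⟩ := hΨ (0 + (volume : Measure (SpT d)).integrablePower) 0
  set I := ∫ x : SpT d, (1 + ‖x‖) ^ (-((volume : Measure (SpT d)).integrablePower : ℝ))
  have hI : 0 ≤ I := integral_nonneg fun x => by positivity
  refine ⟨2 ^ (volume : Measure (SpT d)).integrablePower * I * (|K₁| + |K₂|) + 1, by positivity,
    fun j => ?_⟩
  have h := SchwartzMap.integral_pow_mul_iteratedFDeriv_le ℝ (volume : Measure (SpT d)) (Ψ j) 0 0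
  simp only [pow_zero, one_mul, norm_iteratedFDeriv_zero] at h
  refine h.trans ((mul_le_mul_of_nonneg_left (add_le_add ((h₁ j).trans (le_abs_self _))
    ((h₂ j).trans (le_abs_self _))) (by positivity)).trans ?_)
  linarith

theorem IsBoundedFamily.sum {ι : Type*} (s : Finset ι) {Ψ : ι → ℕ → 𝓢(SpT d, ℂ)}
    (hΨ : ∀ i ∈ s, IsBoundedFamily (Ψ i)) : IsBoundedFamily fun j => ∑ i ∈ s, Ψ i j := by
  classical
  intro k l
  induction s using Finset.induction_on with
  | empty => exact ⟨0, fun j => by simp⟩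
  | insert i s hi ih =>
    obtain ⟨C₁, h₁⟩ := ih fun i' hi' => hΨ i' (Finset.mem_insert_of_mem hi')
    obtain ⟨C₂, h₂⟩ := hΨ i (Finset.mem_insert_self _ _) k l
    refine ⟨C₂ + C₁, fun j => ?_⟩
    simp only [Finset.sum_insert hi]
    exact (map_add_le_add _ _ _).trans (add_le_add (h₂ j) (h₁ j))

theorem IsBoundedFamily.smul {Ψ : ℕ → 𝓢(SpT d, ℂ)} (hΨ : IsBoundedFamily Ψ) {c : ℕ → ℝ}
    (hc : ∀ j, |c j| ≤ 1) : IsBoundedFamily fun j => c j • Ψ j := by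
  intro k l
  obtain ⟨C, hC⟩ := hΨ k l
  refine ⟨C, fun j => ?_⟩
  rw [map_smul_eq_mul]
  exact (mul_le_of_le_one_left (apply_nonneg _ _) (hc j)).trans (hC j)

end

section

/-! ### Sums of rescaled Schwartz functions -/

variable {d b : ℕ}

theorem norm_fourier_comp_dilation {r : ℝ} (hr : 0 < r) (z₀ : SpT d) (Ψ : SpT d → ℂ) (ζ : SpT d) :
    ‖𝓕 (fun z => Ψ (dilation b r (z - z₀))) ζ‖ =
      (r ^ (d + 2 * b))⁻¹ * ‖𝓕 Ψ (dilation b r⁻¹ ζ)‖ := by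
  have h1 : 𝓕 (fun z => Ψ (dilation b r (z - z₀))) ζ =
      (Real.fourierChar (-⟪z₀, ζ⟫_ℝ) : ℂ) *
        (((r ^ (d + 2 * b))⁻¹ : ℝ) * 𝓕 Ψ (dilation b r⁻¹ ζ)) := by
    rw [Real.fourier_eq, Real.fourier_eq, ← integral_comp_dilation hr, ← integral_const_mul,
      ← integral_add_right_eq_self _ z₀]
    refine integral_congr_ae (ae_of_all _ fun z => ?_)
    have e : ⟪dilation b r z, dilation b r⁻¹ ζ⟫_ℝ = ⟪z, ζ⟫_ℝ := by
      rw [inner_dilation, dilation_dilation_inv hr.ne']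
    simp only [Circle.smul_def, smul_eq_mul, e, add_sub_cancel_right]
    rw [← mul_assoc, ← Circle.coe_mul, ← AddChar.map_add_eq_mul, inner_add_left, neg_add_rev]
  rw [h1, norm_mul, norm_mul, Circle.norm_coe, one_mul, Complex.norm_real,
    Real.norm_of_nonneg (by positivity)]

theorem integral_norm_comp_dilation {r : ℝ} (hr : 0 < r) (z₀ : SpT d) (Ψ : SpT d → ℂ) :
    ∫ z, ‖Ψ (dilation b r (z - z₀))‖ = (r ^ (d + 2 * b))⁻¹ * ∫ z, ‖Ψ z‖ := by
  rw [integral_sub_right_eq_self (fun z => ‖Ψ (dilation b r z)‖) z₀,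
    ← (measurableEmbedding_dilation hr).integral_map (fun z => ‖Ψ z‖), map_dilation_volume hr,
    integral_smul_measure, ENNReal.toReal_ofReal (by positivity), smul_eq_mul]

theorem integrable_comp_dilation {r : ℝ} (hr : 0 < r) (z₀ : SpT d) {Ψ : SpT d → ℂ}
    (hΨ : Integrable Ψ) : Integrable fun z => Ψ (dilation b r (z - z₀)) := by
  have h : Integrable (fun z => Ψ (dilation b r z)) := by
    have h1 : Integrable Ψ (Measure.map (dilation b r : SpT d → SpT d) volume) := by
      rw [map_dilation_volume hr]
      exact hΨ.smul_measure ENNReal.ofReal_ne_top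
    exact (measurableEmbedding_dilation hr).integrable_map_iff.1 h1
  exact h.comp_sub_right z₀

/-- Potter's bound with δ = σ/2 spends only half of the power σ, so with x = R/r the ratio of
weights still decays like x^{σ/2} as x → 0 and grows polynomially as x → ∞. The decay at low
frequencies makes different scales almost orthogonal. -/
theorem weight_le_of_potter {φ : ℝ → ℝ} (hφ : ClassM φ) {σ : ℝ} (hσ : 0 < σ) :
    ∃ C, 0 < C ∧ ∀ R r : ℝ, 1 ≤ R → 1 ≤ r → R ^ σ * φ R ≤
      C * (r ^ σ * φ r) * ((r⁻¹ * R) ^ (σ / 2) * (1 + r⁻¹ * R) ^ σ) := by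
  obtain ⟨C, hC, h⟩ := hφ.potter (half_pos hσ)
  refine ⟨C, hC, fun R r hR hr => ?_⟩
  have hR0 : 0 < R := one_pos.trans_le hR
  have hr0 : 0 < r := one_pos.trans_le hr
  set x := r⁻¹ * R with hx
  have hx0 : 0 < x := by positivity
  have hlog : Real.log R - Real.log r = Real.log x := by
    rw [hx, Real.log_mul (by positivity) hR0.ne', Real.log_inv]; ring
  have hRx : R = r * x := by rw [hx]; field_simp
  have hmain : x ^ σ * Real.exp (σ / 2 * |Real.log x|) ≤ x ^ (σ / 2) * (1 + x) ^ σ := by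
    rcases le_total x 1 with h1 | h1
    · rw [abs_of_nonpos (Real.log_nonpos hx0.le h1)]
      have e : x ^ σ * Real.exp (σ / 2 * -Real.log x) = x ^ (σ / 2) := by
        rw [Real.rpow_def_of_pos hx0, Real.rpow_def_of_pos hx0, ← Real.exp_add]
        congr 1; ring
      rw [e]
      exact le_mul_of_one_le_right (by positivity)
        (Real.one_le_rpow (by linarith) hσ.le)
    · rw [abs_of_nonneg (Real.log_nonneg h1)]
      have e : Real.exp (σ / 2 * Real.log x) = x ^ (σ / 2) := by
        rw [Real.rpow_def_of_pos hx0, mul_comm]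
      rw [e, mul_comm]
      gcongr
      linarith
  have h2 := h R r hR hr
  rw [hlog] at h2
  have hp := hφ.pos r hr
  calc R ^ σ * φ R ≤ R ^ σ * (C * φ r * Real.exp (σ / 2 * |Real.log x|)) := by gcongr
    _ = C * (r ^ σ * φ r) * (x ^ σ * Real.exp (σ / 2 * |Real.log x|)) := by
      rw [hRx, Real.mul_rpow hr0.le hx0.le]; ring
    _ ≤ _ := by gcongr

/-- A bounded profile in the logarithmic scale. -/
def profile (γ x : ℝ) : ℝ := x ^ γ / (1 + x ^ γ) ^ 2

theorem profile_nonneg (γ : ℝ) {x : ℝ} (hx : 0 ≤ x) : 0 ≤ profile γ x := by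
  unfold profile; positivity

theorem profile_le_one (γ : ℝ) {x : ℝ} (hx : 0 ≤ x) : profile γ x ≤ 1 := by
  unfold profile
  have : 0 ≤ x ^ γ := by positivity
  rw [div_le_one (by positivity)]
  nlinarith

/-- With T_{j+1} = q T_j, the profile is dominated by a multiple of the increment of T/(1 + T), so
the sum telescopes and its bound does not depend on R. At any one frequency all scales together thus
contribute a bounded amount. -/
theorem tsum_profile_le {γ : ℝ} (hγ : 0 < γ) {R : ℝ} (hR : 0 < R) :
    ∑' j : ℕ, ENNReal.ofReal (profile γ (((2 : ℝ) ^ j)⁻¹ * R)) ≤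
      ENNReal.ofReal (1 - (2 : ℝ)⁻¹ ^ γ)⁻¹ := by
  set q : ℝ := (2 : ℝ)⁻¹ ^ γ with hq
  have hq0 : 0 < q := by positivity
  have hq1 : q < 1 := Real.rpow_lt_one (by positivity) (by norm_num) hγ
  let T : ℕ → ℝ := fun j => (((2 : ℝ) ^ j)⁻¹ * R) ^ γ
  have hT0 : ∀ j, 0 < T j := fun j => by positivity
  have hTs : ∀ j, T (j + 1) = q * T j := fun j => by
    simp only [T, hq]
    rw [← Real.mul_rpow (by positivity) (by positivity), pow_succ, mul_inv]
    congr 1; ring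
  have hstep : ∀ j, profile γ (((2 : ℝ) ^ j)⁻¹ * R) ≤
      (1 - q)⁻¹ * (T j / (1 + T j) - T (j + 1) / (1 + T (j + 1))) := by
    intro j
    have h0 := hT0 j
    have e : T j / (1 + T j) - T (j + 1) / (1 + T (j + 1)) =
        (1 - q) * (T j / ((1 + T j) * (1 + q * T j))) := by
      rw [hTs]; field_simp; ring
    rw [e, ← mul_assoc, inv_mul_cancel₀ (by linarith), one_mul]
    change T j / (1 + T j) ^ 2 ≤ _
    rw [sq]
    gcongr
    nlinarith
  rw [ENNReal.tsum_eq_iSup_nat]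
  refine iSup_le fun N => ?_
  rw [← ENNReal.ofReal_sum_of_nonneg fun j _ => profile_nonneg _ (by positivity)]
  refine ENNReal.ofReal_le_ofReal ((Finset.sum_le_sum fun j _ => hstep j).trans ?_)
  rw [← Finset.mul_sum, Finset.sum_range_sub' (fun j => T j / (1 + T j))]
  refine mul_le_of_le_one_right (by rw [inv_nonneg]; linarith) ?_
  have h1 : T 0 / (1 + T 0) ≤ 1 := by
    have := hT0 0
    rw [div_le_one (by positivity)]; linarith
  have h2 : 0 ≤ T N / (1 + T N) := by have := hT0 N; positivity
  linarith

/-- The normalizing factor of the `j`-th term of a wave of order `σ`. -/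
def waveCoeff (φ : ℝ → ℝ) (d b : ℕ) (σ : ℝ) (j : ℕ) : ℝ :=
  (φ (2 ^ j))⁻¹ * ((2 : ℝ) ^ j) ^ ((d : ℝ) / 2 + b - σ)

/-- The sum of the functions `Ψ_j` rescaled to the frequency `2^j`, with coefficients `a_j`. -/
def wave (φ : ℝ → ℝ) (b : ℕ) (σ : ℝ) (z₀ : SpT d) (Ψ : ℕ → 𝓢(SpT d, ℂ)) (a : ℕ → ℝ) (z : SpT d) :
    ℂ :=
  ∑' j, ((a j * waveCoeff φ d b σ j : ℝ) : ℂ) * Ψ j (dilation b (2 ^ j) (z - z₀))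

theorem waveCoeff_pos {φ : ℝ → ℝ} (hφ : ClassM φ) (σ : ℝ) (j : ℕ) : 0 < waveCoeff φ d b σ j := by
  have := hφ.pos (2 ^ j) (one_le_pow₀ one_le_two)
  unfold waveCoeff; positivity

/-- The decisive pointwise bound for the weighted Fourier transform of a single term. -/
theorem exists_term_bound {φ : ℝ → ℝ} (hφ : ClassM φ) (hb : 1 ≤ b) {σ : ℝ} (hσ : 0 < σ)
    {Ψ : ℕ → 𝓢(SpT d, ℂ)} (hΨ : IsBoundedFamily Ψ) :
    ∃ C, 0 < C ∧ ∀ (j : ℕ) (ζ : SpT d),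
      anisoBase b ((2 * Real.pi) • ζ) ^ σ * φ (anisoBase b ((2 * Real.pi) • ζ)) *
        (waveCoeff φ d b σ j * ((((2 : ℝ) ^ j) ^ (d + 2 * b))⁻¹ *
          ‖𝓕 (Ψ j : SpT d → ℂ) (dilation b ((2 : ℝ) ^ j)⁻¹ ζ)‖)) ≤
      C * ((2 : ℝ) ^ j) ^ (-((d : ℝ) / 2 + b)) *
        profile (σ / 2) (((2 : ℝ) ^ j)⁻¹ * anisoBase b ((2 * Real.pi) • ζ)) *
        (1 + ‖dilation b ((2 : ℝ) ^ j)⁻¹ ζ‖) ^ (-((d : ℝ) + 2)) := by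
  obtain ⟨C₁, hC₁, h₁⟩ := weight_le_of_potter hφ hσ
  obtain ⟨K, hK⟩ := exists_nat_ge (2 * σ)
  -- K ≥ 2σ powers of decay absorb the growth of the weight; the remaining d + 2 exceed the
  -- dimension d + 1 of space-time and give integrability.
  obtain ⟨C₂, hC₂, h₂⟩ := hΨ.fourier_decay (K + (d + 2))
  refine ⟨C₁ * C₂ * 9 ^ K * 4, by positivity, fun j ζ => ?_⟩
  set r : ℝ := (2 : ℝ) ^ j
  have hr : 1 ≤ r := one_le_pow₀ one_le_two
  have hr0 : 0 < r := one_pos.trans_le hr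
  set R := anisoBase b ((2 * Real.pi) • ζ)
  have hR : 1 ≤ R := one_le_anisoBase _
  have hR0 : 0 < R := one_pos.trans_le hR
  set ζ' := dilation b r⁻¹ ζ
  set x := r⁻¹ * R
  have hx : 0 < x := by positivity
  have hp := hφ.pos r hr
  have hx9 : 1 + x ≤ 9 * (1 + ‖ζ'‖) := by
    have := inv_mul_anisoBase_le hb hr ζ
    have := norm_nonneg ζ'
    change x ≤ 8 * (1 + ‖ζ'‖) at *
    linarith
  have hF : ‖𝓕 (Ψ j : SpT d → ℂ) ζ'‖ ≤
      C₂ * 9 ^ K * ((1 + x) ^ (2 * σ))⁻¹ * (1 + ‖ζ'‖) ^ (-((d : ℝ) + 2)) := by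
    have hz : 0 < 1 + ‖ζ'‖ := by positivity
    have e1 : (1 + ‖ζ'‖) ^ (-((d : ℝ) + 2)) = ((1 + ‖ζ'‖) ^ (d + 2))⁻¹ := by
      rw [Real.rpow_neg hz.le, ← Real.rpow_natCast]; push_cast; rfl
    have e2 : (1 + x) ^ (2 * σ) ≤ 9 ^ K * (1 + ‖ζ'‖) ^ K := by
      calc (1 + x) ^ (2 * σ) ≤ (1 + x) ^ (K : ℝ) :=
            Real.rpow_le_rpow_of_exponent_le (by linarith) hK
        _ = (1 + x) ^ K := Real.rpow_natCast _ _
        _ ≤ (9 * (1 + ‖ζ'‖)) ^ K := by gcongr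
        _ = _ := mul_pow _ _ _
    have h3 := h₂ j ζ'
    rw [pow_add] at h3
    rw [e1]
    have hx2 : 0 < (1 + x) ^ (2 * σ) := by positivity
    have e3 : C₂ * 9 ^ K * ((1 + x) ^ (2 * σ))⁻¹ * ((1 + ‖ζ'‖) ^ (d + 2))⁻¹ =
        C₂ * 9 ^ K / ((1 + x) ^ (2 * σ) * (1 + ‖ζ'‖) ^ (d + 2)) := by
      field_simp
    rw [e3, le_div_iff₀ (by positivity)]
    calc ‖𝓕 (Ψ j : SpT d → ℂ) ζ'‖ * ((1 + x) ^ (2 * σ) * (1 + ‖ζ'‖) ^ (d + 2))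
        ≤ ‖𝓕 (Ψ j : SpT d → ℂ) ζ'‖ * ((9 ^ K * (1 + ‖ζ'‖) ^ K) * (1 + ‖ζ'‖) ^ (d + 2)) := by
          gcongr
      _ = 9 ^ K * ((1 + ‖ζ'‖) ^ K * (1 + ‖ζ'‖) ^ (d + 2) * ‖𝓕 (Ψ j : SpT d → ℂ) ζ'‖) := by ring
      _ ≤ 9 ^ K * C₂ := by gcongr
      _ = _ := mul_comm _ _
  -- The 4 is the square of the 2 in 1 + x^{σ/2} ≤ 2 (1 + x)^{σ/2}.
  have hprof : x ^ (σ / 2) * (1 + x) ^ σ * ((1 + x) ^ (2 * σ))⁻¹ ≤ 4 * profile (σ / 2) x := by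
    have e1 : (1 + x) ^ σ * ((1 + x) ^ (2 * σ))⁻¹ = (((1 + x) ^ (σ / 2)) ^ 2)⁻¹ := by
      rw [← Real.rpow_neg (by positivity), ← Real.rpow_add (by positivity), ← Real.rpow_natCast,
        ← Real.rpow_mul (by positivity), ← Real.rpow_neg (by positivity)]
      congr 1; push_cast; ring
    have e2 : 1 + x ^ (σ / 2) ≤ 2 * (1 + x) ^ (σ / 2) := by
      have a1 : 1 ≤ (1 + x) ^ (σ / 2) := Real.one_le_rpow (by linarith) (by positivity)
      have a2 : x ^ (σ / 2) ≤ (1 + x) ^ (σ / 2) :=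
        Real.rpow_le_rpow hx.le (by linarith) (by positivity)
      linarith
    rw [mul_assoc, e1]
    unfold profile
    have h5 : (1 + x ^ (σ / 2)) ^ 2 ≤ 4 * ((1 + x) ^ (σ / 2)) ^ 2 := by
      calc (1 + x ^ (σ / 2)) ^ 2 ≤ (2 * (1 + x) ^ (σ / 2)) ^ 2 := by gcongr
        _ = _ := by ring
    rw [← div_eq_mul_inv, mul_div_assoc', div_le_div_iff₀ (by positivity) (by positivity)]
    nlinarith [Real.rpow_nonneg hx.le (σ / 2)]
  -- The coefficient cancels the weight at frequency r and leaves the square root of the Jacobian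
  -- r^{-(d+2b)}, so the weighted L² size of a term is independent of the scale.
  have hcoef : waveCoeff φ d b σ j * (r ^ (d + 2 * b))⁻¹ * (r ^ σ * φ r) =
      r ^ (-((d : ℝ) / 2 + b)) := by
    have e1 : (r ^ (d + 2 * b))⁻¹ = r ^ (-((d : ℝ) + 2 * b)) := by
      rw [Real.rpow_neg hr0.le, ← Real.rpow_natCast]; push_cast; rfl
    unfold waveCoeff
    change (φ r)⁻¹ * r ^ ((d : ℝ) / 2 + b - σ) * _ * _ = _
    rw [e1]
    calc (φ r)⁻¹ * r ^ ((d : ℝ) / 2 + b - σ) * r ^ (-((d : ℝ) + 2 * b)) * (r ^ σ * φ r)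
        = ((φ r)⁻¹ * φ r) *
          (r ^ ((d : ℝ) / 2 + b - σ) * r ^ (-((d : ℝ) + 2 * b)) * r ^ σ) := by ring
      _ = _ := by
        rw [inv_mul_cancel₀ hp.ne', one_mul, ← Real.rpow_add hr0, ← Real.rpow_add hr0]
        congr 1; ring
  have hw := waveCoeff_pos (d := d) (b := b) hφ σ j
  have hw1 := h₁ R r hR hr
  calc R ^ σ * φ R * (waveCoeff φ d b σ j * ((r ^ (d + 2 * b))⁻¹ * ‖𝓕 (Ψ j : SpT d → ℂ) ζ'‖))
      ≤ (C₁ * (r ^ σ * φ r) * (x ^ (σ / 2) * (1 + x) ^ σ)) *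
        (waveCoeff φ d b σ j * ((r ^ (d + 2 * b))⁻¹ *
          (C₂ * 9 ^ K * ((1 + x) ^ (2 * σ))⁻¹ * (1 + ‖ζ'‖) ^ (-((d : ℝ) + 2))))) := by
        gcongr
    _ = C₁ * C₂ * 9 ^ K * (waveCoeff φ d b σ j * (r ^ (d + 2 * b))⁻¹ * (r ^ σ * φ r)) *
        (x ^ (σ / 2) * (1 + x) ^ σ * ((1 + x) ^ (2 * σ))⁻¹) *
          (1 + ‖ζ'‖) ^ (-((d : ℝ) + 2)) := by ring
    _ ≤ C₁ * C₂ * 9 ^ K * r ^ (-((d : ℝ) / 2 + b)) * (4 * profile (σ / 2) x) *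
          (1 + ‖ζ'‖) ^ (-((d : ℝ) + 2)) := by
        rw [hcoef]; gcongr
    _ = _ := by ring

end

/-! ### Norm estimate for waves by near orthogonality of the scales -/

section

variable {d b : ℕ}

theorem fourier_const_mul (c : ℂ) (g : SpT d → ℂ) (ζ : SpT d) :
    𝓕 (fun z => c * g z) ζ = c * 𝓕 g ζ := by
  rw [Real.fourier_eq, Real.fourier_eq, ← integral_const_mul]
  refine integral_congr_ae (ae_of_all _ fun z => ?_)
  simp only [Circle.smul_def, smul_eq_mul]
  ring

theorem fourier_tsum {F : ℕ → SpT d → ℂ} (hF : ∀ j, Integrable (F j))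
    (hs : Summable fun j => ∫ z, ‖F j z‖) (ζ : SpT d) :
    𝓕 (fun z => ∑' j, F j z) ζ = ∑' j, 𝓕 (F j) ζ := by
  simp only [Real.fourier_eq]
  rw [integral_tsum_of_summable_integral_norm
    (F := fun j z => Real.fourierChar (-⟪z, ζ⟫_ℝ) • F j z)]
  · refine integral_congr_ae (ae_of_all _ fun z => ?_)
    simp only [Circle.smul_def, smul_eq_mul, tsum_mul_left]
  · exact fun j => (Real.fourierIntegral_convergent_iff ζ).2 (hF j)
  · simpa only [Circle.norm_smul] using hs

/-- Convergence in L¹, needed to take the Fourier transform termwise. Potter's bound with δ = σ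
absorbs r^{-σ} and the Jacobian leaves r^{-(d/2+b)} ≤ r⁻¹ with r = 2^j, a geometric series. -/
theorem summable_integral_norm_wave {φ : ℝ → ℝ} (hφ : ClassM φ) (hb : 1 ≤ b) {σ : ℝ}
    (hσ : 0 < σ) (z₀ : SpT d) {Ψ : ℕ → 𝓢(SpT d, ℂ)} (hΨ : IsBoundedFamily Ψ) {a : ℕ → ℝ}
    (ha : Summable fun j => a j ^ 2) :
    Summable fun j => ∫ z, ‖((a j * waveCoeff φ d b σ j : ℝ) : ℂ) *
      Ψ j (dilation b (2 ^ j) (z - z₀))‖ := by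
  obtain ⟨C, hC, hpot⟩ := hφ.potter hσ
  obtain ⟨I, hI, hΨI⟩ := hΨ.integral_norm_le
  have hφ1 := hφ.pos 1 le_rfl
  set S := ∑' j, a j ^ 2
  have hS : 0 ≤ S := tsum_nonneg fun j => sq_nonneg _
  refine Summable.of_nonneg_of_le (fun j => integral_nonneg fun z => norm_nonneg _) (fun j => ?_)
    ((summable_geometric_of_lt_one (r := (2 : ℝ)⁻¹) (by norm_num) (by norm_num)).mul_left
      ((1 + S) * (C / φ 1) * I))
  set r : ℝ := (2 : ℝ) ^ j
  have hr : 1 ≤ r := one_le_pow₀ one_le_two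
  have hr0 : 0 < r := one_pos.trans_le hr
  have hp := hφ.pos r hr
  have hw := waveCoeff_pos (d := d) (b := b) hφ σ j
  have haj : |a j| ≤ 1 + S := by
    have h1 : a j ^ 2 ≤ S := ha.le_tsum j fun _ _ => sq_nonneg _
    refine abs_le_of_sq_le_sq ?_ (by positivity)
    nlinarith
  have hcoef : waveCoeff φ d b σ j * (r ^ (d + 2 * b))⁻¹ ≤ C / φ 1 * r⁻¹ := by
    have h1 := hpot 1 r le_rfl hr
    have e1 : Real.exp (σ * |Real.log 1 - Real.log r|) = r ^ σ := by
      rw [Real.log_one, zero_sub, abs_neg, abs_of_nonneg (Real.log_nonneg hr),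
        Real.rpow_def_of_pos hr0, mul_comm]
    rw [e1] at h1
    have e2 : (φ r)⁻¹ ≤ C / φ 1 * r ^ σ := by
      rw [inv_le_iff_one_le_mul₀ hp, div_mul_eq_mul_div, div_mul_eq_mul_div,
        one_le_div hφ1]
      linarith
    have e3 : (r ^ (d + 2 * b))⁻¹ = r ^ (-((d : ℝ) + 2 * b)) := by
      rw [Real.rpow_neg hr0.le, ← Real.rpow_natCast]; push_cast; rfl
    have hb' : (1 : ℝ) ≤ b := by exact_mod_cast hb
    calc waveCoeff φ d b σ j * (r ^ (d + 2 * b))⁻¹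
        = (φ r)⁻¹ * r ^ ((d : ℝ) / 2 + b - σ) * (r ^ (d + 2 * b))⁻¹ := rfl
      _ ≤ (C / φ 1 * r ^ σ) * r ^ ((d : ℝ) / 2 + b - σ) * (r ^ (d + 2 * b))⁻¹ := by gcongr
      _ = C / φ 1 * r ^ (-((d : ℝ) / 2 + b)) := by
        rw [e3, mul_assoc, mul_assoc, ← Real.rpow_add hr0, ← Real.rpow_add hr0]
        congr 2; ring
      _ ≤ C / φ 1 * r ^ (-1 : ℝ) := by
        gcongr
        have : (0 : ℝ) ≤ d := Nat.cast_nonneg d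
        linarith
      _ = _ := by rw [Real.rpow_neg_one]
  simp only [norm_mul, Complex.norm_real, norm_mul, Real.norm_eq_abs, abs_of_pos hw]
  rw [integral_const_mul, integral_norm_comp_dilation hr0]
  calc |a j| * waveCoeff φ d b σ j * ((r ^ (d + 2 * b))⁻¹ * ∫ z, ‖Ψ j z‖)
      = |a j| * (waveCoeff φ d b σ j * (r ^ (d + 2 * b))⁻¹) * ∫ z, ‖Ψ j z‖ := by ring
    _ ≤ (1 + S) * (C / φ 1 * r⁻¹) * I := by
      have := hΨI j
      gcongr
    _ = _ := by simp only [r]; rw [inv_pow]; ring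

theorem integrable_wave_term (φ : ℝ → ℝ) (σ : ℝ) (z₀ : SpT d) (Ψ : ℕ → 𝓢(SpT d, ℂ)) (a : ℕ → ℝ)
    (j : ℕ) : Integrable fun z => ((a j * waveCoeff φ d b σ j : ℝ) : ℂ) *
      Ψ j (dilation b (2 ^ j) (z - z₀)) :=
  (integrable_comp_dilation (by positivity) z₀ (Ψ j).integrable).const_mul _

theorem lintegral_one_add_norm_lt_top :
    ∫⁻ z : SpT d, ENNReal.ofReal ((1 + ‖z‖) ^ (-((d : ℝ) + 2))) < ⊤ := by
  refine finite_integral_one_add_norm ?_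
  have : Module.finrank ℝ (SpT d) = d + 1 := by
    rw [(WithLp.linearEquiv 2 ℝ (Sp d × ℝ)).finrank_eq]; simp
  rw [this]; push_cast; linarith

/-- The norm of a wave of order `σ` is bounded by the `ℓ²` norm of its coefficients. -/
theorem exists_hNormOn_wave_le {φ : ℝ → ℝ} (hφ : ClassM φ) (hb : 1 ≤ b) {σ : ℝ} (hσ : 0 < σ)
    (z₀ : SpT d) {Ψ : ℕ → 𝓢(SpT d, ℂ)} (hΨ : IsBoundedFamily Ψ) :
    ∃ C : ℝ≥0∞, C ≠ ⊤ ∧ ∀ a : ℕ → ℝ, (Summable fun j => a j ^ 2) → ∀ (U : Set (SpT d))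
      (v : SpT d → ℂ), v =ᵐ[volume] wave φ b σ z₀ Ψ a →
        hNormOn (anisoBase b) σ φ U v ≤
          C * (∑' j, ENNReal.ofReal (a j ^ 2)) ^ (1 / 2 : ℝ) := by
  obtain ⟨C, hC, hterm⟩ := exists_term_bound hφ hb hσ hΨ
  set I := ∫⁻ z : SpT d, ENNReal.ofReal ((1 + ‖z‖) ^ (-((d : ℝ) + 2)))
  have hI : I ≠ ⊤ := lintegral_one_add_norm_lt_top.ne
  set M : ℝ≥0∞ := ENNReal.ofReal (1 - (2 : ℝ)⁻¹ ^ (σ / 2))⁻¹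
  refine ⟨(ENNReal.ofReal C ^ 2 * M * I) ^ (1 / 2 : ℝ), ?_, fun a ha U v hv => ?_⟩
  · exact ENNReal.rpow_ne_top_of_nonneg (by norm_num)
      (ENNReal.mul_ne_top (ENNReal.mul_ne_top (by simp) ENNReal.ofReal_ne_top) hI)
  have hInt := integrable_wave_term (b := b) φ σ z₀ Ψ a
  have hsum := summable_integral_norm_wave hφ hb hσ z₀ hΨ ha
  have hW : Integrable (wave φ b σ z₀ Ψ a) := integrable_tsum_of_summable hInt hsum
  refine (hNormOn_le_of_integrable _ _ _ _ hW hv).trans ?_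
  rw [← ENNReal.mul_rpow_of_nonneg _ _ (by norm_num)]
  refine ENNReal.rpow_le_rpow ?_ (by norm_num)
  let r : ℕ → ℝ := fun j => (2 : ℝ) ^ j
  let e : ℕ → SpT d → ℝ := fun j ζ => (1 + ‖dilation b (r j)⁻¹ ζ‖) ^ (-((d : ℝ) + 2))
  let T : ℕ → SpT d → ℝ := fun j ζ =>
    profile (σ / 2) ((r j)⁻¹ * anisoBase b ((2 * Real.pi) • ζ))
  have hr0 : ∀ j, 0 < r j := fun j => by positivity
  have hR0 : ∀ ζ : SpT d, 0 < anisoBase b ζ := fun ζ => one_pos.trans_le (one_le_anisoBase ζ)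
  have hT0 : ∀ j ζ, 0 ≤ T j ζ := fun j ζ =>
    profile_nonneg _ (mul_nonneg (inv_nonneg.2 (hr0 j).le) (hR0 _).le)
  have hT1 : ∀ j ζ, T j ζ ≤ 1 := fun j ζ =>
    profile_le_one _ (mul_nonneg (inv_nonneg.2 (hr0 j).le) (hR0 _).le)
  have he0 : ∀ j ζ, 0 ≤ e j ζ := fun j ζ => by positivity
  have he1 : ∀ j ζ, e j ζ ≤ 1 := fun j ζ =>
    Real.rpow_le_one_of_one_le_of_nonpos (by linarith [norm_nonneg (dilation b (r j)⁻¹ ζ)])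
      (by linarith [(Nat.cast_nonneg d : (0 : ℝ) ≤ d)])
  have hpt : ∀ ζ : SpT d,
      ENNReal.ofReal (anisoBase b ((2 * Real.pi) • ζ) ^ σ * φ (anisoBase b ((2 * Real.pi) • ζ))) ^ 2
        * ‖𝓕 (wave φ b σ z₀ Ψ a) ζ‖ₑ ^ 2 ≤
      ENNReal.ofReal C ^ 2 * M * ∑' j, ENNReal.ofReal (a j ^ 2) *
        (ENNReal.ofReal ((r j ^ (d + 2 * b))⁻¹) * ENNReal.ofReal (e j ζ)) := by
    intro ζ
    set w := anisoBase b ((2 * Real.pi) • ζ) ^ σ * φ (anisoBase b ((2 * Real.pi) • ζ))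
    have hw0 : 0 ≤ w := mul_nonneg (Real.rpow_nonneg (hR0 _).le _)
      (hφ.pos _ (one_le_anisoBase _)).le
    -- The profile T is split as √T · √T for Cauchy–Schwarz: one factor gives Σ T_j ≤ M uniformly in
    -- ζ, the other keeps the squares a_j².
    have h1 : ENNReal.ofReal w * ‖𝓕 (wave φ b σ z₀ Ψ a) ζ‖ₑ ≤
        ∑' j, ENNReal.ofReal √(T j ζ) * (ENNReal.ofReal C * ENNReal.ofReal
          (|a j| * r j ^ (-((d : ℝ) / 2 + b)) * √(T j ζ) * e j ζ)) := by
      have hf : 𝓕 (wave φ b σ z₀ Ψ a) ζ = ∑' j, 𝓕 (fun z =>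
          ((a j * waveCoeff φ d b σ j : ℝ) : ℂ) * Ψ j (dilation b (2 ^ j) (z - z₀))) ζ :=
        fourier_tsum hInt hsum ζ
      rw [hf]
      refine (mul_le_mul_right enorm_tsum_le_tsum_enorm _).trans ?_
      rw [← ENNReal.tsum_mul_left]
      refine ENNReal.tsum_le_tsum fun j => ?_
      rw [← ofReal_norm, ← ENNReal.ofReal_mul hw0, ← ENNReal.ofReal_mul hC.le,
        ← ENNReal.ofReal_mul (Real.sqrt_nonneg _)]
      refine ENNReal.ofReal_le_ofReal ?_
      have hwc := waveCoeff_pos (d := d) (b := b) hφ σ j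
      rw [fourier_const_mul, norm_mul, Complex.norm_real, Real.norm_eq_abs, abs_mul,
        abs_of_pos hwc, norm_fourier_comp_dilation (hr0 j)]
      have h2 := mul_le_mul_of_nonneg_left (hterm j ζ) (abs_nonneg (a j))
      calc w * (|a j| * waveCoeff φ d b σ j * ((r j ^ (d + 2 * b))⁻¹ *
            ‖𝓕 (Ψ j : SpT d → ℂ) (dilation b (r j)⁻¹ ζ)‖))
          = |a j| * (w * (waveCoeff φ d b σ j * ((r j ^ (d + 2 * b))⁻¹ *
            ‖𝓕 (Ψ j : SpT d → ℂ) (dilation b (r j)⁻¹ ζ)‖))) := by ring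
        _ ≤ |a j| * (C * r j ^ (-((d : ℝ) / 2 + b)) * T j ζ * e j ζ) := h2
        _ = √(T j ζ) * (C * (|a j| * r j ^ (-((d : ℝ) / 2 + b)) * √(T j ζ) * e j ζ)) := by
          rw [← Real.mul_self_sqrt (hT0 j ζ)]
          simp only [Real.sqrt_mul_self (Real.sqrt_nonneg _)]
          ring
    rw [← mul_pow]
    refine (pow_le_pow_left' h1 2).trans ((ENNReal_tsum_mul_sq_le _ _).trans ?_)
    simp only [mul_pow]
    rw [ENNReal.tsum_mul_left, mul_comm (ENNReal.ofReal C ^ 2) M, mul_assoc M]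
    have hTs : ∑' j, ENNReal.ofReal √(T j ζ) ^ 2 ≤ M := by
      have : ∀ j, ENNReal.ofReal √(T j ζ) ^ 2 = ENNReal.ofReal (T j ζ) := fun j => by
        rw [← ENNReal.ofReal_pow (Real.sqrt_nonneg _), Real.sq_sqrt (hT0 j ζ)]
      simp only [this]
      exact tsum_profile_le (half_pos hσ) (hR0 _)
    refine mul_le_mul' hTs (mul_le_mul_right (ENNReal.tsum_le_tsum fun j => ?_) _)
    rw [← ENNReal.ofReal_pow (mul_nonneg (by positivity) (he0 j ζ)),
      ← ENNReal.ofReal_mul (inv_nonneg.2 (pow_nonneg (hr0 j).le _)),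
      ← ENNReal.ofReal_mul (sq_nonneg _)]
    refine ENNReal.ofReal_le_ofReal ?_
    rw [mul_pow, mul_pow, mul_pow, sq_abs, Real.sq_sqrt (hT0 j ζ)]
    have e1 : (r j ^ (-((d : ℝ) / 2 + b))) ^ 2 = (r j ^ (d + 2 * b))⁻¹ := by
      rw [← Real.rpow_natCast, ← Real.rpow_mul (hr0 j).le, ← Real.rpow_natCast (r j),
        ← Real.rpow_neg (hr0 j).le]
      congr 1; push_cast; ring
    rw [e1, mul_assoc, mul_assoc]
    have e2 : T j ζ * e j ζ ^ 2 ≤ e j ζ := by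
      calc T j ζ * e j ζ ^ 2 ≤ 1 * (e j ζ * 1) := by
            rw [sq]
            exact mul_le_mul (hT1 j ζ) (mul_le_mul_of_nonneg_left (he1 j ζ) (he0 j ζ))
              (mul_nonneg (he0 j ζ) (he0 j ζ)) zero_le_one
        _ = e j ζ := by ring
    have := (inv_nonneg.2 (pow_nonneg (hr0 j).le (d + 2 * b)))
    gcongr
  refine (lintegral_mono hpt).trans ?_
  have hem : ∀ j, Measurable fun ζ : SpT d => ENNReal.ofReal (e j ζ) := fun j => by
    refine ENNReal.measurable_ofReal.comp (Continuous.measurable ?_)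
    refine Continuous.rpow_const (by fun_prop) fun ζ => Or.inl ?_
    positivity
  rw [lintegral_const_mul' _ _ (ENNReal.mul_ne_top (by simp) ENNReal.ofReal_ne_top),
    lintegral_tsum fun j => (((hem j).const_mul _).const_mul _).aemeasurable]
  -- The change of variables by the dilation exactly cancels (r_j^{d+2b})⁻¹, so every scale
  -- contributes the same integral I.
  have hj : ∀ j, ∫⁻ ζ, ENNReal.ofReal (a j ^ 2) *
      (ENNReal.ofReal ((r j ^ (d + 2 * b))⁻¹) * ENNReal.ofReal (e j ζ)) =
      ENNReal.ofReal (a j ^ 2) * I := fun j => by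
    rw [lintegral_const_mul _ ((hem j).const_mul _), lintegral_const_mul _ (hem j)]
    congr 1
    have h3 := lintegral_comp_dilation (b := b) (inv_pos.2 (hr0 j))
      (fun ζ : SpT d => ENNReal.ofReal ((1 + ‖ζ‖) ^ (-((d : ℝ) + 2))))
    simp only [e]
    rw [h3, ← mul_assoc, ← ENNReal.ofReal_mul (inv_nonneg.2 (pow_nonneg (hr0 j).le _)), inv_pow,
      inv_inv, inv_mul_cancel₀ (pow_pos (hr0 j) _).ne', ENNReal.ofReal_one, one_mul]
  simp only [hj]
  rw [ENNReal.tsum_mul_right, mul_assoc, mul_assoc, mul_comm _ I]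
  simp only [mul_assoc]
  exact le_rfl

end

section

/-! ### Iterated partial derivatives -/

section Derivatives

variable {Y : Type*} [NormedAddCommGroup Y] [NormedSpace ℝ Y]

/-- The derivative of `f` along the vector `e`. -/
def dirDeriv (e : Y) (f : Y → ℂ) : Y → ℂ := fun y => fderiv ℝ f y e

theorem ContDiff.dirDeriv {f : Y → ℂ} (hf : ContDiff ℝ ∞ f) (e : Y) :
    ContDiff ℝ ∞ (dirDeriv e f) :=
  (hf.fderiv_right (by simp)).clm_apply contDiff_const

theorem dirDeriv_add_const_mul {f g : Y → ℂ} (hf : ContDiff ℝ ∞ f) (hg : ContDiff ℝ ∞ g)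
    (c : ℂ) (e : Y) :
    dirDeriv e (fun y => f y + c * g y) = fun y => dirDeriv e f y + c * dirDeriv e g y := by
  funext y
  have h1 := hf.differentiable (by simp) y
  have h2 := hg.differentiable (by simp) y
  simp only [dirDeriv]
  rw [fderiv_fun_add h1 (h2.const_mul c), fderiv_const_mul h2]
  rfl

theorem dirDeriv_eq_zero {f : Y → ℂ} {K : Set Y} (hK : IsClosed K) (hf : ∀ y ∉ K, f y = 0)
    (e : Y) : ∀ y ∉ K, dirDeriv e f y = 0 := by
  intro y hy
  have : f =ᶠ[𝓝 y] fun _ => 0 := by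
    filter_upwards [hK.isOpen_compl.mem_nhds hy] with z hz using hf z hz
  simp [dirDeriv, this.fderiv_eq]

theorem dirDeriv_comp_affine {f : Y → ℂ} (hf : ContDiff ℝ ∞ f) (c : ℂ) (S : Y →L[ℝ] Y)
    (y₀ e : Y) :
    dirDeriv e (fun y => c * f (S (y - y₀))) = fun y => c * dirDeriv (S e) f (S (y - y₀)) := by
  funext y
  have h1 : HasFDerivAt (fun y => S (y - y₀)) S y := (hasFDerivAt_comp_sub y₀).2 S.hasFDerivAt
  have h2 : HasFDerivAt f (fderiv ℝ f (S (y - y₀))) (S (y - y₀)) :=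
    (hf.differentiable (by simp) _).hasFDerivAt
  have h4 := ((h2.comp y h1).const_mul c).fderiv
  exact congrArg (fun L : Y →L[ℝ] ℂ => L e) h4

theorem dirDeriv_smul (e : Y) (c : ℝ) (f : Y → ℂ) (y : Y) :
    dirDeriv (c • e) f y = c * dirDeriv e f y := by
  simp [dirDeriv]

/-- A common induction for smoothness, supports, linearity and scaling of iterated derivatives. The
counter m records the accumulated weighted order; each step adds w. -/
theorem iterate_rel {X₁ X₂ X₃ : Type*} (o₁ : X₁ → X₁) (o₂ : X₂ → X₂) (o₃ : X₃ → X₃)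
    (R : ℕ → X₁ → X₂ → X₃ → Prop) (w : ℕ)
    (h : ∀ m x₁ x₂ x₃, R m x₁ x₂ x₃ → R (m + w) (o₁ x₁) (o₂ x₂) (o₃ x₃)) (k : ℕ) :
    ∀ m x₁ x₂ x₃, R m x₁ x₂ x₃ → R (m + w * k) (o₁^[k] x₁) (o₂^[k] x₂) (o₃^[k] x₃) := by
  induction k with
  | zero => intro m x₁ x₂ x₃ hR; simpa using hR
  | succ k ih =>
    intro m x₁ x₂ x₃ hR
    have := ih _ _ _ _ (h _ _ _ _ hR)
    simp only [Function.iterate_succ, Function.comp]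
    convert this using 1
    ring

theorem iterPartial_rel {d : ℕ} (e : Fin d → Y) (α : Fin d → ℕ)
    (R : ℕ → (Y → ℂ) → (Y → ℂ) → (Y → ℂ) → Prop)
    (h : ∀ i m f g k, R m f g k → R (m + 1) (dirDeriv (e i) f) (dirDeriv (e i) g)
      (dirDeriv (e i) k)) {m : ℕ} {f g k : Y → ℂ} (hR : R m f g k) :
    R (m + ∑ i, α i) (iterPartial e α f) (iterPartial e α g) (iterPartial e α k) := by
  have key : ∀ l : List (Fin d), R (m + (l.map α).sum)
      (l.foldr (fun i g => (dirDeriv (e i))^[α i] g) f)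
      (l.foldr (fun i g => (dirDeriv (e i))^[α i] g) g)
      (l.foldr (fun i g => (dirDeriv (e i))^[α i] g) k) := by
    intro l
    induction l with
    | nil => simpa using hR
    | cons i l ih =>
      have := iterate_rel _ _ _ R 1 (h i) (α i) _ _ _ _ ih
      simp only [List.foldr_cons, List.map_cons, List.sum_cons]
      convert this using 1
      ring
  have h1 := key (List.finRange d)
  rwa [← List.sum_ofFn (f := α), List.ofFn_eq_map] at *

end Derivatives

variable {d b : ℕ}

/-- Spatial derivatives count 1 and time derivatives 2b, so the counter ends at the weighted order
|α| + 2bβ, the exponent of r under dilations. Properties that ignore the counter use b = 0. -/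
theorem dxt_rel (b : ℕ) (α : Fin d → ℕ) (β : ℕ)
    (R : ℕ → (SpT d → ℂ) → (SpT d → ℂ) → (SpT d → ℂ) → Prop)
    (hx : ∀ i m f g k, R m f g k → R (m + 1)
      (dirDeriv (pt (EuclideanSpace.single i 1) 0) f)
      (dirDeriv (pt (EuclideanSpace.single i 1) 0) g)
      (dirDeriv (pt (EuclideanSpace.single i 1) 0) k))
    (ht : ∀ m f g k, R m f g k → R (m + 2 * b) (dirDeriv (pt 0 1) f) (dirDeriv (pt 0 1) g)
      (dirDeriv (pt 0 1) k)) {f g k : SpT d → ℂ} (hR : R 0 f g k) :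
    R (∑ i, α i + 2 * b * β) (dxt α β f) (dxt α β g) (dxt α β k) := by
  have h1 := iterate_rel _ _ _ R (2 * b) ht β _ _ _ _ hR
  have h2 := iterPartial_rel (fun i => pt (EuclideanSpace.single i (1 : ℝ)) 0) α R hx h1
  rw [zero_add, add_comm] at h2
  exact h2

theorem contDiff_dxt {f : SpT d → ℂ} (hf : ContDiff ℝ ∞ f) (α : Fin d → ℕ) (β : ℕ) :
    ContDiff ℝ ∞ (dxt α β f) :=
  dxt_rel 0 α β (fun _ f _ _ => ContDiff ℝ ∞ f) (fun _ _ _ _ _ h => ContDiff.dirDeriv h _)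
    (fun _ _ _ _ h => ContDiff.dirDeriv h _) (g := f) (k := f) hf

theorem contDiff_Dxt {f : SpT d → ℂ} (hf : ContDiff ℝ ∞ f) (α : Fin d → ℕ) (β : ℕ) :
    ContDiff ℝ ∞ (Dxt α β f) :=
  contDiff_const.mul (contDiff_dxt hf α β)

theorem dxt_add_const_mul {f g : SpT d → ℂ} (hf : ContDiff ℝ ∞ f) (hg : ContDiff ℝ ∞ g) (c : ℂ)
    (α : Fin d → ℕ) (β : ℕ) :
    dxt α β (fun z => f z + c * g z) = fun z => dxt α β f z + c * dxt α β g z := by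
  refine (dxt_rel 0 α β (fun _ k f g => ContDiff ℝ ∞ f ∧ ContDiff ℝ ∞ g ∧
    k = fun z => f z + c * g z) ?_ ?_ ⟨hf, hg, rfl⟩).2.2
  · rintro i m k f g ⟨hf, hg, rfl⟩
    exact ⟨ContDiff.dirDeriv hf _, ContDiff.dirDeriv hg _, dirDeriv_add_const_mul hf hg c _⟩
  · rintro m k f g ⟨hf, hg, rfl⟩
    exact ⟨ContDiff.dirDeriv hf _, ContDiff.dirDeriv hg _, dirDeriv_add_const_mul hf hg c _⟩

theorem dxt_eq_zero {f : SpT d → ℂ} {K : Set (SpT d)} (hK : IsClosed K)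
    (hf : ∀ z ∉ K, f z = 0) (α : Fin d → ℕ) (β : ℕ) : ∀ z ∉ K, dxt α β f z = 0 :=
  dxt_rel 0 α β (fun _ f _ _ => ∀ z ∉ K, f z = 0) (fun _ _ _ _ _ h => dirDeriv_eq_zero hK h _)
    (fun _ _ _ _ h => dirDeriv_eq_zero hK h _) (g := f) (k := f) hf

theorem dt_eq_zero {f : SpT d → ℂ} {K : Set (SpT d)} (hK : IsClosed K)
    (hf : ∀ z ∉ K, f z = 0) (β : ℕ) : ∀ z ∉ K, dt β f z = 0 :=
  iterate_rel (dirDeriv (pt 0 1)) (dirDeriv (pt 0 1)) (dirDeriv (pt 0 1))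
    (fun _ (f _ _ : SpT d → ℂ) => ∀ z ∉ K, f z = 0) 0
    (fun _ _ _ _ h => dirDeriv_eq_zero hK h _) β 0 f f f hf

theorem Dxt_eq_zero {f : SpT d → ℂ} {K : Set (SpT d)} (hK : IsClosed K)
    (hf : ∀ z ∉ K, f z = 0) (α : Fin d → ℕ) (β : ℕ) : ∀ z ∉ K, Dxt α β f z = 0 := fun z hz => by
  simp [Dxt, dxt_eq_zero hK hf α β z hz]

theorem dxt_zero (α : Fin d → ℕ) (β : ℕ) : dxt α β (0 : SpT d → ℂ) = 0 :=
  funext fun z => dxt_eq_zero isClosed_empty (fun _ _ => rfl) α β z (notMem_empty z)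

theorem Dxt_zero (α : Fin d → ℕ) (β : ℕ) : Dxt α β (0 : SpT d → ℂ) = 0 := by
  funext z; simp [Dxt, dxt_zero]

theorem Dxt_sum {ι : Type*} (s : Finset ι) (c : ι → ℂ) {f : ι → SpT d → ℂ}
    (hf : ∀ i, ContDiff ℝ ∞ (f i)) (α : Fin d → ℕ) (β : ℕ) :
    Dxt α β (fun z => ∑ i ∈ s, c i * f i z) = fun z => ∑ i ∈ s, c i * Dxt α β (f i) z := by
  classical
  have key : dxt α β (fun z => ∑ i ∈ s, c i * f i z) = fun z => ∑ i ∈ s, c i * dxt α β (f i) z := by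
    induction s using Finset.induction_on with
    | empty => simp only [Finset.sum_empty]; exact dxt_zero α β
    | insert i s hi ih =>
      have hs : ContDiff ℝ ∞ fun z => ∑ i ∈ s, c i * f i z :=
        ContDiff.sum fun i _ => contDiff_const.mul (hf i)
      simp only [Finset.sum_insert hi, add_comm (c i * _)]
      rw [dxt_add_const_mul hs (hf i), ih]
  funext z
  simp only [Dxt, key, Finset.mul_sum]
  exact Finset.sum_congr rfl fun i _ => by ring

theorem dxt_comp_dilation {f : SpT d → ℂ} (hf : ContDiff ℝ ∞ f) (r : ℝ) (z₀ : SpT d)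
    (α : Fin d → ℕ) (β : ℕ) :
    dxt α β (fun z => f (dilation b r (z - z₀))) = fun z =>
      ((r ^ (∑ i, α i + 2 * b * β) : ℝ) : ℂ) * dxt α β f (dilation b r (z - z₀)) := by
  refine (dxt_rel b α β (fun m k f _ => ContDiff ℝ ∞ f ∧
    k = fun z => ((r ^ m : ℝ) : ℂ) * f (dilation b r (z - z₀))) ?_ ?_ (k := f)
    ⟨hf, by simp⟩).2
  · rintro i m k f - ⟨hf, rfl⟩
    refine ⟨ContDiff.dirDeriv hf _, ?_⟩
    rw [dirDeriv_comp_affine hf, dilation_single]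
    funext z
    rw [dirDeriv_smul]
    push_cast; ring
  · rintro m k f - ⟨hf, rfl⟩
    refine ⟨ContDiff.dirDeriv hf _, ?_⟩
    rw [dirDeriv_comp_affine hf, dilation_time]
    funext z
    rw [dirDeriv_smul]
    push_cast; ring

theorem Dxt_comp_dilation {f : SpT d → ℂ} (hf : ContDiff ℝ ∞ f) (r : ℝ) (z₀ : SpT d)
    (α : Fin d → ℕ) (β : ℕ) (z : SpT d) :
    Dxt α β (fun z => f (dilation b r (z - z₀))) z =
      ((r ^ (∑ i, α i + 2 * b * β) : ℝ) : ℂ) * Dxt α β f (dilation b r (z - z₀)) := by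
  simp only [Dxt, dxt_comp_dilation hf]
  ring

theorem Dx_zero (α : Fin d → ℕ) : Dx α (0 : Sp d → ℂ) = 0 := by
  have h : ∀ x, iterPartial (fun i => EuclideanSpace.single i (1 : ℝ)) α (0 : Sp d → ℂ) x = 0 :=
    fun x => iterPartial_rel (fun i => EuclideanSpace.single i (1 : ℝ)) α
      (fun _ f _ _ => ∀ z : Sp d, z ∉ (∅ : Set (Sp d)) → f z = 0)
      (fun _ _ _ _ _ h => dirDeriv_eq_zero isClosed_empty h _) (m := 0) (f := 0) (g := 0) (k := 0)
      (fun _ _ => rfl) x (notMem_empty x)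
  funext x
  simp [Dx, h]

theorem iterPartial_single {Y : Type*} [NormedAddCommGroup Y] [NormedSpace ℝ Y] (e : Fin d → Y)
    (i : Fin d) (M : ℕ) (f : Y → ℂ) :
    iterPartial e (Pi.single i M) f = (dirDeriv (e i))^[M] f := by
  have key : ∀ l : List (Fin d), l.Nodup →
      l.foldr (fun j g => (dirDeriv (e j))^[(Pi.single i M : Fin d → ℕ) j] g) f =
        if i ∈ l then (dirDeriv (e i))^[M] f else f := by
    intro l hl
    induction l with
    | nil => simp
    | cons j l ih =>
      rw [List.nodup_cons] at hl
      rw [List.foldr_cons, ih hl.2]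
      by_cases hij : i = j
      · subst hij
        simp [hl.1]
      · have : j ≠ i := fun h => hij h.symm
        simp [hij, this]
  have := key (List.finRange d) (List.nodup_finRange d)
  rwa [if_pos (List.mem_finRange i)] at this

/-! ### Bounded families obtained by freezing coefficients -/

/-- The dilations by 2^{-j} are contractions, so zooming in at z₀ does not increase the derivatives
of a smooth coefficient on a fixed ball. -/
theorem exists_bound_iteratedFDeriv_comp_dilation {A : SpT d → ℂ} (hA : ContDiff ℝ ∞ A)
    (z₀ : SpT d) (ρ : ℝ) (l : ℕ) :
    ∃ C, 0 ≤ C ∧ ∀ j : ℕ, ∀ x : SpT d, ‖x‖ ≤ ρ →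
      ‖iteratedFDeriv ℝ l (fun z => A (z₀ + dilation b ((2 : ℝ) ^ j)⁻¹ z)) x‖ ≤ C := by
  have hc : Continuous (iteratedFDeriv ℝ l A) :=
    hA.continuous_iteratedFDeriv (by exact_mod_cast le_top)
  obtain ⟨C, hC⟩ := (isCompact_closedBall z₀ ρ).exists_bound_of_continuousOn hc.continuousOn
  refine ⟨max C 0, le_max_right _ _, fun j x hx => ?_⟩
  have h0 : (0 : ℝ) ≤ ((2 : ℝ) ^ j)⁻¹ := by positivity
  have h1 : ((2 : ℝ) ^ j)⁻¹ ≤ 1 := inv_le_one_of_one_le₀ (one_le_pow₀ one_le_two)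
  set S : SpT d →L[ℝ] SpT d := dilation b ((2 : ℝ) ^ j)⁻¹
  have hA' : ContDiff ℝ ∞ fun z => A (z₀ + z) := hA.comp (contDiff_const.add contDiff_id)
  have e := S.iteratedFDeriv_comp_right (f := fun z => A (z₀ + z)) hA' x (i := l)
    (by exact_mod_cast le_top)
  change ‖iteratedFDeriv ℝ l ((fun z => A (z₀ + z)) ∘ S) x‖ ≤ _
  rw [e, iteratedFDeriv_comp_add_left]
  refine (ContinuousMultilinearMap.norm_compContinuousLinearMap_le _ _).trans ?_
  have hp : ∏ _i : Fin l, ‖S‖ ≤ 1 :=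
    Finset.prod_le_one (fun _ _ => norm_nonneg _) fun _ _ => opNorm_dilation_le h0 h1
  refine (mul_le_of_le_one_right (norm_nonneg _) hp).trans ((hC _ ?_).trans (le_max_left _ _))
  rw [mem_closedBall_iff_norm, add_sub_cancel_left]
  exact (norm_dilation_le h0 h1 x).trans hx

/-- The functions `A(z₀ + S_j⁻¹ z) g(z)`, where `S_j` is the dilation by `2^j`. -/
def frozenFamily (b : ℕ) {A g : SpT d → ℂ} (hA : ContDiff ℝ ∞ A) (hg : ContDiff ℝ ∞ g)
    (hg' : HasCompactSupport g) (z₀ : SpT d) (j : ℕ) : 𝓢(SpT d, ℂ) :=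
  HasCompactSupport.toSchwartzMap
    (f := fun z => A (z₀ + dilation b ((2 : ℝ) ^ j)⁻¹ z) * g z) hg'.mul_left
    ((hA.comp (contDiff_const.add (dilation b _).contDiff)).mul hg)

/-- Leibniz' rule on the support of g, where the rescaled coefficients have bounds uniform in j;
elsewhere all derivatives vanish. -/
theorem isBoundedFamily_frozenFamily {A g : SpT d → ℂ} (hA : ContDiff ℝ ∞ A)
    (hg : ContDiff ℝ ∞ g) (hg' : HasCompactSupport g) (z₀ : SpT d) :
    IsBoundedFamily (frozenFamily b hA hg hg' z₀) := by
  intro k l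
  obtain ⟨ρ, hρ⟩ := hg'.isBounded.exists_norm_le
  choose C hC0 hC using exists_bound_iteratedFDeriv_comp_dilation (b := b) hA z₀ ρ
  have hgb : ∀ i : ℕ, ∃ K, ∀ x, ‖iteratedFDeriv ℝ i g x‖ ≤ K := fun i =>
    (hg'.iteratedFDeriv i).exists_bound_of_continuous
      (hg.continuous_iteratedFDeriv (by exact_mod_cast le_top))
  choose K hK using hgb
  have hK0 : ∀ i, 0 ≤ K i := fun i => (norm_nonneg _).trans (hK i 0)
  have hB0 : 0 ≤ ∑ i ∈ Finset.range (l + 1), (l.choose i : ℝ) * C i * K (l - i) :=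
    Finset.sum_nonneg fun i _ => mul_nonneg (mul_nonneg (Nat.cast_nonneg _) (hC0 i)) (hK0 _)
  refine ⟨|ρ| ^ k * ∑ i ∈ Finset.range (l + 1), (l.choose i : ℝ) * C i * K (l - i), fun j => ?_⟩
  refine SchwartzMap.seminorm_le_bound ℝ k l _ (by positivity) fun x => ?_
  have hAj : ContDiff ℝ ∞ fun z => A (z₀ + dilation b ((2 : ℝ) ^ j)⁻¹ z) :=
    hA.comp (contDiff_const.add (dilation b _).contDiff)
  change ‖x‖ ^ k * ‖iteratedFDeriv ℝ l (fun z => A (z₀ + dilation b ((2 : ℝ) ^ j)⁻¹ z) * g z) x‖ ≤ _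
  by_cases hx : x ∈ tsupport g
  · have hxρ := hρ x hx
    refine mul_le_mul (pow_le_pow_left₀ (norm_nonneg _) (hxρ.trans (le_abs_self _)) _) ?_
      (norm_nonneg _) (by positivity)
    refine (norm_iteratedFDeriv_mul_le hAj hg x (by exact_mod_cast le_top)).trans
      (Finset.sum_le_sum fun i _ => ?_)
    have h1 := hC i j x hxρ
    have h2 := hK (l - i) x
    have := hC0 i
    gcongr
  · have h0 : iteratedFDeriv ℝ l (fun z => A (z₀ + dilation b ((2 : ℝ) ^ j)⁻¹ z) * g z) x = 0 := by
      by_contra hne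
      exact hx (closure_mono (Function.support_mul_subset_right _ _)
        (support_iteratedFDeriv_subset l (Function.mem_support.2 hne)))
    rw [h0, norm_zero, mul_zero]
    positivity

end

section

/-! ### Quasi-orthogonal series and the square root of a self-adjoint operator -/

/-- With truncated subtraction the exponent is |i - j|. Splitting at i leaves two sums with distinct
exponents, each below the full geometric series. -/
theorem sum_pow_dist_le {θ : ℝ} (h0 : 0 ≤ θ) (h1 : θ < 1) (t : Finset ℕ) (i : ℕ) :
    ∑ j ∈ t, θ ^ (j - i + (i - j)) ≤ 2 * (1 - θ)⁻¹ := by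
  have hs := summable_geometric_of_lt_one h0 h1
  have hle : ∀ (s : Finset ℕ) (f : ℕ → ℕ), InjOn f s → ∑ j ∈ s, θ ^ f j ≤ (1 - θ)⁻¹ := by
    intro s f hf
    rw [← Finset.sum_image (f := fun k => θ ^ k) hf, ← tsum_geometric_of_lt_one h0 h1]
    exact hs.sum_le_tsum _ fun k _ => pow_nonneg h0 k
  rw [← Finset.sum_filter_add_sum_filter_not t (fun j => i ≤ j), two_mul]
  refine add_le_add (hle _ _ ?_) (hle _ _ ?_)
  · intro j hj k hk hjk
    simp only [Finset.coe_filter, mem_ofPred_eq] at hj hk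
    simp only at hjk
    omega
  · intro j hj k hk hjk
    simp only [Finset.coe_filter, mem_ofPred_eq, not_le] at hj hk
    simp only at hjk
    omega

variable {H : Type} [NormedAddCommGroup H] [InnerProductSpace ℂ H] [CompleteSpace H]

/-- Schur's test: A_i A_j ≤ (A_i² + A_j²)/2 and the rows of θ^{|i-j|} have bounded sums, so blocks
of the series are controlled by blocks of Σ A_i² and Cauchy's criterion applies. -/
theorem summable_of_quasiOrthogonal {y : ℕ → H} {A : ℕ → ℝ} (hA : Summable fun i => A i ^ 2) {θ : ℝ} (h0 : 0 ≤ θ) (h1 : θ < 1)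
    (hy : ∀ i j, ‖⟪y i, y j⟫_ℂ‖ ≤ A i * A j * θ ^ (j - i + (i - j))) : Summable y := by
  have h1' : 0 < 1 - θ := by linarith
  have hbound : ∀ t : Finset ℕ, ‖∑ i ∈ t, y i‖ ^ 2 ≤ 2 * (1 - θ)⁻¹ * ∑ i ∈ t, A i ^ 2 := by
    intro t
    have e : ‖∑ i ∈ t, y i‖ ^ 2 = ‖⟪∑ i ∈ t, y i, ∑ j ∈ t, y j⟫_ℂ‖ := by
      rw [inner_self_eq_norm_sq_to_K]; simp
    rw [e, sum_inner]
    simp only [inner_sum]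
    calc ‖∑ i ∈ t, ∑ j ∈ t, ⟪y i, y j⟫_ℂ‖
        ≤ ∑ i ∈ t, ∑ j ∈ t, (A i ^ 2 / 2 * θ ^ (j - i + (i - j)) +
            A j ^ 2 / 2 * θ ^ (i - j + (j - i))) := by
          refine (norm_sum_le _ _).trans (Finset.sum_le_sum fun i _ => (norm_sum_le _ _).trans
            (Finset.sum_le_sum fun j _ => (hy i j).trans ?_))
          rw [add_comm (i - j), ← add_mul]
          have := pow_nonneg h0 (j - i + (i - j))
          gcongr
          nlinarith [sq_nonneg (A i - A j)]
      _ = ∑ i ∈ t, A i ^ 2 / 2 * ∑ j ∈ t, θ ^ (j - i + (i - j)) +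
          ∑ j ∈ t, A j ^ 2 / 2 * ∑ i ∈ t, θ ^ (i - j + (j - i)) := by
          simp only [Finset.sum_add_distrib, Finset.mul_sum]
          congr 1
          exact Finset.sum_comm
      _ ≤ ∑ i ∈ t, A i ^ 2 / 2 * (2 * (1 - θ)⁻¹) + ∑ j ∈ t, A j ^ 2 / 2 * (2 * (1 - θ)⁻¹) := by
          gcongr <;> exact sum_pow_dist_le h0 h1 t _
      _ = _ := by
          rw [← Finset.sum_mul, ← Finset.sum_div]; ring
  rw [summable_iff_vanishing_norm]
  intro η hη
  obtain ⟨s, hs⟩ := summable_iff_vanishing_norm.1 hA (η ^ 2 / (2 * (1 - θ)⁻¹)) (by positivity)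
  refine ⟨s, fun t ht => ?_⟩
  have h2 := hs t ht
  rw [Real.norm_of_nonneg (Finset.sum_nonneg fun i _ => sq_nonneg _),
    lt_div_iff₀ (by positivity)] at h2
  refine lt_of_pow_lt_pow_left₀ 2 hη.le ((hbound t).trans_lt ?_)
  linarith

/-- Symmetry gives ⟨R x_i, R x_j⟩ = ⟨J x_i, x_j⟩. For i ≤ j the bounds θ^{-i} and θ^j combine to
θ^{j-i}, so the vectors R x_i are quasi-orthogonal and their series converges. No functional
calculus is needed beyond R² = J. -/
theorem mem_domain_of_quasiOrthogonal {R J : H →ₗ.[ℂ] H} (hR : IsSquareRoot R J) {x : ℕ → H}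
    (hx : ∀ i, x i ∈ J.domain) {X : H}
    (hX : Tendsto (fun N => ∑ i ∈ Finset.range N, x i) atTop (𝓝 X)) {A : ℕ → ℝ}
    (hA0 : ∀ i, 0 ≤ A i) (hA : Summable fun i => A i ^ 2) {θ : ℝ} (h0 : 0 < θ) (h1 : θ < 1)
    (hx0 : ∀ i, ‖x i‖ ≤ A i * θ ^ i) (hx1 : ∀ i, ‖J ⟨x i, hx i⟩‖ ≤ A i * (θ⁻¹) ^ i) :
    X ∈ R.domain := by
  obtain ⟨hsa, -, hdom, hval⟩ := hR
  have hsym : ∀ u v : R.domain, ⟪R u, (v : H)⟫_ℂ = ⟪(u : H), R v⟫_ℂ := by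
    have := LinearPMap.adjoint_isFormalAdjoint hsa.dense_domain
    rw [LinearPMap.isSelfAdjoint_def.1 hsa] at this
    exact this
  choose hxR hxRR using fun i => (hdom (x i)).1 (hx i)
  let y : ℕ → H := fun i => R ⟨x i, hxR i⟩
  have hin : ∀ i j, ⟪y i, y j⟫_ℂ = ⟪J ⟨x i, hx i⟩, x j⟫_ℂ := by
    intro i j
    rw [hval (x i) (hx i) (hxR i) (hxRR i)]
    exact (hsym ⟨y i, hxRR i⟩ ⟨x j, hxR j⟩).symm
  have hle : ∀ i j, i ≤ j → ‖⟪y i, y j⟫_ℂ‖ ≤ A i * A j * θ ^ (j - i + (i - j)) := by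
    intro i j hij
    rw [hin]
    refine (norm_inner_le_norm _ _).trans ((mul_le_mul (hx1 i) (hx0 j) (norm_nonneg _)
      (mul_nonneg (hA0 i) (by positivity))).trans_eq ?_)
    rw [Nat.sub_eq_zero_of_le hij, add_zero]
    obtain ⟨k, rfl⟩ := Nat.exists_eq_add_of_le hij
    rw [Nat.add_sub_cancel_left, pow_add, inv_pow]
    field_simp
  have hsum : Summable y := by
    refine summable_of_quasiOrthogonal hA h0.le h1 fun i j => ?_
    rcases le_total i j with hij | hij
    · exact hle i j hij
    · rw [norm_inner_symm, mul_comm (A i), add_comm]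
      exact hle j i hij
  have hgraph : ∀ N, (∑ i ∈ Finset.range N, x i, ∑ i ∈ Finset.range N, y i) ∈ R.graph := by
    intro N
    have : (∑ i ∈ Finset.range N, x i, ∑ i ∈ Finset.range N, y i) =
        ∑ i ∈ Finset.range N, (x i, y i) :=
      Prod.ext (by simp [Prod.fst_sum]) (by simp [Prod.snd_sum])
    rw [this]
    exact Submodule.sum_mem _ fun i _ => R.mem_graph ⟨x i, hxR i⟩
  have hlim := hX.prodMk_nhds hsum.hasSum.tendsto_sum_nat
  -- A self-adjoint operator is closed, so the limit of the partial sums stays in its graph.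
  have hmem : (X, ∑' i, y i) ∈ (R.graph : Set (H × H)) :=
    IsClosed.mem_of_tendsto hsa.isClosed hlim (Eventually.of_forall hgraph)
  exact LinearPMap.mem_domain_of_mem_graph hmem

end

section

/-! ### Approximation of waves by their partial sums -/

variable {d b : ℕ}

/-- A sequence with its first `N` entries replaced by zero. -/
def tailSeq (N : ℕ) (a : ℕ → ℝ) (j : ℕ) : ℝ := if j < N then 0 else a j

theorem summable_tailSeq {a : ℕ → ℝ} (ha : Summable fun j => a j ^ 2) (N : ℕ) :
    Summable fun j => tailSeq N a j ^ 2 :=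
  ha.of_nonneg_of_le (fun j => sq_nonneg _) fun j => by
    unfold tailSeq; split_ifs
    · simpa using sq_nonneg (a j)
    · exact le_rfl

theorem tendsto_tsum_tailSeq {a : ℕ → ℝ} (ha : Summable fun j => a j ^ 2) :
    Tendsto (fun N => (∑' j, ENNReal.ofReal (tailSeq N a j ^ 2)) ^ (1 / 2 : ℝ)) atTop (𝓝 0) := by
  have h1 : ∀ N, ∑' j, ENNReal.ofReal (tailSeq N a j ^ 2) =
      ENNReal.ofReal (∑' j, a (j + N) ^ 2) := by
    intro N
    have hN := summable_tailSeq ha N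
    rw [← ENNReal.ofReal_tsum_of_nonneg (fun j => sq_nonneg _) hN, ← hN.sum_add_tsum_nat_add N,
      Finset.sum_eq_zero, zero_add]
    · simp [tailSeq]
    · intro j hj
      simp [tailSeq, Finset.mem_range.1 hj]
  simp only [h1]
  have h2 := (ENNReal.continuous_ofReal.tendsto 0).comp (tendsto_sum_nat_add fun j => a j ^ 2)
  rw [ENNReal.ofReal_zero] at h2
  have h3 := ((ENNReal.continuous_rpow_const (y := (1 / 2 : ℝ))).tendsto 0).comp h2
  rw [ENNReal.zero_rpow_of_pos (by norm_num)] at h3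
  exact h3

/-- All functions of the family vanish outside the ball of radius `3 / 2`. -/
def IsSupportedFamily (Ψ : ℕ → 𝓢(SpT d, ℂ)) : Prop := ∀ j z, 3 / 2 < ‖z‖ → Ψ j z = 0

theorem eventually_lt_norm_dilation (hb : 1 ≤ b) {z z₀ : SpT d} (hz : z ≠ z₀) :
    ∃ N : ℕ, ∀ j, N ≤ j → 3 / 2 < ‖dilation b ((2 : ℝ) ^ j) (z - z₀)‖ := by
  have hpos : 0 < ‖z - z₀‖ := norm_pos_iff.2 (sub_ne_zero.2 hz)
  obtain ⟨N, hN⟩ := pow_unbounded_of_one_lt (3 / 2 / ‖z - z₀‖) (one_lt_two : (1 : ℝ) < 2)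
  refine ⟨N, fun j hj => ?_⟩
  refine lt_of_lt_of_le ?_ (le_norm_dilation hb (one_le_pow₀ one_le_two) _)
  rw [div_lt_iff₀ hpos] at hN
  exact hN.trans_le (by gcongr; exact one_le_two)

/-- Off the centre only finitely many terms are nonzero. At z₀ itself the series may diverge, which
is why identities between waves are used almost everywhere. -/
theorem summable_wave (hb : 1 ≤ b) (φ : ℝ → ℝ) (σ : ℝ) {z₀ : SpT d} {Ψ : ℕ → 𝓢(SpT d, ℂ)}
    (hΨ : IsSupportedFamily Ψ) (a : ℕ → ℝ) {z : SpT d} (hz : z ≠ z₀) :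
    Summable fun j => ((a j * waveCoeff φ d b σ j : ℝ) : ℂ) *
      Ψ j (dilation b (2 ^ j) (z - z₀)) := by
  obtain ⟨N, hN⟩ := eventually_lt_norm_dilation hb hz
  refine summable_of_ne_finset_zero (s := Finset.range N) fun j hj => ?_
  rw [hΨ j _ (hN j (by simpa using hj)), mul_zero]

theorem wave_sub_sum (hb : 1 ≤ b) (φ : ℝ → ℝ) (σ : ℝ) {z₀ : SpT d} {Ψ : ℕ → 𝓢(SpT d, ℂ)}
    (hΨ : IsSupportedFamily Ψ) (a : ℕ → ℝ) (N : ℕ) {z : SpT d} (hz : z ≠ z₀) :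
    wave φ b σ z₀ Ψ a z - ∑ j ∈ Finset.range N, ((a j * waveCoeff φ d b σ j : ℝ) : ℂ) *
      Ψ j (dilation b (2 ^ j) (z - z₀)) = wave φ b σ z₀ Ψ (tailSeq N a) z := by
  unfold wave
  rw [← (summable_wave hb φ σ hΨ a hz).sum_add_tsum_nat_add N,
    ← (summable_wave hb φ σ hΨ (tailSeq N a) hz).sum_add_tsum_nat_add N, add_sub_cancel_left,
    Finset.sum_eq_zero, zero_add]
  · simp [tailSeq]
  · intro j hj
    simp [tailSeq, Finset.mem_range.1 hj]

theorem ae_ne_of_nontrivial {Z : Type*} [NormedAddCommGroup Z] [InnerProductSpace ℝ Z]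
    [FiniteDimensional ℝ Z] [MeasurableSpace Z] [BorelSpace Z] (hZ : Nontrivial Z) (z₀ : Z) :
    ∀ᵐ z : Z, z ≠ z₀ :=
  Measure.ae_ne volume z₀

theorem ae_ne_point (z₀ : SpT d) : ∀ᵐ z : SpT d, z ≠ z₀ :=
  ae_ne_of_nontrivial ⟨⟨pt 0 1, 0, fun h => by
    have h1 : (pt (0 : Sp d) 1).snd = (0 : SpT d).snd := congrArg WithLp.snd h
    rw [pt_snd, WithLp.zero_snd] at h1
    exact one_ne_zero h1⟩⟩ z₀

theorem hNormOn_wave_lt_top {φ : ℝ → ℝ} (hφ : ClassM φ) (hb : 1 ≤ b) {σ : ℝ} (hσ : 0 < σ)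
    (z₀ : SpT d) {Ψ : ℕ → 𝓢(SpT d, ℂ)} (hΨ : IsBoundedFamily Ψ) {a : ℕ → ℝ}
    (ha : Summable fun j => a j ^ 2) (U : Set (SpT d)) {w : SpT d → ℂ}
    (hw : w =ᵐ[volume] wave φ b σ z₀ Ψ a) : hNormOn (anisoBase b) σ φ U w < ⊤ := by
  obtain ⟨C, hC, h⟩ := exists_hNormOn_wave_le hφ hb hσ z₀ hΨ
  refine (h a ha U _ hw).trans_lt (ENNReal.mul_lt_top hC.lt_top ?_)
  exact (ENNReal.rpow_ne_top_of_nonneg (by norm_num) ha.tsum_ofReal_ne_top).lt_top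

/-- The remainder is, off z₀, the wave with the tail of the coefficients, and the tails of an ℓ²
sequence tend to 0. -/
theorem tendsto_hNormOn_wave_sub {φ : ℝ → ℝ} (hφ : ClassM φ) (hb : 1 ≤ b) {σ : ℝ} (hσ : 0 < σ)
    (z₀ : SpT d) {Ψ : ℕ → 𝓢(SpT d, ℂ)} (hΨ : IsBoundedFamily Ψ) (hΨ' : IsSupportedFamily Ψ)
    {a : ℕ → ℝ} (ha : Summable fun j => a j ^ 2) (U : Set (SpT d)) {w : SpT d → ℂ}
    (hw : w =ᵐ[volume] wave φ b σ z₀ Ψ a) {v : ℕ → SpT d → ℂ}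
    (hv : ∀ N z, v N z = w z - ∑ j ∈ Finset.range N,
      ((a j * waveCoeff φ d b σ j : ℝ) : ℂ) * Ψ j (dilation b (2 ^ j) (z - z₀))) :
    Tendsto (fun N => hNormOn (anisoBase b) σ φ U (v N)) atTop (𝓝 0) := by
  obtain ⟨C, hC, h⟩ := exists_hNormOn_wave_le hφ hb hσ z₀ hΨ
  have hlim := ENNReal.Tendsto.const_mul (tendsto_tsum_tailSeq ha) (Or.inr hC)
  rw [mul_zero] at hlim
  refine tendsto_of_tendsto_of_tendsto_of_le_of_le tendsto_const_nhds hlim (fun _ => zero_le)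
    fun N => h _ (summable_tailSeq ha N) U _ ?_
  filter_upwards [ae_ne_point z₀, hw] with z hz hwz
  rw [hv, hwz, wave_sub_sum hb φ σ hΨ' a N hz]

theorem waveCoeff_change (φ : ℝ → ℝ) (d b : ℕ) (σ σ' : ℝ) (j : ℕ) :
    waveCoeff φ d b σ j = ((2 : ℝ) ^ j) ^ (σ' - σ) * waveCoeff φ d b σ' j := by
  unfold waveCoeff
  rw [mul_left_comm, ← Real.rpow_add (by positivity)]
  congr 2; ring

/-- A term normalized for order σ is a one-term wave of order σ' with coefficient multiplied by
2^{j(σ'-σ)}. It serves for σ' = σ ± ε in the interpolation argument. -/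
theorem exists_hNormOn_term_le {φ : ℝ → ℝ} (hφ : ClassM φ) (hb : 1 ≤ b) (σ : ℝ) {σ' : ℝ}
    (hσ' : 0 < σ') (z₀ : SpT d) {Ψ : ℕ → 𝓢(SpT d, ℂ)} (hΨ : IsBoundedFamily Ψ) :
    ∃ C : ℝ, 0 ≤ C ∧ ∀ (a : ℕ → ℝ) (j : ℕ) (U : Set (SpT d)),
      hNormOn (anisoBase b) σ' φ U (fun z => ((a j * waveCoeff φ d b σ j : ℝ) : ℂ) *
        Ψ j (dilation b (2 ^ j) (z - z₀))) ≤
          ENNReal.ofReal (C * (|a j| * ((2 : ℝ) ^ j) ^ (σ' - σ))) := by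
  obtain ⟨C, hC, h⟩ := exists_hNormOn_wave_le hφ hb hσ' z₀ hΨ
  refine ⟨C.toReal, ENNReal.toReal_nonneg, fun a j U => ?_⟩
  set t : ℝ := a j * ((2 : ℝ) ^ j) ^ (σ' - σ)
  have hs : Summable fun i => (Pi.single j t : ℕ → ℝ) i ^ 2 :=
    summable_of_ne_finset_zero (s := {j}) fun i hi => by
      rw [Pi.single_eq_of_ne (by simpa using hi)]; simp
  have hw : (fun z => ((a j * waveCoeff φ d b σ j : ℝ) : ℂ) * Ψ j (dilation b (2 ^ j) (z - z₀))) =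
      wave φ b σ' z₀ Ψ (Pi.single j t) := by
    funext z
    unfold wave
    rw [tsum_eq_single j fun i hi => by rw [Pi.single_eq_of_ne hi]; simp, Pi.single_eq_same,
      waveCoeff_change φ d b σ σ' j, ← mul_assoc]
  have h2 := h _ hs U _ (EventuallyEq.of_eq hw)
  refine h2.trans_eq ?_
  rw [tsum_eq_single j fun i hi => by rw [Pi.single_eq_of_ne hi]; simp, Pi.single_eq_same,
    ← sq_abs, ENNReal.ofReal_pow (abs_nonneg _), ← ENNReal.rpow_natCast, ← ENNReal.rpow_mul,
    ENNReal.ofReal_mul ENNReal.toReal_nonneg, ENNReal.ofReal_toReal hC]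
  norm_num
  rw [abs_mul, abs_of_pos (a := ((2 : ℝ) ^ j) ^ (σ' - σ)) (by positivity),
    ENNReal.ofReal_mul (abs_nonneg _)]

/-- A differential operator of order at most `K` with smooth coefficients, applied to rescaled
copies of `ψ`, yields rescaled copies of a bounded family. -/
theorem exists_family_of_operator {ψ : SpT d → ℂ} (hψ : ContDiff ℝ ∞ ψ)
    (hψ' : ∀ z, 3 / 2 ≤ ‖z‖ → ψ z = 0) (z₀ : SpT d) (K : ℕ) (s : Finset ((Fin d → ℕ) × ℕ))
    (hs : ∀ q ∈ s, ∑ i, q.1 i + 2 * b * q.2 ≤ K) {A : (Fin d → ℕ) × ℕ → SpT d → ℂ}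
    (hA : ∀ q, ContDiff ℝ ∞ (A q)) :
    ∃ Φ : ℕ → 𝓢(SpT d, ℂ), IsBoundedFamily Φ ∧ IsSupportedFamily Φ ∧
      ∀ (φ : ℝ → ℝ) (σ : ℝ) (j : ℕ) (z : SpT d),
        (waveCoeff φ d b (σ + K) j : ℂ) *
          ∑ q ∈ s, A q z * Dxt q.1 q.2 (fun z => ψ (dilation b (2 ^ j) (z - z₀))) z =
        (waveCoeff φ d b σ j : ℂ) * Φ j (dilation b (2 ^ j) (z - z₀)) := by
  have hout : ∀ q : (Fin d → ℕ) × ℕ, ∀ z ∉ Metric.closedBall (0 : SpT d) (3 / 2),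
      Dxt q.1 q.2 ψ z = 0 := fun q =>
    Dxt_eq_zero Metric.isClosed_closedBall (fun z hz => hψ' z (by
      rw [mem_closedBall_zero_iff, not_le] at hz; exact hz.le)) q.1 q.2
  have hcs : ∀ q : (Fin d → ℕ) × ℕ, HasCompactSupport (Dxt q.1 q.2 ψ) := fun q =>
    HasCompactSupport.intro (isCompact_closedBall 0 (3 / 2)) (hout q)
  have hsm : ∀ q : (Fin d → ℕ) × ℕ, ContDiff ℝ ∞ (Dxt q.1 q.2 ψ) := fun q => contDiff_Dxt hψ _ _
  -- Differentiation produces (2^j)^{|α|+2bβ}, of which (2^j)^K goes into the change of order from σ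
  -- + K to σ; since |α| + 2bβ ≤ K, the quotient left over is at most 1.
  let c : (Fin d → ℕ) × ℕ → ℕ → ℝ := fun q j =>
    ((2 : ℝ) ^ j) ^ (∑ i, q.1 i + 2 * b * q.2) / ((2 : ℝ) ^ j) ^ K
  let Φ : ℕ → 𝓢(SpT d, ℂ) := fun j =>
    ∑ q ∈ s, c q j • frozenFamily b (hA q) (hsm q) (hcs q) z₀ j
  have hΦ : ∀ j z, Φ j z = ∑ q ∈ s, (c q j : ℂ) *
      (A q (z₀ + dilation b ((2 : ℝ) ^ j)⁻¹ z) * Dxt q.1 q.2 ψ z) := by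
    intro j z
    simp only [Φ]
    rw [sum_apply]
    exact Finset.sum_congr rfl fun q _ => by
      rw [smul_apply, Complex.real_smul]; rfl
  refine ⟨Φ, ?_, ?_, ?_⟩
  · refine IsBoundedFamily.sum s fun q hq => (isBoundedFamily_frozenFamily _ _ _ _).smul fun j => ?_
    rw [abs_of_nonneg (by positivity)]
    refine div_le_one_of_le₀ ?_ (by positivity)
    exact pow_le_pow_right₀ (one_le_pow₀ one_le_two) (hs q hq)
  · intro j z hz
    rw [hΦ]
    refine Finset.sum_eq_zero fun q _ => ?_
    rw [hout q z (by rw [mem_closedBall_zero_iff, not_le]; exact hz), mul_zero, mul_zero]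
  · intro φ σ j z
    have hr : (2 : ℝ) ^ j ≠ 0 := by positivity
    have hw : waveCoeff φ d b (σ + K) j * ((2 : ℝ) ^ j) ^ K = waveCoeff φ d b σ j := by
      rw [waveCoeff_change φ d b σ (σ + K) j, add_sub_cancel_left, Real.rpow_natCast, mul_comm]
    rw [hΦ, Finset.mul_sum, Finset.mul_sum]
    refine Finset.sum_congr rfl fun q _ => ?_
    rw [dilation_inv_dilation hr, add_sub_cancel, Dxt_comp_dilation hψ, ← hw]
    have hK : (((2 : ℝ) ^ j) ^ K : ℂ) ≠ 0 := by exact_mod_cast pow_ne_zero K hr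
    simp only [c]
    push_cast at hK ⊢
    field_simp

end

section

/-! ### Waves with an unbounded generalized derivative -/

section Monomial

variable {Z : Type*} [NormedAddCommGroup Z] [InnerProductSpace ℝ Z]

theorem contDiff_iterate_dirDeriv (e : Z) (M : ℕ) {f : Z → ℂ} (hf : ContDiff ℝ ∞ f) :
    ContDiff ℝ ∞ ((dirDeriv e)^[M] f) := by
  induction M generalizing f with
  | zero => exact hf
  | succ M ih => rw [Function.iterate_succ_apply]; exact ih (ContDiff.dirDeriv hf e)

theorem iterate_dirDeriv_eq_zero (e : Z) (M : ℕ) {f : Z → ℂ} {K : Set Z} (hK : IsClosed K)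
    (hf : ∀ z ∉ K, f z = 0) : ∀ z ∉ K, (dirDeriv e)^[M] f z = 0 := by
  induction M generalizing f with
  | zero => exact hf
  | succ M ih => rw [Function.iterate_succ_apply]; exact ih (dirDeriv_eq_zero hK hf e)

theorem hasCompactSupport_dirDeriv (e : Z) {f : Z → ℂ} (hf : HasCompactSupport f) :
    HasCompactSupport (dirDeriv e f) :=
  HasCompactSupport.intro hf
    (dirDeriv_eq_zero (isClosed_tsupport f) (fun _ hz => image_eq_zero_of_notMem_tsupport hz) e)

theorem contDiff_monomial (L : Z →L[ℝ] ℝ) (z₀ : Z) (C : ℂ) (M : ℕ) :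
    ContDiff ℝ ∞ fun z => C * (((L (z - z₀) : ℝ) : ℂ) ^ M / (M.factorial : ℂ)) :=
  contDiff_const.mul (((Complex.ofRealCLM.contDiff.comp
    (L.contDiff.comp (contDiff_id.sub contDiff_const))).pow M).div_const _)

theorem iterate_dirDeriv_monomial (L : Z →L[ℝ] ℝ) {e : Z} (he : L e = 1) (z₀ : Z) (C : ℂ) (M : ℕ) :
    (dirDeriv e)^[M] (fun z => C * (((L (z - z₀) : ℝ) : ℂ) ^ M / (M.factorial : ℂ))) =
      fun _ => C := by
  induction M with
  | zero => simp
  | succ M ih =>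
    rw [Function.iterate_succ_apply, ← ih]
    congr 1
    funext z
    have h1 : HasFDerivAt (fun z => ((L (z - z₀) : ℝ) : ℂ)) (Complex.ofRealCLM.comp L) z :=
      Complex.ofRealCLM.hasFDerivAt.comp z ((hasFDerivAt_comp_sub z₀).2 L.hasFDerivAt)
    have h2 := ((h1.pow (M + 1)).mul_const ((M + 1).factorial : ℂ)⁻¹).const_mul C
    simp only [dirDeriv, div_eq_mul_inv]
    rw [h2.fderiv]
    have hM : ((M : ℂ) + 1) ≠ 0 := by exact_mod_cast M.succ_ne_zero
    have hf : (M.factorial : ℂ) ≠ 0 := by exact_mod_cast M.factorial_ne_zero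
    simp [he, Nat.factorial_succ]
    field_simp
    exact Or.inl trivial

/-- The radii satisfy 1 < 5/4 and 3/2 < 2: a point at distance 1 along a spatial axis lies where ψ
is the monomial, and its dilate by 2 lies outside the support. This separates consecutive scales. -/
theorem exists_cutoff_monomial (L : Z →L[ℝ] ℝ) (M : ℕ) :
    ∃ ψ : Z → ℂ, ContDiff ℝ ∞ ψ ∧ (∀ z, 3 / 2 ≤ ‖z‖ → ψ z = 0) ∧
      ∀ z, ‖z‖ < 5 / 4 → ψ z = ((L z : ℝ) : ℂ) ^ M / (M.factorial : ℂ) := by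
  let χ : ContDiffBump (0 : Z) := ⟨5 / 4, 3 / 2, by norm_num, by norm_num⟩
  refine ⟨fun z => ((L z : ℝ) : ℂ) ^ M / (M.factorial : ℂ) * (χ z : ℂ), ?_, ?_, ?_⟩
  · exact (((Complex.ofRealCLM.contDiff.comp L.contDiff).pow M).div_const _).mul
      (Complex.ofRealCLM.contDiff.comp χ.contDiff)
  · intro z hz
    beta_reduce
    rw [χ.zero_of_le_dist (by rw [dist_zero_right]; exact hz)]; simp
  · intro z hz
    beta_reduce
    rw [χ.one_of_mem_closedBall (by rw [mem_closedBall_zero_iff]; exact hz.le)]; simp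

variable [FiniteDimensional ℝ Z] [MeasurableSpace Z] [BorelSpace Z]

theorem integral_mul_iterate_dirDeriv (e : Z) (M : ℕ) {g η : Z → ℂ} (hg : ContDiff ℝ ∞ g)
    (hη : ContDiff ℝ ∞ η) (hη' : HasCompactSupport η) :
    ∫ z, g z * (dirDeriv e)^[M] η z = (-1) ^ M * ∫ z, (dirDeriv e)^[M] g z * η z := by
  induction M generalizing g η with
  | zero => simp
  | succ M ih =>
    rw [Function.iterate_succ_apply, ih hg (ContDiff.dirDeriv hη e)
      (hasCompactSupport_dirDeriv e hη'), Function.iterate_succ_apply']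
    have hgM := contDiff_iterate_dirDeriv e M hg
    have hInt : ∀ {f k : Z → ℂ}, ContDiff ℝ ∞ f → ContDiff ℝ ∞ k → HasCompactSupport k →
        Integrable (fun z => f z * k z) := fun hf hk hk' =>
      (hf.continuous.mul hk.continuous).integrable_of_hasCompactSupport hk'.mul_left
    have h := integral_mul_fderiv_eq_neg_fderiv_mul_of_integrable (μ := volume) (v := e)
      (hInt (ContDiff.dirDeriv hgM e) hη hη')
      (hInt hgM (ContDiff.dirDeriv hη e) (hasCompactSupport_dirDeriv e hη')) (hInt hgM hη hη')
      (fun z _ => hgM.differentiable (by simp) z) (fun z _ => hη.differentiable (by simp) z)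
    change ((-1) ^ M * ∫ z, (dirDeriv e)^[M] g z * fderiv ℝ η z e) =
      (-1) ^ (M + 1) * ∫ z, fderiv ℝ ((dirDeriv e)^[M] g) z e * η z
    rw [h, pow_succ]; ring

/-- If `v` is the monomial `C (L (z - z₀))^M / M!` on an open set and its weak derivative
`∂_e^M v` is there a function bounded by `B`, then `‖C‖ ≤ B`. -/
theorem norm_le_of_weak_deriv_monomial (L : Z →L[ℝ] ℝ) {e : Z} (he : L e = 1) (z₀ : Z) {C : ℂ}
    {M : ℕ} {V W : Set Z} (hV : IsOpen V) (hVn : V.Nonempty) {v v₀ : Z → ℂ}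
    (hv : ∀ z ∈ V, v z = C * (((L (z - z₀) : ℝ) : ℂ) ^ M / (M.factorial : ℂ))) {B : ℝ}
    (hB : ∀ z ∈ V, ‖v₀ z‖ ≤ B)
    (h : ∀ η : Z → ℂ, ContDiff ℝ ∞ η → HasCompactSupport η → tsupport η ⊆ V →
      (-1) ^ M * ∫ z, v z * (Complex.I ^ M * (dirDeriv e)^[M] η z) = ∫ z in W, v₀ z * η z) :
    ‖C‖ ≤ B := by
  obtain ⟨z₁, hz₁⟩ := hVn
  obtain ⟨r, hr, hrV⟩ := Metric.nhds_basis_closedBall.mem_iff.1 (hV.mem_nhds hz₁)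
  -- A nonnegative test function supported in V reduces the claim to ‖C‖ ∫ χ ≤ B ∫ χ with ∫ χ > 0.
  let χ : ContDiffBump z₁ := ⟨r / 2, r, half_pos hr, half_lt_self hr⟩
  let η : Z → ℂ := fun z => (χ z : ℂ)
  have hη : ContDiff ℝ ∞ η := Complex.ofRealCLM.contDiff.comp χ.contDiff
  have hη0 : ∀ z ∉ Metric.closedBall z₁ r, η z = 0 := fun z hz => by
    have : χ z = 0 := χ.zero_of_le_dist (le_of_lt (by simpa using hz))
    simp [η, this]
  have hηc : HasCompactSupport η := HasCompactSupport.intro (isCompact_closedBall z₁ r) hη0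
  have hηV : tsupport η ⊆ V := (closure_minimal (fun z hz => by
    by_contra hn; exact hz (hη0 z hn)) Metric.isClosed_closedBall).trans hrV
  have hBn : 0 ≤ B := (norm_nonneg _).trans (hB z₁ hz₁)
  have hχi : Integrable (fun z => χ z) := χ.integrable
  have hkey := h η hη hηc hηV
  -- On the support of η, v may be replaced by the globally smooth monomial, which permits
  -- integration by parts.
  have e1 : ∫ z, v z * (Complex.I ^ M * (dirDeriv e)^[M] η z) =
      Complex.I ^ M * ((-1) ^ M * (C * ∫ z, (χ z : ℂ))) := by
    have e2 : ∀ z, v z * (Complex.I ^ M * (dirDeriv e)^[M] η z) = Complex.I ^ M *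
        ((C * (((L (z - z₀) : ℝ) : ℂ) ^ M / (M.factorial : ℂ))) * (dirDeriv e)^[M] η z) := by
      intro z
      by_cases hz : z ∈ V
      · rw [hv z hz]; ring
      · rw [iterate_dirDeriv_eq_zero e M Metric.isClosed_closedBall hη0 z fun hz' => hz (hrV hz')]
        simp
    simp only [e2]
    rw [integral_const_mul, integral_mul_iterate_dirDeriv e M (contDiff_monomial L z₀ C M) hη hηc,
      iterate_dirDeriv_monomial L he, integral_const_mul]
  have hpos : 0 < ∫ z, χ z := χ.integral_pos
  have e3 : ‖∫ z in W, v₀ z * η z‖ ≤ B * ∫ z, χ z := by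
    refine (norm_integral_le_of_norm_le (hχi.const_mul B).integrableOn
      (Eventually.of_forall fun z => ?_)).trans ?_
    · by_cases hz : z ∈ V
      · rw [norm_mul, Complex.norm_real, Real.norm_of_nonneg χ.nonneg]
        exact mul_le_mul_of_nonneg_right (hB z hz) χ.nonneg
      · rw [hη0 z fun hz' => hz (hrV hz'), mul_zero, norm_zero]
        exact mul_nonneg hBn χ.nonneg
    · rw [← integral_const_mul]
      exact setIntegral_le_integral (hχi.const_mul B)
        (Eventually.of_forall fun z => mul_nonneg hBn χ.nonneg)
  rw [← hkey, e1, integral_complex_ofReal] at e3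
  simp only [norm_mul, norm_pow, norm_neg, norm_one, one_pow, one_mul, Complex.norm_I,
    Complex.norm_real, Real.norm_of_nonneg hpos.le] at e3
  exact le_of_mul_le_mul_right e3 hpos

end Monomial

variable {d b : ℕ}

/-- The spatial coordinate with index `i` on space-time. -/
def coord (i : Fin d) : SpT d →L[ℝ] ℝ :=
  { toFun := fun z => z.fst i
    map_add' := fun _ _ => rfl
    map_smul' := fun _ _ => rfl
    cont := (EuclideanSpace.proj (𝕜 := ℝ) i).continuous.comp (WithLp.continuous_fst 2 (Sp d) ℝ) }

theorem coord_dilation (i : Fin d) (r : ℝ) (z : SpT d) :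
    coord i (dilation b r z) = r * coord i z := rfl

theorem coord_single (i : Fin d) : coord i (pt (EuclideanSpace.single i 1) 0) = 1 := by
  change (EuclideanSpace.single i (1 : ℝ)) i = 1
  simp

theorem norm_pt_single (i : Fin d) : ‖pt (EuclideanSpace.single i (1 : ℝ)) 0‖ = 1 := by
  have h := SpT.norm_sq (pt (EuclideanSpace.single i (1 : ℝ)) 0)
  rw [pt_fst, pt_snd, PiLp.norm_single, norm_one] at h
  have h0 := norm_nonneg (pt (EuclideanSpace.single i (1 : ℝ)) 0)
  nlinarith

theorem norm_dilation_mono {r q : ℝ} (hr : 0 < r) (hrq : r ≤ q) (z : SpT d) :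
    ‖dilation b r z‖ ≤ ‖dilation b q z‖ := by
  have hq : 0 < q := hr.trans_le hrq
  have h : dilation b r z = dilation b (r / q) (dilation b q z) := by
    rw [dilation_dilation, div_mul_cancel₀ _ hq.ne']
  rw [h]
  exact norm_dilation_le (by positivity) (div_le_one_of_le₀ hrq hq.le) _

/-- If the profile is a monomial near the origin and the partial sums of `∑ a_j / φ(2^j)` are
unbounded, then the corresponding generalized derivative of the wave is discontinuous. -/
theorem not_continuousDerivOn_wave {φ : ℝ → ℝ} (hφ : ClassM φ) (i : Fin d) (M : ℕ)
    {σ : ℝ} (hσ : σ = M + b + d / 2) {Ψ : 𝓢(SpT d, ℂ)} (hΨ0 : ∀ z, 3 / 2 ≤ ‖z‖ → Ψ z = 0)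
    (hΨ1 : ∀ z, ‖z‖ < 5 / 4 → Ψ z = ((coord i z : ℝ) : ℂ) ^ M / (M.factorial : ℂ))
    {a : ℕ → ℝ} (ha : ∀ j, 0 ≤ a j) (ha' : ¬ Summable fun j => a j * (φ (2 ^ j))⁻¹)
    {z₀ : SpT d} {W₀ W : Set (SpT d)} (hW₀ : IsOpen W₀) (hz₀ : z₀ ∈ W₀) (hW : W₀ ⊆ W) :
    ¬ Problem.ContinuousDerivOn (wave φ b σ z₀ (fun _ => Ψ) a) (Pi.single i M) 0 W₀ W := by
  rintro ⟨v₀, hv₀, h⟩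
  have hφpos : ∀ j : ℕ, 0 < φ (2 ^ j) := fun j => hφ.pos _ (one_le_pow₀ one_le_two)
  have hcont : ContinuousAt v₀ z₀ := hv₀.continuousAt (mem_of_superset (hW₀.mem_nhds hz₀) hW)
  set B : ℝ := ‖v₀ z₀‖ + 1
  have hO : {z | z ∈ W₀ ∧ ‖v₀ z‖ < B} ∈ 𝓝 z₀ :=
    inter_mem (hW₀.mem_nhds hz₀) (hcont.norm.eventually_lt continuousAt_const (lt_add_one _))
  obtain ⟨O, hOs, hOo, hzO⟩ := mem_nhds_iff.1 hO
  set e : SpT d := pt (EuclideanSpace.single i 1) 0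
  have hlim : Tendsto (fun J : ℕ => z₀ + ((2 : ℝ) ^ J)⁻¹ • e) atTop (𝓝 z₀) := by
    have h1 : Tendsto (fun J : ℕ => ((2 : ℝ) ^ J)⁻¹) atTop (𝓝 0) :=
      tendsto_inv_atTop_zero.comp (tendsto_pow_atTop_atTop_of_one_lt one_lt_two)
    simpa using tendsto_const_nhds.add (h1.smul_const e)
  obtain ⟨J₀, hJ₀⟩ := eventually_atTop.1 (hlim.eventually (hOo.mem_nhds hzO))
  refine ha' (summable_of_sum_range_le (c := B)
    (fun j => mul_nonneg (ha j) (inv_pos.2 (hφpos j)).le) fun K => ?_)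
  -- J ≥ J₀ puts the test point z₀ + 2^{-J} e into the neighbourhood where v₀ is bounded by B; J ≥ K
  -- makes C dominate the given partial sum.
  set J := max J₀ K
  set C : ℝ := ∑ j ∈ Finset.range (J + 1), a j * (φ (2 ^ j))⁻¹
  have hKC : ∑ j ∈ Finset.range K, a j * (φ (2 ^ j))⁻¹ ≤ C :=
    Finset.sum_le_sum_of_subset_of_nonneg
      (Finset.range_subset_range.2 ((le_max_right J₀ K).trans (Nat.le_succ _)))
      fun j _ _ => mul_nonneg (ha j) (inv_pos.2 (hφpos j)).le
  have hcd : ∀ r : ℝ, Continuous fun z : SpT d => ‖dilation b r (z - z₀)‖ := fun r =>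
    ((dilation b r).continuous.comp (continuous_id.sub continuous_const)).norm
  -- On V the terms with j ≤ J are in the monomial regime and those with j > J vanish. The test
  -- point has rescaled norms 1 and 2, so V is nonempty.
  set V : Set (SpT d) := O ∩ ({z | ‖dilation b (2 ^ J) (z - z₀)‖ < 5 / 4} ∩
    {z | 3 / 2 < ‖dilation b (2 ^ (J + 1)) (z - z₀)‖})
  have hVo : IsOpen V := hOo.inter
    ((isOpen_lt (hcd _) continuous_const).inter (isOpen_lt continuous_const (hcd _)))
  have hVz : z₀ + ((2 : ℝ) ^ J)⁻¹ • e ∈ V := by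
    have hn : ∀ r : ℝ, ‖dilation b r ((z₀ + ((2 : ℝ) ^ J)⁻¹ • e) - z₀)‖ = |((2 : ℝ) ^ J)⁻¹ * r| := by
      intro r
      rw [add_sub_cancel_left, map_smul, dilation_single, smul_smul, norm_smul, norm_pt_single,
        mul_one, Real.norm_eq_abs]
    refine ⟨hJ₀ J (le_max_left _ _), ?_, ?_⟩
    · rw [mem_ofPred_eq, hn, inv_mul_cancel₀ (by positivity)]; norm_num
    · rw [mem_ofPred_eq, hn, pow_succ, inv_mul_cancel_left₀ (by positivity)]; norm_num
  have hv : ∀ z ∈ V, wave φ b σ z₀ (fun _ => Ψ) a z =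
      (C : ℂ) * (((coord i (z - z₀) : ℝ) : ℂ) ^ M / (M.factorial : ℂ)) := by
    rintro z ⟨-, hz1, hz2⟩
    unfold wave
    rw [tsum_eq_sum (s := Finset.range (J + 1))]
    · simp only [C]
      push_cast
      rw [Finset.sum_mul]
      refine Finset.sum_congr rfl fun j hj => ?_
      have hjJ : j ≤ J := Nat.lt_succ_iff.1 (Finset.mem_range.1 hj)
      have hlt : ‖dilation b (2 ^ j) (z - z₀)‖ < 5 / 4 :=
        (norm_dilation_mono (by positivity) (pow_le_pow_right₀ one_le_two hjJ) _).trans_lt hz1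
      -- At the critical order the coefficient carries 2^{-jM}, which cancels the 2^{jM} from the
      -- dilated monomial: every scale adds a_j/φ(2^j) times the same function.
      rw [hΨ1 _ hlt, coord_dilation, waveCoeff, hσ,
        show (d : ℝ) / 2 + b - (M + b + d / 2) = -M by ring, Real.rpow_neg (by positivity),
        Real.rpow_natCast]
      have h2 : ((2 : ℂ) ^ j) ^ M ≠ 0 := pow_ne_zero _ (pow_ne_zero _ two_ne_zero)
      push_cast
      rw [mul_pow]
      field_simp
    · intro j hj
      have hjJ : J + 1 ≤ j := by simpa using hj
      rw [hΨ0 _ (hz2.le.trans (norm_dilation_mono (by positivity)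
        (pow_le_pow_right₀ one_le_two hjJ) _)), mul_zero]
  have hfin : ‖(C : ℂ)‖ ≤ B := by
    refine norm_le_of_weak_deriv_monomial (coord i) (coord_single i) z₀ hVo ⟨_, hVz⟩ hv
      (fun z hz => (hOs hz.1).2.le) (v₀ := v₀) (W := W₀) fun η hη hηc hηV => ?_
    have hh := h η hη hηc (hηV.trans fun z hz => (hOs hz.1).1)
    have hsum : ∑ i' : Fin d, (Pi.single i M : Fin d → ℕ) i' = M := by simp
    rw [hsum, add_zero] at hh
    rw [← hh]
    congr 2
    funext z
    rw [Dxt, hsum, dxt, iterPartial_single]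
    rfl
  rw [Complex.norm_real] at hfin
  exact hKC.trans ((le_abs_self C).trans hfin)

end

section

/-! ### Right-hand sides that vanish near the boundary of the cylinder -/

/-- Potter's bound between 1 and the weight, with δ = σ - σ', shows that φ costs less than any
positive power. Hence the embedding into the Sobolev space of any strictly lower order. -/
theorem exists_hNormOn_le_of_lt {φ : ℝ → ℝ} (hφ : ClassM φ) {d : ℕ} (b : ℕ) {σ' σ : ℝ}
    (h : σ' < σ) : ∃ C : ℝ, ∀ (U : Set (SpT d)) (v : SpT d → ℂ),
      hNormOn (anisoBase b) σ' 1 U v ≤ ENNReal.ofReal C * hNormOn (anisoBase b) σ φ U v := by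
  obtain ⟨C, hC, hpot⟩ := hφ.potter (sub_pos.2 h)
  have h1 : 0 < φ 1 := hφ.pos 1 le_rfl
  refine ⟨C / φ 1, fun U v => hNormOn_mono_weight (div_pos hC h1) (fun z => ?_) U v⟩
  have hR : 1 ≤ anisoBase b z := one_le_anisoBase z
  have hR0 : 0 < anisoBase b z := zero_lt_one.trans_le hR
  have hp := hpot 1 _ le_rfl hR
  rw [Real.log_one, zero_sub, abs_neg, abs_of_nonneg (Real.log_nonneg hR), mul_comm (σ - σ'),
    ← Real.rpow_def_of_pos hR0, Real.rpow_sub hR0] at hp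
  have hs : 0 < anisoBase b z ^ σ' := Real.rpow_pos_of_pos hR0 _
  rw [Pi.one_apply, mul_one, div_mul_eq_mul_div, le_div_iff₀ h1]
  calc anisoBase b z ^ σ' * φ 1 ≤ anisoBase b z ^ σ' * (C * φ (anisoBase b z) *
        (anisoBase b z ^ σ / anisoBase b z ^ σ')) := by gcongr
    _ = C * (anisoBase b z ^ σ * φ (anisoBase b z)) := by field_simp

theorem tendsto_hNormOn_of_lt {φ : ℝ → ℝ} (hφ : ClassM φ) {d : ℕ} (b : ℕ) {σ' σ : ℝ}
    (h : σ' < σ) {U : Set (SpT d)} {v : ℕ → SpT d → ℂ}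
    (hv : Tendsto (fun i => hNormOn (anisoBase b) σ φ U (v i)) atTop (𝓝 0)) :
    Tendsto (fun i => hNormOn (anisoBase b) σ' 1 U (v i)) atTop (𝓝 0) := by
  obtain ⟨C, hC⟩ := exists_hNormOn_le_of_lt hφ b h (d := d)
  have hlim := ENNReal.Tendsto.const_mul hv (Or.inr (ENNReal.ofReal_ne_top (r := C)))
  rw [mul_zero] at hlim
  exact tendsto_of_tendsto_of_tendsto_of_le_of_le tendsto_const_nhds hlim (fun _ => zero_le)
    fun i => hC U (v i)

theorem ENNReal_rpow_half_sum_sq_le {ι : Type*} (s : Finset ι) (x : ι → ℝ≥0∞) :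
    (∑ i ∈ s, x i ^ 2) ^ (1 / 2 : ℝ) ≤ ∑ i ∈ s, x i := by
  have h : ∑ i ∈ s, x i ^ 2 ≤ (∑ i ∈ s, x i) ^ 2 := by
    rw [sq, Finset.sum_mul]
    refine Finset.sum_le_sum fun i hi => ?_
    rw [sq]
    gcongr
    exact Finset.single_le_sum (fun _ _ => zero_le) hi
  calc (∑ i ∈ s, x i ^ 2) ^ (1 / 2 : ℝ) ≤ ((∑ i ∈ s, x i) ^ 2) ^ (1 / 2 : ℝ) := by gcongr
    _ = ∑ i ∈ s, x i := by rw [← ENNReal.rpow_natCast, ← ENNReal.rpow_mul]; norm_num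

theorem ae_lateralMeasure {d : ℕ} (G : Set (Sp d)) (τ : ℝ) :
    ∀ᵐ z ∂lateralMeasure G τ, z.fst ∈ frontier G := by
  have hm : Measurable (WithLp.toLp 2 : Sp d × ℝ → SpT d) :=
    (WithLp.prod_continuous_toLp 2 (Sp d) ℝ).measurable
  have hc : IsClosed {z : SpT d | z.fst ∈ frontier G} :=
    isClosed_frontier.preimage (WithLp.continuous_fst 2 (Sp d) ℝ)
  rw [lateralMeasure, ae_map_iff hm.aemeasurable hc.measurableSet]
  exact Measure.quasiMeasurePreserving_fst.ae (ae_restrict_mem isClosed_frontier.measurableSet)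

namespace Problem

variable (P : Problem) (𝒜 : BoundaryAtlas P.G)

theorem normS_eq_zero (s : ℝ) (φ : ℝ → ℝ) {η : SpT P.n → ℂ}
    (hη : ∀ z, z.fst ∈ frontier P.G → η z = 0) : P.normS 𝒜 s φ η = 0 := by
  have h1 : η =ᵐ[lateralMeasure P.G P.τ] 0 := by
    filter_upwards [ae_lateralMeasure P.G P.τ] with z hz using hη z hz
  have h2 : MemLp η 2 (lateralMeasure P.G P.τ) := (memLp_congr_ae h1).2 MemLp.zero'
  rw [normS, hNormS, iInf_pos h2, Finset.sum_eq_zero, ENNReal.zero_rpow_of_pos (by norm_num)]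
  intro j _
  have h3 : (fun z : SpT (P.n - 1) => 𝒜.χ j (𝒜.θ j z.fst) * η (pt (𝒜.θ j z.fst) z.snd)) = 0 := by
    funext z
    have : 𝒜.θ j z.fst ∈ frontier P.G := by
      rw [← 𝒜.θ_cover]; exact mem_iUnion.2 ⟨j, mem_range_self _⟩
    rw [hη (pt (𝒜.θ j z.fst) z.snd) this, mul_zero]; rfl
  rw [h3, hNormOn_zero, zero_pow two_ne_zero]

theorem normG_zero (s : ℝ) (φ : ℝ → ℝ) : P.normG s φ 0 = 0 := hNormOn_zero _ _ _ _

theorem normH_le_sum (s : ℝ) (φ : ℝ → ℝ) {y : P.RHS}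
    (h1 : ∀ j z, z.fst ∈ frontier P.G → y.2.1 j z = 0) (h2 : y.2.2 = 0) :
    P.normH 𝒜 s φ y ≤ ∑ j, P.normΩ s φ (y.1 j) := by
  have e1 : ∑ j, P.normS 𝒜 (s - P.l j - 1 / 2) φ (y.2.1 j) ^ 2 = 0 :=
    Finset.sum_eq_zero fun j _ => by
      rw [P.normS_eq_zero 𝒜 _ _ (h1 j), zero_pow two_ne_zero]
  have e2 : ∑ k, ∑ r : Fin (P.ϰ k),
      P.normG (s + 2 * P.b * P.ϰ k - 2 * P.b * r - P.b) φ (y.2.2 k r) ^ 2 = 0 :=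
    Finset.sum_eq_zero fun k _ => Finset.sum_eq_zero fun r _ => by
      have : y.2.2 k r = 0 := by rw [h2]; rfl
      rw [this, normG_zero, zero_pow two_ne_zero]
  rw [normH, e1, e2, add_zero, add_zero]
  exact ENNReal_rpow_half_sum_sq_le _ _

theorem tendsto_normH (s : ℝ) (φ : ℝ → ℝ) {y : ℕ → P.RHS}
    (h : ∀ j, Tendsto (fun i => P.normΩ s φ ((y i).1 j)) atTop (𝓝 0))
    (h1 : ∀ i j z, z.fst ∈ frontier P.G → (y i).2.1 j z = 0) (h2 : ∀ i, (y i).2.2 = 0) :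
    Tendsto (fun i => P.normH 𝒜 s φ (y i)) atTop (𝓝 0) := by
  have hs := tendsto_finsetSum Finset.univ fun j _ => h j
  rw [Finset.sum_const_zero] at hs
  exact tendsto_of_tendsto_of_tendsto_of_le_of_le tendsto_const_nhds hs (fun _ => zero_le)
    fun i => P.normH_le_sum 𝒜 s φ (h1 i) (h2 i)

/-- Right-hand sides approximated by smooth `(f, 0, 0)` with `f` supported in the open cylinder
satisfy the compatibility conditions. -/
theorem compatible_of_tendsto {s : ℝ} {φ : ℝ → ℝ} {y : P.RHS} {F : ℕ → Fin P.N → SpT P.n → ℂ}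
    (hF : ∀ i j, ContDiff ℝ ∞ (F i j)) {K : Set (SpT P.n)} (hK : IsClosed K)
    (hK0 : ∀ x, pt x 0 ∉ K) (hF0 : ∀ i j, ∀ z ∉ K, F i j z = 0)
    (h : Tendsto (fun i => P.normH 𝒜 s φ (y - (F i, 0, 0))) atTop (𝓝 0)) :
    P.Compatible 𝒜 s φ y := by
  -- F vanishes off a closed set missing t = 0, so all its time derivatives vanish there: the zero
  -- jet solves the recurrence and every residual is zero.
  refine ⟨fun i => (F i, 0, 0), fun _ _ _ => 0, fun i => ⟨⟨hF i, fun _ => contDiff_const,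
    fun _ _ => contDiff_const⟩, fun _ _ => rfl, fun k ρ x => ?_⟩, h, fun j r _ => ?_⟩
  · rw [dt_eq_zero hK (hF0 i k) ρ _ (hK0 x)]
    simp [Dx_zero]
  · have h0 : ∀ i, P.residual (F i, 0, 0) (fun _ _ => 0) j r = 0 := by
      intro i
      funext x
      have hd : dt r (0 : SpT P.n → ℂ) (pt x 0) = 0 :=
        dt_eq_zero isClosed_empty (fun _ _ => rfl) r _ (notMem_empty _)
      simp [residual, Dx_zero, hd]
    simp only [h0, eLpNorm_zero]
    exact tendsto_const_nhds

end Problem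

end

section

/-! ### Waves as right-hand sides -/

/-- Dilation by 2^j ≥ 2^{j₀} expands distances at least by 2^{j₀}, so all terms from j₀ on live in
one small ball, which fits into Ω for large j₀. -/
theorem term_eq_zero {d b : ℕ} (hb : 1 ≤ b) {z₀ : SpT d} {g : SpT d → ℂ}
    (hg : ∀ z, 3 / 2 < ‖z‖ → g z = 0) {j₀ j : ℕ} (hj : j₀ ≤ j) {z : SpT d}
    (hz : z ∉ Metric.closedBall z₀ (3 / 2 * ((2 : ℝ) ^ j₀)⁻¹)) :
    g (dilation b (2 ^ j) (z - z₀)) = 0 := by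
  rw [Metric.mem_closedBall, dist_eq_norm, not_le, ← div_eq_mul_inv,
    div_lt_iff₀ (by positivity)] at hz
  refine hg _ (hz.trans_le ?_)
  rw [mul_comm]
  refine le_trans ?_ (le_norm_dilation hb (one_le_pow₀ one_le_two) _)
  gcongr
  exact one_le_two

theorem wave_change {d b : ℕ} (φ : ℝ → ℝ) (σ σ' : ℝ) (z₀ : SpT d) (Ψ : ℕ → 𝓢(SpT d, ℂ))
    (a : ℕ → ℝ) : wave φ b σ z₀ Ψ a =
      wave φ b σ' z₀ Ψ fun j => a j * ((2 : ℝ) ^ j) ^ (σ' - σ) := by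
  funext z
  unfold wave
  refine tsum_congr fun j => ?_
  rw [waveCoeff_change φ d b σ σ' j, ← mul_assoc]

theorem summable_sq_mul_rpow {a : ℕ → ℝ} (ha : Summable fun j => a j ^ 2) {δ : ℝ} (hδ : δ ≤ 0) :
    Summable fun j => (a j * ((2 : ℝ) ^ j) ^ δ) ^ 2 := by
  refine ha.of_nonneg_of_le (fun j => sq_nonneg _) fun j => ?_
  rw [mul_pow]
  have h1 : ((2 : ℝ) ^ j) ^ δ ≤ 1 :=
    Real.rpow_le_one_of_one_le_of_nonpos (one_le_pow₀ one_le_two) hδ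
  have h0 : 0 ≤ ((2 : ℝ) ^ j) ^ δ := by positivity
  exact mul_le_of_le_one_right (sq_nonneg _) (pow_le_one₀ h0 h1)

theorem wave_single {d b : ℕ} (φ : ℝ → ℝ) (σ : ℝ) (z₀ : SpT d) (Ψ : ℕ → 𝓢(SpT d, ℂ)) (j : ℕ)
    (t : ℝ) : wave φ b σ z₀ Ψ (Pi.single j t) = fun z =>
      ((t * waveCoeff φ d b σ j : ℝ) : ℂ) * Ψ j (dilation b (2 ^ j) (z - z₀)) := by
  funext z
  unfold wave
  rw [tsum_eq_single j fun i hi => by rw [Pi.single_eq_of_ne hi]; simp, Pi.single_eq_same]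

namespace Problem

variable {P : Problem} (𝒜 : BoundaryAtlas P.G)

theorem isOpen_Ω (hP : P.IsParabolic) : IsOpen P.Ω :=
  (hP.G_open.preimage (WithLp.continuous_fst 2 (Sp P.n) ℝ)).inter
    (isOpen_Ioo.preimage (WithLp.continuous_snd 2 (Sp P.n) ℝ))

theorem pt_zero_notMem_Ω (x : Sp P.n) : pt x 0 ∉ P.Ω := fun h => lt_irrefl 0 h.2.1

variable {φ : ℝ → ℝ} {s : ℝ} {z₀ : SpT P.n} {Φ : Fin P.N → ℕ → 𝓢(SpT P.n, ℂ)} {a : ℕ → ℝ} {j₀ : ℕ}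

/-- Right-hand sides `(f, 0, 0)` with waves `f` localized inside the cylinder belong to the spaces
defined by the compatibility conditions. -/
theorem mem_QReg_of_ae_wave (hP : P.IsParabolic) (hφ : ClassM φ) (hs : 0 < s) (hΦ : ∀ i, IsBoundedFamily (Φ i))
    (hΦ' : ∀ i, IsSupportedFamily (Φ i)) (ha : Summable fun j => a j ^ 2)
    (ha0 : ∀ j < j₀, a j = 0)
    (hK : Metric.closedBall z₀ (3 / 2 * ((2 : ℝ) ^ j₀)⁻¹) ⊆ P.Ω) {y : P.RHS}
    (hy : ∀ i, y.1 i =ᵐ[volume] wave φ P.b s z₀ (Φ i) a) (hy' : y.2 = 0) :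
    y ∈ P.QReg 𝒜 s φ := by
  refine ⟨?_, ?_⟩
  · refine (P.normH_le_sum 𝒜 s φ (fun j z _ => by rw [hy']; rfl) (by rw [hy']; rfl)).trans_lt ?_
    exact ENNReal.sum_lt_top.2 fun i _ => hNormOn_wave_lt_top hφ hP.b_pos hs z₀ (hΦ i) ha _ (hy i)
  · let F : ℕ → Fin P.N → SpT P.n → ℂ := fun N i z => ∑ j ∈ Finset.range N,
      ((a j * waveCoeff φ P.n P.b s j : ℝ) : ℂ) * Φ i j (dilation P.b (2 ^ j) (z - z₀))
    refine P.compatible_of_tendsto 𝒜 (F := F) (K := Metric.closedBall z₀ (3 / 2 * ((2 : ℝ) ^ j₀)⁻¹))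
      (fun N i => ?_) Metric.isClosed_closedBall (fun x hx => pt_zero_notMem_Ω x (hK hx))
      (fun N i z hz => ?_) ?_
    · refine ContDiff.sum fun j _ => contDiff_const.mul (((Φ i j).smooth ⊤).comp
        ((dilation P.b _).contDiff.comp (contDiff_id.sub contDiff_const)))
    · refine Finset.sum_eq_zero fun j _ => ?_
      -- The terms below j₀, whose supports could leave the cylinder, have zero coefficient.
      by_cases hj : j < j₀
      · rw [ha0 j hj]; simp
      · rw [term_eq_zero hP.b_pos (hΦ' i j) (not_lt.1 hj) hz, mul_zero]
    · refine P.tendsto_normH 𝒜 s φ (fun i => ?_) (fun N j z _ => ?_) fun N => ?_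
      · exact tendsto_hNormOn_wave_sub hφ hP.b_pos hs z₀ (hΦ i) (hΦ' i) ha P.Ω (hy i)
          fun N z => rfl
      · change y.2.1 j z - 0 = 0
        rw [hy']; simp
      · change y.2.2 - 0 = 0
        rw [hy']; simp

/-- The right-hand sides `(f, 0, 0)` whose first component consists of waves. -/
def waveRHS (P : Problem) (φ : ℝ → ℝ) (s : ℝ) (z₀ : SpT P.n) (Φ : Fin P.N → ℕ → 𝓢(SpT P.n, ℂ))
    (a : ℕ → ℝ) : P.RHS := (fun i => wave φ P.b s z₀ (Φ i) a, 0, 0)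

theorem exists_normH_single_le (hP : P.IsParabolic) (hφ : ClassM φ) (s : ℝ) {s' : ℝ} (hs' : 0 < s') (z₀ : SpT P.n)
    (hΦ : ∀ i, IsBoundedFamily (Φ i)) :
    ∃ C : ℝ, 0 ≤ C ∧ ∀ (j : ℕ) (t : ℝ), P.normH 𝒜 s' φ (P.waveRHS φ s z₀ Φ (Pi.single j t)) ≤
      ENNReal.ofReal (C * (|t| * ((2 : ℝ) ^ j) ^ (s' - s))) := by
  choose C hC0 hC using fun i => exists_hNormOn_term_le hφ hP.b_pos s hs' z₀ (hΦ i)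
  refine ⟨∑ i, C i, Finset.sum_nonneg fun i _ => hC0 i, fun j t => ?_⟩
  refine (P.normH_le_sum 𝒜 s' φ (fun _ _ _ => rfl) rfl).trans ?_
  rw [Finset.sum_mul, ENNReal.ofReal_sum_of_nonneg fun i _ => mul_nonneg (hC0 i) (by positivity)]
  refine Finset.sum_le_sum fun i _ => ?_
  have h := hC i (Pi.single j t) j P.Ω
  rw [Pi.single_eq_same] at h
  change hNormOn (anisoBase P.b) s' φ P.Ω (wave φ P.b s z₀ (Φ i) (Pi.single j t)) ≤ _
  rw [wave_single]
  exact h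

/-- The j-th term has norms at most constant multiples of |a_j| 2^{-jε} and |a_j| 2^{jε} in the
endpoint spaces: exactly the hypotheses of `mem_domain_of_quasiOrthogonal` with θ = 2^{-ε}. -/
theorem waveRHS_mem_interpHalf (hP : P.IsParabolic) (hφ : ClassM φ) {ε : ℝ} (hε : 0 < ε) (hs : 0 < s - ε)
    (hΦ : ∀ i, IsBoundedFamily (Φ i)) (hΦ' : ∀ i, IsSupportedFamily (Φ i))
    (ha : Summable fun j => a j ^ 2) (ha0 : ∀ j < j₀, a j = 0)
    (hK : Metric.closedBall z₀ (3 / 2 * ((2 : ℝ) ^ j₀)⁻¹) ⊆ P.Ω) :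
    P.waveRHS φ s z₀ Φ a ∈ interpHalf (P.QReg 𝒜 (s - ε) φ) (P.QReg 𝒜 (s + ε) φ)
      (P.normH 𝒜 (s - ε) φ) (P.normH 𝒜 (s + ε) φ) := by
  -- Coefficients are kept in the normalization of order s and only required to be square summable
  -- after reweighting to order s'. This covers the whole wave, its tails and its single terms.
  have hmem : ∀ {s' : ℝ} (_ : 0 < s') {c : ℕ → ℝ}
      (_ : Summable fun j => (c j * ((2 : ℝ) ^ j) ^ (s' - s)) ^ 2) (_ : ∀ j < j₀, c j = 0)
      {y : P.RHS} (_ : ∀ i, y.1 i =ᵐ[volume] wave φ P.b s z₀ (Φ i) c) (_ : y.2 = 0),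
      y ∈ P.QReg 𝒜 s' φ := fun {s'} hs' {c} hc hc0 {y} hy hy' =>
    mem_QReg_of_ae_wave 𝒜 hP hφ hs' hΦ hΦ' hc (fun j hj => by rw [hc0 j hj, zero_mul]) hK
      (fun i => by rw [← wave_change]; exact hy i) hy'
  have hδ : s - ε - s ≤ 0 := by linarith
  have hy0 : P.waveRHS φ s z₀ Φ a ∈ P.QReg 𝒜 (s - ε) φ :=
    hmem hs (summable_sq_mul_rpow ha hδ) ha0 (fun i => EventuallyEq.refl _ _) rfl
  refine ⟨hy0, ?_⟩
  intro H _ _ _ π J R hπ hJ hR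
  let v : ℕ → P.RHS := fun j => P.waveRHS φ s z₀ Φ (Pi.single j (a j))
  have hv : ∀ {s' : ℝ} (_ : 0 < s') (j : ℕ), v j ∈ P.QReg 𝒜 s' φ := by
    intro s' hs' j
    refine hmem hs' (summable_of_ne_finset_zero (s := {j}) fun i hi => ?_) (fun i hi => ?_)
      (fun i => EventuallyEq.refl _ _) rfl
    · rw [Pi.single_eq_of_ne (by simpa using hi)]; simp
    · by_cases hij : i = j
      · subst hij; rw [Pi.single_eq_same, ha0 i hi]
      · exact Pi.single_eq_of_ne hij _
  obtain ⟨C₀, hC₀, hb₀⟩ := exists_normH_single_le 𝒜 hP hφ s hs z₀ hΦ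
  obtain ⟨C₁, hC₁, hb₁⟩ := exists_normH_single_le 𝒜 hP hφ s (s' := s + ε) (by linarith) z₀ hΦ
  have hx : ∀ j, π (v j) ∈ J.domain := fun j => by
    have : π (v j) ∈ (J.domain : Set H) := by
      rw [hJ.2.2.1]; exact ⟨_, hv (by linarith) j, rfl⟩
    exact this
  have hpow : ∀ (δ : ℝ) (j : ℕ), ((2 : ℝ) ^ j) ^ δ = ((2 : ℝ) ^ δ) ^ j := fun δ j => by
    rw [← Real.rpow_natCast, ← Real.rpow_mul zero_le_two, mul_comm, Real.rpow_mul zero_le_two,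
      Real.rpow_natCast]
  have hnorm : ∀ {x : H} {c : ℝ} (_ : 0 ≤ c), ‖x‖ₑ ≤ ENNReal.ofReal c → ‖x‖ ≤ c := by
    intro x c hc h
    rwa [← ofReal_norm, ENNReal.ofReal_le_ofReal_iff hc] at h
  refine mem_domain_of_quasiOrthogonal hR (x := fun j => π (v j)) hx ?_
    (A := fun j => max C₀ C₁ * |a j|) (fun j => by positivity) ?_
    (θ := (2 : ℝ) ^ (-ε)) (by positivity) (Real.rpow_lt_one_of_one_lt_of_neg one_lt_two (by linarith))
    (fun j => ?_) fun j => ?_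
  · let w : ℕ → P.RHS := fun N => P.waveRHS φ s z₀ Φ a - ∑ j ∈ Finset.range N, v j
    have hw1 : ∀ N i z, (w N).1 i z = wave φ P.b s z₀ (Φ i) a z - ∑ j ∈ Finset.range N,
        ((a j * waveCoeff φ P.n P.b s j : ℝ) : ℂ) * Φ i j (dilation P.b (2 ^ j) (z - z₀)) := by
      intro N i z
      simp only [w, v, Prod.fst_sub, Prod.fst_sum, Pi.sub_apply, Finset.sum_apply, waveRHS,
        wave_single]
    have hw2 : ∀ N, (w N).2 = 0 := by
      intro N
      simp only [w, v, Prod.snd_sub, Prod.snd_sum, waveRHS, Prod.mk_zero_zero,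
        Finset.sum_const_zero, sub_zero]
    -- π is isometric only on the realized space, so the remainders themselves must be shown to lie
    -- in it.
    have hwm : ∀ N, w N ∈ P.QReg 𝒜 (s - ε) φ := fun N =>
      hmem hs (c := tailSeq N a) (summable_sq_mul_rpow (summable_tailSeq ha N) hδ)
        (fun j hj => by simp [tailSeq, ha0 j hj]) (fun i => by
          filter_upwards [ae_ne_point z₀] with z hz
          rw [hw1, wave_sub_sum hP.b_pos φ s (hΦ' i) a N hz]) (hw2 N)
    have hlim : Tendsto (fun N => P.normH 𝒜 (s - ε) φ (w N)) atTop (𝓝 0) := by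
      refine P.tendsto_normH 𝒜 (s - ε) φ (fun i => ?_) (fun N j z _ => by rw [hw2]; rfl)
        fun N => by rw [hw2]; rfl
      refine tendsto_hNormOn_wave_sub hφ hP.b_pos hs z₀ (hΦ i) (hΦ' i) (summable_sq_mul_rpow ha hδ)
        P.Ω (w := wave φ P.b s z₀ (Φ i) a) (EventuallyEq.of_eq (wave_change _ _ _ _ _ _))
        fun N z => ?_
      rw [hw1]
      congr 1
      refine Finset.sum_congr rfl fun j _ => ?_
      rw [waveCoeff_change φ P.n P.b s (s - ε) j, ← mul_assoc]
    have hlim' : Tendsto (fun N => ‖π (w N)‖ₑ) atTop (𝓝 0) := by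
      simpa only [hπ.1 _ (hwm _)] using hlim
    rw [tendsto_iff_norm_sub_tendsto_zero]
    have h3 := (ENNReal.tendsto_toReal ENNReal.zero_ne_top).comp hlim'
    rw [ENNReal.toReal_zero] at h3
    refine h3.congr fun N => ?_
    simp only [Function.comp_apply, toReal_enorm, w, map_sub, map_sum]
    rw [norm_sub_rev]
  · simp only [mul_pow, sq_abs]
    exact ha.mul_left _
  · refine hnorm (by positivity) ?_
    rw [hπ.1 _ (hv hs j)]
    refine (hb₀ j (a j)).trans (ENNReal.ofReal_le_ofReal ?_)
    rw [hpow, show s - ε - s = -ε by ring, ← mul_assoc]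
    gcongr
    exact le_max_left _ _
  · refine hnorm (by positivity) ?_
    rw [hJ.2.2.2 _ (hv (by linarith) j)]
    refine (hb₁ j (a j)).trans (ENNReal.ofReal_le_ofReal ?_)
    rw [hpow, show s + ε - s = - -ε by ring, Real.rpow_neg zero_le_two (-ε), ← mul_assoc]
    gcongr
    exact le_max_right _ _

theorem waveRHS_mem_Q (hP : P.IsParabolic) (hφ : ClassM φ) {ε : ℝ} (hε : 0 < ε) (hs : 0 < s - ε)
    (hΦ : ∀ i, IsBoundedFamily (Φ i)) (hΦ' : ∀ i, IsSupportedFamily (Φ i))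
    (ha : Summable fun j => a j ^ 2) (ha0 : ∀ j < j₀, a j = 0)
    (hK : Metric.closedBall z₀ (3 / 2 * ((2 : ℝ) ^ j₀)⁻¹) ⊆ P.Ω) :
    P.waveRHS φ s z₀ Φ a ∈ P.Q 𝒜 ε s φ := by
  rw [Q]
  split_ifs
  · exact waveRHS_mem_interpHalf 𝒜 hP hφ hε hs hΦ hΦ' ha ha0 hK
  · exact mem_QReg_of_ae_wave 𝒜 hP hφ (by linarith) hΦ hΦ' ha ha0 hK
      (fun i => EventuallyEq.refl _ _) rfl

end Problem

end

section

/-! ### The solution with a discontinuous derivative -/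

namespace Problem

variable {P : Problem} (𝒜 : BoundaryAtlas P.G)

theorem sum_mem_idxLE_le {d b c : ℕ} {q : (Fin d → ℕ) × ℕ} (hq : q ∈ idxLE d b (2 * b * c)) :
    ∑ i, q.1 i + 2 * b * q.2 ≤ 2 * b * c := by
  have h := (Finset.mem_filter.1 hq).2
  exact_mod_cast h

/-- The operators of the system map rescaled copies of `ψ` in the `k`-th component to rescaled
copies of bounded families, also after multiplication by a smooth function `χ`. -/
theorem exists_family_of_row (hP : P.IsParabolic) {ψ : SpT P.n → ℂ} (hψ : ContDiff ℝ ∞ ψ)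
    (hψ' : ∀ z, 3 / 2 ≤ ‖z‖ → ψ z = 0) (z₀ : SpT P.n) (i k : Fin P.N) {χ : SpT P.n → ℂ}
    (hχ : ContDiff ℝ ∞ χ) :
    ∃ Φ : ℕ → 𝓢(SpT P.n, ℂ), IsBoundedFamily Φ ∧ IsSupportedFamily Φ ∧
      ∀ (φ : ℝ → ℝ) (σ : ℝ) (a : ℕ → ℝ) (j : ℕ) (z : SpT P.n),
        ((a j * waveCoeff φ P.n P.b (σ + 2 * P.b * P.ϰ k) j : ℝ) : ℂ) *
          (χ z * ∑ q ∈ idxLE P.n P.b (2 * P.b * P.ϰ k), P.a i k q.1 q.2 z *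
            Dxt q.1 q.2 (fun z => ψ (dilation P.b (2 ^ j) (z - z₀))) z) =
        ((a j * waveCoeff φ P.n P.b σ j : ℝ) : ℂ) * Φ j (dilation P.b (2 ^ j) (z - z₀)) := by
  obtain ⟨Φ, h1, h2, h3⟩ := exists_family_of_operator (b := P.b) hψ hψ' z₀ (2 * P.b * P.ϰ k)
    (idxLE P.n P.b (2 * P.b * P.ϰ k)) (fun q hq => sum_mem_idxLE_le hq)
    (A := fun q z => χ z * P.a i k q.1 q.2 z) fun q => hχ.mul (hP.a_smooth i k q.1 q.2)
  refine ⟨Φ, h1, h2, fun φ σ a j z => ?_⟩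
  have h := h3 φ σ j z
  push_cast at h ⊢
  rw [mul_assoc (a j : ℂ), mul_assoc (a j : ℂ), ← h, Finset.mul_sum]
  simp only [mul_assoc]

/-- The wave is put into the k-th component alone. The rows of the system turn it into waves of
order s, and the boundary and initial data are zero because the support is inside Ω; thus the
right-hand sides are found from the solution. -/
theorem exists_solution (hP : P.IsParabolic) {φ : ℝ → ℝ} (hφ : ClassM φ) {ε s : ℝ} (hε : 0 < ε)
    (hs : 0 < s - ε) (hs' : (P.σ₀ : ℝ) < s) (k : Fin P.N) {Ψ : 𝓢(SpT P.n, ℂ)}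
    (hΨ : ∀ z, 3 / 2 ≤ ‖z‖ → Ψ z = 0) {a : ℕ → ℝ} (ha : Summable fun j => a j ^ 2) {j₀ : ℕ}
    (ha0 : ∀ j < j₀, a j = 0) {z₀ : SpT P.n}
    (hK : Metric.closedBall z₀ (3 / 2 * ((2 : ℝ) ^ j₀)⁻¹) ⊆ P.Ω) :
    ∃ y : P.RHS, y ∈ P.Q 𝒜 ε s φ ∧ (∀ U, P.LocalRHS 𝒜 U s φ y) ∧ P.IsSolution 𝒜
      (Pi.single k (wave φ P.b (s + 2 * P.b * P.ϰ k) z₀ (fun _ => Ψ) a)) y := by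
  have hs0 : 0 < s := by linarith
  have hb := hP.b_pos
  have hΨs : ContDiff ℝ ∞ Ψ := Ψ.smooth ⊤
  have hbase : 0 < s + 2 * P.b * P.ϰ k := by positivity
  have hcb : IsBoundedFamily (fun _ : ℕ => Ψ) := fun m l => ⟨_, fun _ => le_rfl⟩
  have hcs : IsSupportedFamily (fun _ : ℕ => Ψ) := fun _ z hz => hΨ z hz.le
  choose Φ hΦ hΦ' hΦe using fun i => exists_family_of_row hP hΨs hΨ z₀ i k
    (χ := fun _ => 1) contDiff_const
  simp only [one_mul] at hΦe
  set K := Metric.closedBall z₀ (3 / 2 * ((2 : ℝ) ^ j₀)⁻¹)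
  have hKc : IsClosed K := Metric.isClosed_closedBall
  refine ⟨P.waveRHS φ s z₀ Φ a, waveRHS_mem_Q 𝒜 hP hφ hε hs hΦ hΦ' ha ha0 hK, fun U => ⟨?_, ?_, ?_⟩,
    ?_, ?_⟩
  · intro i χ hχ _
    -- A smooth cutoff is absorbed into the coefficients of the operator, so χ f is again a wave of
    -- order s. This holds for every χ, hence for every U.
    obtain ⟨Φ', h1, h2, h3⟩ := exists_family_of_row hP hΨs hΨ z₀ i k hχ
    refine hNormOn_wave_lt_top hφ hb hs0 z₀ h1 ha P.Ω (EventuallyEq.of_eq ?_)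
    funext z
    change χ z * wave φ P.b s z₀ (Φ i) a z = _
    unfold wave
    rw [← tsum_mul_left]
    refine tsum_congr fun j => ?_
    rw [← h3, ← hΦe]
    ring
  · intro j χ _ _
    change P.normS 𝒜 _ φ (χ * 0) < ⊤
    rw [mul_zero, P.normS_eq_zero 𝒜 _ _ (η := 0) fun _ _ => rfl]
    exact ENNReal.zero_lt_top
  · intro k r χ _ _
    change P.normG _ φ (χ * 0) < ⊤
    rw [mul_zero, normG_zero]
    exact ENNReal.zero_lt_top
  · intro k'
    by_cases hk : k' = k
    · subst hk
      rw [Pi.single_eq_same]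
      obtain ⟨C, hC⟩ := exists_hNormOn_le_of_lt hφ P.b (d := P.n)
        (add_lt_add_left hs' (2 * P.b * P.ϰ k'))
      exact (hC P.Ω _).trans_lt (ENNReal.mul_lt_top ENNReal.ofReal_lt_top
        (hNormOn_wave_lt_top hφ hb hbase z₀ hcb ha P.Ω (EventuallyEq.refl _ _)))
    · rw [Pi.single_eq_of_ne hk]
      exact (hNormOn_zero _ _ _ _).trans_lt ENNReal.zero_lt_top
  · let c : ℕ → ℂ := fun j => ((a j * waveCoeff φ P.n P.b (s + 2 * P.b * P.ϰ k) j : ℝ) : ℂ)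
    let g : ℕ → SpT P.n → ℂ := fun j z => Ψ (dilation P.b (2 ^ j) (z - z₀))
    have hg : ∀ j, ContDiff ℝ ∞ (g j) := fun j =>
      hΨs.comp ((dilation P.b _).contDiff.comp (contDiff_id.sub contDiff_const))
    -- Partial sums of the wave: the smooth functions through which the extension of `Λ` by
    -- continuity is computed.
    let w : ℕ → SpT P.n → ℂ := fun N z => ∑ j ∈ Finset.range N, c j * g j z
    have hw : ∀ N, ContDiff ℝ ∞ (w N) := fun N =>
      ContDiff.sum fun j _ => contDiff_const.mul (hg j)
    have hw0 : ∀ N, ∀ z ∉ K, w N z = 0 := by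
      intro N z hz
      refine Finset.sum_eq_zero fun j _ => ?_
      by_cases hj : j < j₀
      · simp [c, ha0 j hj]
      · have : g j z = 0 := term_eq_zero hb (hcs j) (not_lt.1 hj) hz
        rw [this, mul_zero]
    have hlat : ∀ z : SpT P.n, z.fst ∈ frontier P.G → z ∉ K := fun z hz hzK => by
      have h1 := (hK hzK).1
      rw [hP.G_open.frontier_eq] at hz
      exact hz.2 h1
    have hsum : ∀ (N : ℕ) (M : Fin P.N → ℤ) (A : Fin P.N → (Fin P.n → ℕ) × ℕ → SpT P.n → ℂ)
        (z : SpT P.n), ∑ k', ∑ q ∈ idxLE P.n P.b (M k'), A k' q z *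
          Dxt q.1 q.2 ((Pi.single k (w N) : Fin P.N → SpT P.n → ℂ) k') z =
        ∑ q ∈ idxLE P.n P.b (M k), A k q z * Dxt q.1 q.2 (w N) z := by
      intro N M A z
      rw [Finset.sum_eq_single k, Pi.single_eq_same]
      · intro k' _ hk
        rw [Pi.single_eq_of_ne hk]
        simp [Dxt_zero]
      · simp
    refine ⟨fun N => Pi.single k (w N), fun N k' => ?_, fun k' => ?_, ?_⟩
    · beta_reduce
      by_cases hk : k' = k
      · subst hk; rw [Pi.single_eq_same]; exact hw N
      · rw [Pi.single_eq_of_ne hk]; exact contDiff_const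
    · by_cases hk : k' = k
      · subst hk
        simp only [Pi.single_eq_same]
        refine tendsto_hNormOn_of_lt hφ P.b (add_lt_add_left hs' _) ?_
        exact tendsto_hNormOn_wave_sub hφ hb hbase z₀ hcb hcs ha P.Ω (EventuallyEq.refl _ _)
          fun N z => rfl
      · simp only [Pi.single_eq_of_ne hk, sub_zero]
        have : P.normΩ (P.σ₀ + 2 * P.b * P.ϰ k') 1 0 = 0 := hNormOn_zero _ _ _ _
        rw [this]
        exact tendsto_const_nhds
    · refine P.tendsto_normH 𝒜 _ _ (fun i => ?_) (fun N j z hz => ?_) fun N => ?_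
      -- Convergence takes place at order s with parameter φ and passes to σ₀ < s with φ = 1. The
      -- operator applied to the N-th partial sum of u is the N-th partial sum of f, term by term.
      · refine tendsto_hNormOn_of_lt hφ P.b hs' ?_
        refine tendsto_hNormOn_wave_sub hφ hb hs0 z₀ (hΦ i) (hΦ' i) ha P.Ω (EventuallyEq.refl _ _)
          fun N z => ?_
        change wave φ P.b s z₀ (Φ i) a z - ∑ k', ∑ q ∈ idxLE P.n P.b (2 * P.b * P.ϰ k'),
          P.a i k' q.1 q.2 z *
            Dxt q.1 q.2 ((Pi.single k (w N) : Fin P.N → SpT P.n → ℂ) k') z = _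
        rw [hsum N (fun k' => 2 * P.b * P.ϰ k') (fun k' q => P.a i k' q.1 q.2)]
        congr 1
        have e1 : ∀ q : (Fin P.n → ℕ) × ℕ, Dxt q.1 q.2 (w N) z =
            ∑ j ∈ Finset.range N, c j * Dxt q.1 q.2 (g j) z := fun q =>
          congrFun (Dxt_sum (Finset.range N) c hg q.1 q.2) z
        simp only [e1, ← hΦe i φ s a, Finset.mul_sum]
        rw [Finset.sum_comm]
        refine Finset.sum_congr rfl fun j _ => Finset.sum_congr rfl fun q _ => ?_
        ring
      · change 0 - ∑ k', ∑ q ∈ idxLE P.n P.b (P.l j + 2 * P.b * P.ϰ k'), P.c j k' q.1 q.2 z *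
            Dxt q.1 q.2 ((Pi.single k (w N) : Fin P.N → SpT P.n → ℂ) k') z = 0
        rw [hsum N (fun k' => P.l j + 2 * P.b * P.ϰ k') (fun k' q => P.c j k' q.1 q.2), zero_sub,
          neg_eq_zero]
        exact Finset.sum_eq_zero fun q _ => by
          rw [Dxt_eq_zero hKc (hw0 N) q.1 q.2 z (hlat z hz), mul_zero]
      · funext k' r x
        change 0 - dt r ((Pi.single k (w N) : Fin P.N → SpT P.n → ℂ) k') (pt x 0) = 0
        rw [zero_sub, neg_eq_zero]
        refine dt_eq_zero hKc (fun z hz => ?_) r _ fun hx => pt_zero_notMem_Ω x (hK hx)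
        by_cases hk : k' = k
        · subst hk; rw [Pi.single_eq_same]; exact hw0 N z hz
        · rw [Pi.single_eq_of_ne hk]; rfl

/-- If the integral condition fails, then near every point of the cylinder there is a singular
solution whose right-hand sides satisfy the global as well as the local conditions. -/
theorem exists_singular_solution (hP : P.IsParabolic) {φ : ℝ → ℝ} (hφ : ClassM φ)
    (hφ' : ¬ IntegralCondition φ) {ε : ℝ} (hε : 0 < ε) (hε' : ε < 1 / 2) {p : ℤ}
    (hs : (P.σ₀ : ℝ) < P.limitOrder p) (hp : ∃ k, 0 ≤ p + 2 * P.b * P.ϰ k)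
    {W₀ W : Set (SpT P.n)} (hW₀ : IsOpen W₀) (hne : W₀.Nonempty) (hΩ : W₀ ⊆ P.Ω) (hW : W₀ ⊆ W) :
    ∃ u y, P.MemDomain P.σ₀ 1 u ∧ y ∈ P.Q 𝒜 ε (P.limitOrder p) φ ∧
      (∀ U, P.LocalRHS 𝒜 U (P.limitOrder p) φ y) ∧ P.IsSolution 𝒜 u y ∧
      ¬ P.ContinuityConclusion p u W₀ W := by
  obtain ⟨k, hk⟩ := hp
  obtain ⟨z₀, hz₀⟩ := hne
  obtain ⟨M, hM⟩ := Int.eq_ofNat_of_zero_le hk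
  let i₀ : Fin P.n := ⟨0, zero_lt_two.trans_le hP.two_le_n⟩
  obtain ⟨ψ, hψ, hψ0, hψ1⟩ := exists_cutoff_monomial (coord i₀) M
  have hψc : HasCompactSupport ψ := HasCompactSupport.intro (isCompact_closedBall 0 (3 / 2))
    fun z hz => hψ0 z (by rw [mem_closedBall_zero_iff, not_le] at hz; exact hz.le)
  let Ψ : 𝓢(SpT P.n, ℂ) := hψc.toSchwartzMap hψ
  have hφpos : ∀ j : ℕ, 0 < φ (2 ^ j) := fun j => hφ.pos _ (one_le_pow₀ one_le_two)
  obtain ⟨a, ha0, ha, hadiv⟩ := exists_summable_sq_not_summable_mul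
    (d := fun j => (φ (2 ^ j))⁻¹) (fun j => inv_pos.2 (hφpos j))
    fun h => hφ' (hφ.integralCondition_of_summable h)
  obtain ⟨r, hr, hrΩ⟩ := Metric.nhds_basis_closedBall.mem_iff.1
    ((isOpen_Ω hP).mem_nhds (hΩ hz₀))
  obtain ⟨j₀, hj₀⟩ := pow_unbounded_of_one_lt (3 / 2 / r) (one_lt_two : (1 : ℝ) < 2)
  have hK : Metric.closedBall z₀ (3 / 2 * ((2 : ℝ) ^ j₀)⁻¹) ⊆ P.Ω := by
    refine (Metric.closedBall_subset_closedBall ?_).trans hrΩ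
    rw [div_lt_iff₀ hr] at hj₀
    rw [← div_eq_mul_inv, div_le_iff₀ (by positivity), mul_comm]
    exact hj₀.le
  -- Dropping the first j₀ entries localizes the support and affects neither the ℓ² bound nor the
  -- divergence.
  have hta : Summable fun j => tailSeq j₀ a j ^ 2 := summable_tailSeq ha j₀
  have htdiv : ¬ Summable fun j => tailSeq j₀ a j * (φ (2 ^ j))⁻¹ := by
    intro h
    refine hadiv ((summable_nat_add_iff j₀).1 ?_)
    simpa [tailSeq] using (summable_nat_add_iff j₀).2 h
  -- The limit order is half an integer and exceeds σ₀ ≥ 0, so it is at least 1/2 > ε.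
  have hsε : 0 < P.limitOrder p - ε := by
    have h2 : (2 : ℝ) * P.limitOrder p = ((2 * p + 2 * P.b + P.n : ℤ) : ℝ) := by
      rw [limitOrder]; push_cast; ring
    have h0 : (0 : ℝ) ≤ P.σ₀ := Nat.cast_nonneg _
    have h3 : (0 : ℝ) < ((2 * p + 2 * P.b + P.n : ℤ) : ℝ) := by rw [← h2]; linarith
    have h4 : (1 : ℝ) ≤ ((2 * p + 2 * P.b + P.n : ℤ) : ℝ) := by exact_mod_cast h3
    linarith
  obtain ⟨y, hyQ, hyL, hsol⟩ := exists_solution 𝒜 hP hφ hε hsε hs k (Ψ := Ψ) hψ0 hta (j₀ := j₀)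
    (fun j hj => by simp [tailSeq, hj]) hK
  refine ⟨_, y, hsol.1, hyQ, hyL, hsol, fun hcc => ?_⟩
  have hM' : (M : ℝ) = p + 2 * P.b * P.ϰ k := by exact_mod_cast hM.symm
  have h := hcc k (Pi.single i₀ M) 0 (by rw [hM]; simp)
  rw [Pi.single_eq_same] at h
  refine not_continuousDerivOn_wave hφ i₀ M (Ψ := Ψ) ?_ hψ0 hψ1 (fun j => ?_) htdiv hW₀ hz₀ hW h
  -- The order of the wave is s + 2bϰ_k = M + b + n/2, the critical one for M derivatives.
  · rw [limitOrder, hM']; ring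
  · unfold tailSeq; split_ifs
    · exact le_rfl
    · exact ha0 j

end Problem

end

end Parabolic

end

/-! ### The global and local statements, and the Sobolev case φ = 1 -/

theorem mainTheorem5 (P : Parabolic.Problem) (hP : P.IsParabolic)
    (𝒜 : Parabolic.BoundaryAtlas P.G) (ε : ℝ) (hε : 0 < ε) (hε' : ε < 1 / 2)
    (p : ℤ) (hs : (P.σ₀ : ℝ) < P.limitOrder p) (hp : ∃ k, 0 ≤ p + 2 * P.b * P.ϰ k) :
    (∀ φ : ℝ → ℝ, Parabolic.ClassM φ →
      (P.GlobalImplication 𝒜 ε p φ → Parabolic.IntegralCondition φ) ∧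
      ∀ U, P.IsAdmissible U →
        (P.LocalImplication 𝒜 U p φ → Parabolic.IntegralCondition φ)) ∧
    ¬ P.GlobalImplication 𝒜 ε p 1 ∧
    ∀ U, P.IsAdmissible U → ¬ P.LocalImplication 𝒜 U p 1 := by
  have key : ∀ φ : ℝ → ℝ, Parabolic.ClassM φ →
      (P.GlobalImplication 𝒜 ε p φ → Parabolic.IntegralCondition φ) ∧
      ∀ U, P.IsAdmissible U →
        (P.LocalImplication 𝒜 U p φ → Parabolic.IntegralCondition φ) := by
    intro φ hφ
    have hΩo := Parabolic.Problem.isOpen_Ω hP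
    refine ⟨fun hG => ?_, fun U hU hL => ?_⟩ <;> by_contra hn
    · have hne : P.Ω.Nonempty := by
        obtain ⟨x, hx⟩ := hP.G_connected.nonempty
        exact ⟨Parabolic.pt x (P.τ / 2), hx, half_pos hP.τ_pos, half_lt_self hP.τ_pos⟩
      obtain ⟨u, y, hu, hyQ, -, hsol, hcc⟩ := Parabolic.Problem.exists_singular_solution 𝒜 hP hφ hn
        hε hε' hs hp hΩo hne subset_rfl subset_closure
      exact hcc (hG u hu ⟨y, hyQ, hsol⟩)
    · obtain ⟨u, y, hu, -, hyL, hsol, hcc⟩ := Parabolic.Problem.exists_singular_solution 𝒜 hP hφ hn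
        hε hε' hs hp (hU.1.inter hΩo) hU.2.1 inter_subset_right
        (subset_union_left : U ∩ P.Ω ⊆ P.Ωloc U)
      exact hcc (hL u hu ⟨y, hyL U, hsol⟩)
  exact ⟨key, fun h => Parabolic.not_integralCondition_one ((key 1 Parabolic.classM_one).1 h),
    fun U hU h => Parabolic.not_integralCondition_one ((key 1 Parabolic.classM_one).2 U hU h)⟩
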